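/- Conventions. Gradings are by a torsion-free abelian group $\Gamma$. A *graded division ring* is a nonzero graded ring in which every nonzero homogeneous element is invertible; a *graded field* is a commutative one. For a graded division ring $A$, $A_0$ is its component of degree $0$, $A^*$ its unit group, and $\Gamma_A\subseteq\Gamma$ the group of degrees of its nonzero homogeneous elements. Let $F$ be a graded field and $D$ a graded central division algebra over $F$, i.e. a graded division ring which is a graded $F$-algebra, finitely generated as an $F$-module, with center $F$; put $\deg D=\sqrt{[D:F]}$. $D$ is *semiramified* if $D_0$ is a field and $[D_0:F_0]=(\Gamma_D:\Gamma_F)=\deg D$. In that case $D_0/F_0$ is Galois, and sending the class of $\gamma\in\Gamma_D$ to the restriction to $D_0$ of conjugation by any nonzero homogeneous element of degree $\gamma$ is an isomorphism $\Gamma_D/\Gamma_F\cong G:=\mathrm{Gal}(D_0/F_0)$. A *graded subfield* of $D$ is a commutative graded $F$-subalgebra in which every nonzero homogeneous element is invertible. $D$ is *cyclic* if it has a maximal graded subfield $K$ such that $\mathrm{Frac}(K)/\mathrm{Frac}(F)$ is a Galois extension with cyclic Galois group. The cocycle $d$. Let $D$ be semiramified. Choose $\delta_1,\dots,\delta_r\in\Gamma_D$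 whose classes, of orders $q_1,\dots,q_r$, form a basis of $\Gamma_D/\Gamma_F$ (every class is $\sum m_i\bar\delta_i$ for exactly one $m\in I=\prod_i\{0,\dots,q_i-1\}$), homogeneous $x_i\in F^*$ of degree $q_i\delta_i$ and homogeneous $z_i\in D^*$ of degree $\delta_i$. For $m,n\in I$ put $z^m=z_1^{m_1}\cdots z_r^{m_r}$, let $\beta(m+n)\in I$ be the reduction of $m+n$ modulo $(q_1,\dots,q_r)$, write $m_i+n_i=\beta(m+n)_i+t_iq_i$, and define $d(m,n)\in D_0^*$ by $z^mz^n=d(m,n)\,\big(\prod_i x_i^{t_i}\big)\,z^{\beta(m+n)}$. Identifying $I$ with $\Gamma_D/\Gamma_F\cong G$, one gets a $2$-cocycle $d\in Z^2(G,D_0^*)$. Its crossed product is $(D_0/F_0,G,d)=\bigoplus_{\tau\in G}D_0x_\tau$ with $x_\tau a=\tau(a)x_\tau$ and $x_\tau x_\rho=d(\tau,\rho)x_{\tau\rho}$. Further notation. For a finite cyclic Galois extension $L/M$ of degree $e$, a generator $\sigma$ of $\mathrm{Gal}(L/M)$ and $u\in M^*$, $(L/M,\sigma,u)=\bigoplus_{i=0}^{e-1}Lx^i$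 with $xa=\sigma(a)x$ and $x^e=u$. For a finite Galois extension $M/k$ whose group has exponent $m$, $\mathrm{KUM}(M/k)=\{x\in M^*: x^m\in k\}$ and $\mathrm{kum}(M/k)=\mathrm{KUM}(M/k)/k^*$. For $M$-algebras, $A\sim B$ means that the matrix algebras $M_p(A)$ and $M_q(B)$ are isomorphic over $M$ for some $p,q\ge1$. **Theorem 2.14.** Let $F$ be a graded field, $D$ a semiramified graded central division algebra over $F$, and $d$ the cocycle attached as above to any choice of $(\delta_i),(x_i),(z_i)$. If $F_0$ contains a primitive $\deg(D)$-th root of unity, then the following are equivalent: (1) $D$ is cyclic; (2) there is a field $M$ with $F_0\subseteq M\subseteq D_0$ such that (i) $M/F_0$ and $D_0/M$ are cyclic Galois extensions, and (ii) $(D_0/F_0,G,d)\otimes_{F_0}M\sim(D_0/M,\sigma,u)$ for some generator $\sigma$ of $\mathrm{Gal}(D_0/M)$ and some $u\in\mathrm{KUM}(M/F_0)$ whose class $uF_0^*$ generates $\mathrm{kum}(M/F_0)$. -/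

import Mathlib

set_option linter.unusedSectionVars false

open scoped TensorProduct

/-! ### Graded division rings -/

/-- A ring graded by an abelian group is a graded division ring if it is nontrivial and all its
nonzero homogeneous elements are invertible. A commutative graded division ring is a
graded field. -/
class IsGradedDivisionRing {Γ A : Type*} [AddCommGroup Γ] [DecidableEq Γ] [Ring A]
    (𝒜 : Γ → AddSubgroup A) [GradedRing 𝒜] : Prop where
  nontrivial : Nontrivial A
  isUnit_of_mem : ∀ (γ : Γ) (a : A), a ∈ 𝒜 γ → a ≠ 0 → IsUnit a

/-- The component of degree `0` is commutative. -/
class IsCommDegreeZero {Γ A : Type*} [AddCommGroup Γ] [Ring A] (𝒜 : Γ → AddSubgroup A) :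
    Prop where
  comm : ∀ a b : A, a ∈ 𝒜 0 → b ∈ 𝒜 0 → a * b = b * a

instance instIsCommDegreeZeroOfCommRing {Γ A : Type*} [AddCommGroup Γ] [CommRing A]
    (𝒜 : Γ → AddSubgroup A) : IsCommDegreeZero 𝒜 :=
  ⟨fun a b _ _ => mul_comm a b⟩

namespace IsGradedDivisionRing

section

variable {Γ A : Type*} [AddCommGroup Γ] [DecidableEq Γ] [Ring A]
  (𝒜 : Γ → AddSubgroup A) [GradedRing 𝒜]

theorem inv_mem {γ : Γ} (z : Aˣ) (hz : (z : A) ∈ 𝒜 γ) : ((z⁻¹ : Aˣ) : A) ∈ 𝒜 (-γ) := by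
  have h := DirectSum.coe_decompose_mul_add_of_left_mem 𝒜 (i := γ) (j := -γ)
    (b := ((z⁻¹ : Aˣ) : A)) hz
  rw [Units.mul_inv, add_neg_cancel,
    DirectSum.decompose_of_mem_same 𝒜 (SetLike.GradedOne.one_mem)] at h
  have h2 : ((z⁻¹ : Aˣ) : A) = (DirectSum.decompose 𝒜 ((z⁻¹ : Aˣ) : A) (-γ) : A) := by
    have := congrArg (fun t => ((z⁻¹ : Aˣ) : A) * t) h
    simpa using this
  rw [h2]
  exact SetLike.coe_mem _

variable [IsGradedDivisionRing 𝒜]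

theorem exists_unit {γ : Γ} (h : 𝒜 γ ≠ ⊥) : ∃ z : Aˣ, (z : A) ∈ 𝒜 γ := by
  obtain ⟨a, ha⟩ := AddSubgroup.ne_bot_iff_exists_ne_zero.1 h
  obtain ⟨z, hz⟩ := isUnit_of_mem (𝒜 := 𝒜) γ (a : A) a.2 (fun h => ha (Subtype.ext h))
  exact ⟨z, hz ▸ a.2⟩

theorem ne_bot_of_unit {γ : Γ} (z : Aˣ) (hz : (z : A) ∈ 𝒜 γ) : 𝒜 γ ≠ ⊥ := by
  have := nontrivial (𝒜 := 𝒜)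
  intro h
  rw [h, AddSubgroup.mem_bot] at hz
  exact z.ne_zero hz

/-- A graded division ring graded by a torsion-free abelian group has no zero divisors. -/
theorem noZeroDivisors {Γ A : Type*} [AddCommGroup Γ] [DecidableEq Γ] [IsAddTorsionFree Γ]
    [Ring A] (𝒜 : Γ → AddSubgroup A) [GradedRing 𝒜] [IsGradedDivisionRing 𝒜] :
    NoZeroDivisors A := by
  classical
  have hU : UniqueSums Γ :=
    UniqueSums.of_injective_addHom (DivisibleHull.coeAddMonoidHom (M := Γ)).toAddHom
      DivisibleHull.coe_injective inferInstance
  refine ⟨fun {a b} hab => ?_⟩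
  by_contra! hne
  obtain ⟨ha, hb⟩ := hne
  set f := DirectSum.decompose 𝒜 a with hf
  set g := DirectSum.decompose 𝒜 b with hg
  have hf0 : f ≠ 0 := fun h => ha (by
    simpa using congrArg (DirectSum.decompose 𝒜).symm (hf.symm.trans h))
  have hg0 : g ≠ 0 := fun h => hb (by
    simpa using congrArg (DirectSum.decompose 𝒜).symm (hg.symm.trans h))
  have hS : f.support.Nonempty := by
    rw [Finset.nonempty_iff_ne_empty]; simpa [DFinsupp.support_eq_empty] using hf0
  have hT : g.support.Nonempty := by
    rw [Finset.nonempty_iff_ne_empty]; simpa [DFinsupp.support_eq_empty] using hg0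
  obtain ⟨i, hi, j, hj, hij⟩ := UniqueSums.uniqueAdd_of_nonempty hS hT
  have h0 : ((f * g) (i + j) : A) = 0 := by
    rw [hf, hg, ← DirectSum.decompose_mul, hab]; simp
  rw [DirectSum.coe_mul_apply, Finset.sum_eq_single_of_mem (i, j)] at h0
  · have hi' : (f i : A) ≠ 0 := by simpa using hi
    have hj' : (g j : A) ≠ 0 := by simpa using hj
    have hu := isUnit_of_mem (𝒜 := 𝒜) i (f i) (SetLike.coe_mem _) hi'
    exact hj' ((hu.mul_right_eq_zero).1 h0)
  · simp only [Finset.mem_filter, Finset.mem_product]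
    exact ⟨⟨hi, hj⟩, trivial⟩
  · rintro ⟨p, q⟩ hpq hne
    simp only [Finset.mem_filter, Finset.mem_product] at hpq
    obtain ⟨rfl, rfl⟩ := hij hpq.1.1 hpq.1.2 hpq.2
    exact absurd rfl hne

/-- The support of a graded division ring, as a subgroup of the grading group. -/
def support : AddSubgroup Γ where
  carrier := {γ | 𝒜 γ ≠ ⊥}
  zero_mem' := ne_bot_of_unit 𝒜 1 SetLike.GradedOne.one_mem
  add_mem' := fun {a b} ha hb => by
    obtain ⟨y, hy⟩ := exists_unit 𝒜 ha
    obtain ⟨z, hz⟩ := exists_unit 𝒜 hb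
    exact ne_bot_of_unit 𝒜 (y * z) (SetLike.GradedMul.mul_mem hy hz)
  neg_mem' := fun {a} ha => by
    obtain ⟨z, hz⟩ := exists_unit 𝒜 ha
    exact ne_bot_of_unit 𝒜 z⁻¹ (inv_mem 𝒜 z hz)

theorem mem_support {γ : Γ} : γ ∈ support 𝒜 ↔ 𝒜 γ ≠ ⊥ := Iff.rfl

end

theorem isDomain {Γ F : Type*} [AddCommGroup Γ] [DecidableEq Γ] [IsAddTorsionFree Γ]
    [CommRing F] (ℱ : Γ → AddSubgroup F) [GradedRing ℱ] [IsGradedDivisionRing ℱ] : IsDomain F :=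
  have := nontrivial (𝒜 := ℱ)
  have := noZeroDivisors ℱ
  NoZeroDivisors.to_isDomain F

end IsGradedDivisionRing

/-- The component of degree `0` of a graded ring. -/
def DegreeZero {Γ A : Type*} [AddCommGroup Γ] [Ring A] (𝒜 : Γ → AddSubgroup A) : Type _ :=
  𝒜 0

namespace DegreeZero

open IsGradedDivisionRing

variable {Γ A : Type*} [AddCommGroup Γ] [DecidableEq Γ] [Ring A]
  (𝒜 : Γ → AddSubgroup A) [GradedRing 𝒜] [IsGradedDivisionRing 𝒜] [IsCommDegreeZero 𝒜]

/-- The ring structure inherited from the graded ring. -/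
@[reducible] def ring {Γ A : Type*} [AddCommGroup Γ] [DecidableEq Γ] [Ring A]
    (𝒜 : Γ → AddSubgroup A) [GradedRing 𝒜] : Ring (DegreeZero 𝒜) := inferInstanceAs (Ring (𝒜 0))

/-- The component of degree `0` of a graded division ring is a field if it is commutative; the
operations are those of the graded ring. -/
noncomputable instance instField : Field (DegreeZero 𝒜) :=
  letI : CommRing (DegreeZero 𝒜) :=
    { ring 𝒜 with
      mul_comm := fun a b => Subtype.ext (IsCommDegreeZero.comm (𝒜 := 𝒜) a.1 b.1 a.2 b.2) }
  have : Nontrivial A := nontrivial (𝒜 := 𝒜)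
  have : Nontrivial (DegreeZero 𝒜) := ⟨⟨0, 1, fun h => zero_ne_one (congrArg Subtype.val h)⟩⟩
  Field.ofIsUnitOrEqZero fun a => by
    by_cases h : a = 0
    · exact Or.inr h
    · left
      obtain ⟨z, hz⟩ := isUnit_of_mem (𝒜 := 𝒜) 0 a.1 a.2 (fun h' => h (Subtype.ext h'))
      have hi := inv_mem 𝒜 z (γ := 0) (hz ▸ a.2)
      rw [neg_zero] at hi
      exact IsUnit.of_mul_eq_one ⟨_, hi⟩ (Subtype.ext (by
        change a.1 * ((z⁻¹ : Aˣ) : A) = 1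
        rw [← hz, Units.mul_inv]))

/-- The inclusion of the component of degree `0`. -/
def incl : DegreeZero 𝒜 →+* A where
  toFun a := a.1
  map_one' := rfl
  map_mul' _ _ := rfl
  map_zero' := rfl
  map_add' _ _ := rfl

theorem incl_mem (a : DegreeZero 𝒜) : incl 𝒜 a ∈ 𝒜 0 := a.2

theorem incl_injective : Function.Injective (incl 𝒜) := Subtype.val_injective

/-- A homogeneous element of degree `0`, as an element of the component of degree `0`. -/
def ofMem (a : A) (ha : a ∈ 𝒜 0) : DegreeZero 𝒜 := ⟨a, ha⟩

@[simp]
theorem incl_ofMem (a : A) (ha : a ∈ 𝒜 0) : incl 𝒜 (ofMem 𝒜 a ha) = a := rfl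

end DegreeZero

/-! ### Algebras over a graded field -/

/-- The structure map of the `F`-algebra `D` preserves degrees. -/
class IsGradedAlgebraOver {Γ F D : Type*} [AddCommGroup Γ] [CommRing F] [Ring D] [Algebra F D]
    (ℱ : Γ → AddSubgroup F) (𝒟 : Γ → AddSubgroup D) : Prop where
  algebraMap_mem : ∀ (γ : Γ) (c : F), c ∈ ℱ γ → algebraMap F D c ∈ 𝒟 γ

namespace IsGradedAlgebraOver

open IsGradedDivisionRing

theorem decompose_algebraMap {Γ F D : Type*} [AddCommGroup Γ] [DecidableEq Γ] [CommRing F] [Ring D]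
    [Algebra F D] (ℱ : Γ → AddSubgroup F) (𝒟 : Γ → AddSubgroup D) [GradedRing ℱ] [GradedRing 𝒟]
    [IsGradedAlgebraOver ℱ 𝒟] (c : F) (γ : Γ) :
    (DirectSum.decompose 𝒟 (algebraMap F D c) γ : D)
      = algebraMap F D (DirectSum.decompose ℱ c γ : F) := by
  classical
  induction c using DirectSum.Decomposition.inductionOn ℱ with
  | zero => simp
  | @homogeneous i m =>
    have hm : algebraMap F D (m : F) ∈ 𝒟 i := algebraMap_mem (ℱ := ℱ) i m m.2
    by_cases h : i = γ
    · subst h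
      rw [DirectSum.decompose_of_mem_same 𝒟 hm, DirectSum.decompose_of_mem_same ℱ m.2]
    · rw [DirectSum.decompose_of_mem_ne 𝒟 hm h, DirectSum.decompose_of_mem_ne ℱ m.2 h, map_zero]
  | add a b ha hb => simp [ha, hb]

theorem algebraMap_injective {Γ F D : Type*} [AddCommGroup Γ] [DecidableEq Γ] [CommRing F] [Ring D]
    [Algebra F D] (ℱ : Γ → AddSubgroup F) (𝒟 : Γ → AddSubgroup D) [GradedRing ℱ] [GradedRing 𝒟]
    [IsGradedDivisionRing ℱ] [IsGradedDivisionRing 𝒟] [IsGradedAlgebraOver ℱ 𝒟] :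
    Function.Injective (algebraMap F D) := by
  have := nontrivial (𝒜 := 𝒟)
  rw [injective_iff_map_eq_zero]
  intro c hc
  have h : ∀ γ, (DirectSum.decompose ℱ c γ : F) = 0 := by
    intro γ
    by_contra hne
    have hu := (isUnit_of_mem (𝒜 := ℱ) γ _ (SetLike.coe_mem _) hne).map (algebraMap F D)
    rw [← decompose_algebraMap ℱ 𝒟, hc] at hu
    simp at hu
  have : DirectSum.decompose ℱ c = 0 := by
    ext γ; simpa using h γ
  simpa using congrArg (DirectSum.decompose ℱ).symm this

theorem faithfulSMul {Γ F D : Type*} [AddCommGroup Γ] [DecidableEq Γ] [CommRing F] [Ring D]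
    [Algebra F D] (ℱ : Γ → AddSubgroup F) (𝒟 : Γ → AddSubgroup D) [GradedRing ℱ] [GradedRing 𝒟]
    [IsGradedDivisionRing ℱ] [IsGradedDivisionRing 𝒟] [IsGradedAlgebraOver ℱ 𝒟] :
    FaithfulSMul F D :=
  (faithfulSMul_iff_algebraMap_injective F D).2 (algebraMap_injective ℱ 𝒟)

/-- `D₀` is an algebra over `F₀`. -/
noncomputable instance instAlgebraZero {Γ F D : Type*} [AddCommGroup Γ] [DecidableEq Γ]
    [CommRing F] [Ring D] [Algebra F D] (ℱ : Γ → AddSubgroup F) (𝒟 : Γ → AddSubgroup D)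
    [GradedRing ℱ] [GradedRing 𝒟] [IsGradedDivisionRing ℱ] [IsGradedDivisionRing 𝒟]
    [IsGradedAlgebraOver ℱ 𝒟] [IsCommDegreeZero 𝒟] :
    Algebra (DegreeZero ℱ) (DegreeZero 𝒟) :=
  RingHom.toAlgebra
    { toFun := fun c =>
        DegreeZero.ofMem 𝒟 (algebraMap F D (DegreeZero.incl ℱ c))
          (algebraMap_mem (ℱ := ℱ) 0 _ (DegreeZero.incl_mem ℱ c))
      map_one' := DegreeZero.incl_injective 𝒟 (by simp)
      map_mul' := fun _ _ => DegreeZero.incl_injective 𝒟 (by simp)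
      map_zero' := DegreeZero.incl_injective 𝒟 (by simp)
      map_add' := fun _ _ => DegreeZero.incl_injective 𝒟 (by simp) }

@[simp]
theorem incl_algebraMap {Γ F D : Type*} [AddCommGroup Γ] [DecidableEq Γ]
    [CommRing F] [Ring D] [Algebra F D] (ℱ : Γ → AddSubgroup F) (𝒟 : Γ → AddSubgroup D)
    [GradedRing ℱ] [GradedRing 𝒟] [IsGradedDivisionRing ℱ] [IsGradedDivisionRing 𝒟]
    [IsGradedAlgebraOver ℱ 𝒟] [IsCommDegreeZero 𝒟] (c : DegreeZero ℱ) :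
    DegreeZero.incl 𝒟 (algebraMap (DegreeZero ℱ) (DegreeZero 𝒟) c)
      = algebraMap F D (DegreeZero.incl ℱ c) := rfl

end IsGradedAlgebraOver

/-! ### Semiramified graded division algebras -/

/-- The degree `√[D : F]` of a graded central division algebra (`D` is a free `F`-module and its
rank is a square). -/
noncomputable def gradedDegree (F D : Type*) [CommRing F] [Ring D] [Algebra F D] : ℕ :=
  Nat.sqrt (Module.finrank F D)

/-- The quotient `Γ_D / Γ_F` of the supports. -/
abbrev SupportQuotient {Γ F D : Type*} [AddCommGroup Γ] [DecidableEq Γ] [CommRing F] [Ring D]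
    (ℱ : Γ → AddSubgroup F) (𝒟 : Γ → AddSubgroup D) [GradedRing ℱ] [GradedRing 𝒟]
    [IsGradedDivisionRing ℱ] [IsGradedDivisionRing 𝒟] : Type _ :=
  IsGradedDivisionRing.support 𝒟 ⧸
    (IsGradedDivisionRing.support ℱ).addSubgroupOf (IsGradedDivisionRing.support 𝒟)

/-- A graded central division algebra `D` over `F` such that `D₀` is a field is semiramified if
`[D₀ : F₀] = (Γ_D : Γ_F) = deg D`. -/
structure IsSemiramified {Γ F D : Type*} [AddCommGroup Γ] [DecidableEq Γ] [CommRing F] [Ring D]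
    [Algebra F D] (ℱ : Γ → AddSubgroup F) (𝒟 : Γ → AddSubgroup D) [GradedRing ℱ] [GradedRing 𝒟]
    [IsGradedDivisionRing ℱ] [IsGradedDivisionRing 𝒟] [IsGradedAlgebraOver ℱ 𝒟]
    [IsCommDegreeZero 𝒟] : Prop where
  finrank_eq : Module.finrank (DegreeZero ℱ) (DegreeZero 𝒟) = gradedDegree F D
  card_eq : Nat.card (SupportQuotient ℱ 𝒟) = gradedDegree F D

section

open IsGradedDivisionRing IsGradedAlgebraOver

variable {Γ F D : Type*} [AddCommGroup Γ] [DecidableEq Γ] [CommRing F] [Ring D] [Algebra F D]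
  (ℱ : Γ → AddSubgroup F) (𝒟 : Γ → AddSubgroup D) [GradedRing ℱ] [GradedRing 𝒟]
  [IsGradedDivisionRing ℱ] [IsGradedDivisionRing 𝒟] [IsGradedAlgebraOver ℱ 𝒟]
  [IsCommDegreeZero 𝒟]

theorem mem_of_eq_degree {A : Type*} [Ring A] {𝒜 : Γ → AddSubgroup A} {a : A} {γ γ' : Γ}
    (h : γ = γ') (ha : a ∈ 𝒜 γ) : a ∈ 𝒜 γ' := h ▸ ha

theorem conj_mem {γ : Γ} (z : Dˣ) (hz : (z : D) ∈ 𝒟 γ) (a : DegreeZero 𝒟) :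
    (z : D) * DegreeZero.incl 𝒟 a * ((z⁻¹ : Dˣ) : D) ∈ 𝒟 0 :=
  mem_of_eq_degree (by abel) (SetLike.GradedMul.mul_mem
    (SetLike.GradedMul.mul_mem hz (DegreeZero.incl_mem 𝒟 a)) (inv_mem 𝒟 z hz))

/-- Conjugation `a ↦ z a z⁻¹` by a homogeneous unit `z`, as an automorphism of `D₀ / F₀`. -/
noncomputable def conjZero {γ : Γ} (z : Dˣ) (hz : (z : D) ∈ 𝒟 γ) :
    DegreeZero 𝒟 ≃ₐ[DegreeZero ℱ] DegreeZero 𝒟 where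
  toFun a := DegreeZero.ofMem 𝒟 _ (conj_mem 𝒟 z hz a)
  invFun a := DegreeZero.ofMem 𝒟 _ (conj_mem 𝒟 z⁻¹ (inv_mem 𝒟 z hz) a)
  left_inv a := DegreeZero.incl_injective 𝒟 (by simp [mul_assoc])
  right_inv a := DegreeZero.incl_injective 𝒟 (by simp [mul_assoc])
  map_mul' a b := DegreeZero.incl_injective 𝒟 (by simp [mul_assoc])
  map_add' a b := DegreeZero.incl_injective 𝒟 (by simp [mul_add, add_mul])
  commutes' c := DegreeZero.incl_injective 𝒟 (by
    rw [DegreeZero.incl_ofMem, incl_algebraMap, ← Algebra.commutes, mul_assoc, Units.mul_inv,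
      mul_one])

theorem incl_conjZero {γ : Γ} (z : Dˣ) (hz : (z : D) ∈ 𝒟 γ) (a : DegreeZero 𝒟) :
    DegreeZero.incl 𝒟 (conjZero ℱ 𝒟 z hz a)
      = (z : D) * DegreeZero.incl 𝒟 a * ((z⁻¹ : Dˣ) : D) := rfl

theorem conjZero_mul {γ γ' : Γ} (y z : Dˣ) (hy : (y : D) ∈ 𝒟 γ) (hz : (z : D) ∈ 𝒟 γ')
    {γ'' : Γ} (hyz : ((y * z : Dˣ) : D) ∈ 𝒟 γ'') :
    conjZero ℱ 𝒟 y hy * conjZero ℱ 𝒟 z hz = conjZero ℱ 𝒟 (y * z) hyz := by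
  ext a
  apply DegreeZero.incl_injective 𝒟
  simp [AlgEquiv.mul_apply, incl_conjZero, mul_assoc]

/-- An invertible homogeneous element of degree `0`, as a unit of `D₀`. -/
def unitZero (z : Dˣ) (hz : (z : D) ∈ 𝒟 0) : (DegreeZero 𝒟)ˣ where
  val := DegreeZero.ofMem 𝒟 z hz
  inv := DegreeZero.ofMem 𝒟 ((z⁻¹ : Dˣ) : D) (mem_of_eq_degree neg_zero (inv_mem 𝒟 z hz))
  val_inv := DegreeZero.incl_injective 𝒟 (by simp)
  inv_val := DegreeZero.incl_injective 𝒟 (by simp)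

@[simp]
theorem incl_unitZero (z : Dˣ) (hz : (z : D) ∈ 𝒟 0) :
    DegreeZero.incl 𝒟 (unitZero 𝒟 z hz : DegreeZero 𝒟) = z := rfl

theorem conjZero_eq_of_eq_mul {γ γ' : Γ} (y z : Dˣ) (hy : (y : D) ∈ 𝒟 γ) (hz : (z : D) ∈ 𝒟 γ')
    (w : DegreeZero 𝒟) (c : F)
    (h : (y : D) = DegreeZero.incl 𝒟 w * algebraMap F D c * z) :
    conjZero ℱ 𝒟 y hy = conjZero ℱ 𝒟 z hz := by
  ext a
  apply DegreeZero.incl_injective 𝒟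
  rw [incl_conjZero, incl_conjZero, Units.mul_inv_eq_iff_eq_mul, h]
  set b := conjZero ℱ 𝒟 z hz a with hb
  have hb' : (z : D) * DegreeZero.incl 𝒟 a = DegreeZero.incl 𝒟 b * z := by
    rw [hb, incl_conjZero]; simp
  have hw : DegreeZero.incl 𝒟 w * DegreeZero.incl 𝒟 b
      = DegreeZero.incl 𝒟 b * DegreeZero.incl 𝒟 w := by
    rw [← map_mul, mul_comm, map_mul]
  calc DegreeZero.incl 𝒟 w * algebraMap F D c * z * DegreeZero.incl 𝒟 a
      = DegreeZero.incl 𝒟 w * (algebraMap F D c * DegreeZero.incl 𝒟 b) * z := by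
        rw [mul_assoc _ (z : D), hb']; simp only [mul_assoc]
    _ = DegreeZero.incl 𝒟 b * (DegreeZero.incl 𝒟 w * algebraMap F D c * z) := by
        rw [Algebra.commutes, ← mul_assoc, hw]; simp only [mul_assoc]
    _ = (z : D) * DegreeZero.incl 𝒟 a * ((z⁻¹ : Dˣ) : D)
          * (DegreeZero.incl 𝒟 w * algebraMap F D c * z) := by
        rw [hb']; simp [mul_assoc]

/-- A choice of homogeneous elements of `D` along a basis of the finite abelian group
`Γ_D / Γ_F`: elements `δ i` of `Γ_D` whose classes, of orders `q i`, form a basis of `Γ_D / Γ_F`,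
units `x i` of `F` of degree `q i • δ i`, and units `z i` of `D` of degree `δ i`. -/
structure HomogeneousFrame where
  r : ℕ
  δ : Fin r → support 𝒟
  /-- Every class is `∑ mᵢ δᵢ` for exactly one family `0 ≤ mᵢ < qᵢ`. -/
  basis : Function.Bijective
    (fun m : (∀ i, Fin (addOrderOf (δ i : SupportQuotient ℱ 𝒟))) =>
      ∑ i, (m i : ℕ) • (δ i : SupportQuotient ℱ 𝒟))
  x : Fin r → Fˣ
  x_mem : ∀ i, (x i : F) ∈ ℱ (addOrderOf (δ i : SupportQuotient ℱ 𝒟) • (δ i : Γ))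
  z : Fin r → Dˣ
  z_mem : ∀ i, (z i : D) ∈ 𝒟 (δ i)

end

namespace HomogeneousFrame

open IsGradedDivisionRing IsGradedAlgebraOver

variable {Γ F D : Type*} [AddCommGroup Γ] [DecidableEq Γ] [CommRing F] [Ring D] [Algebra F D]
  {ℱ : Γ → AddSubgroup F} {𝒟 : Γ → AddSubgroup D} [GradedRing ℱ] [GradedRing 𝒟]
  [IsGradedDivisionRing ℱ] [IsGradedDivisionRing 𝒟] [IsGradedAlgebraOver ℱ 𝒟]
  [IsCommDegreeZero 𝒟] (S : HomogeneousFrame ℱ 𝒟)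

/-- The order of the class of `δ i` in `Γ_D / Γ_F`. -/
noncomputable def q (i : Fin S.r) : ℕ := addOrderOf (S.δ i : SupportQuotient ℱ 𝒟)

/-- The multi-indices `m` with `0 ≤ mᵢ < qᵢ`. -/
abbrev Index : Type := ∀ i, Fin (S.q i)

/-- The multi-index congruent to `m + n` modulo `q`. -/
noncomputable def addIndex (m n : S.Index) : S.Index := fun i =>
  ⟨((m i : ℕ) + n i) % S.q i, Nat.mod_lt _ (Nat.zero_lt_of_lt (m i).2)⟩

/-- The monomial `z₁ ^ m₁ ⋯ z_r ^ m_r`. -/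
noncomputable def zPow (m : S.Index) : Dˣ := (List.ofFn fun i => S.z i ^ (m i : ℕ)).prod

/-- The element `h(m, n) = ∏ xᵢ ^ tᵢ` of `F`, where `mᵢ + nᵢ = (m + n mod q)ᵢ + tᵢ qᵢ`. -/
noncomputable def carry (m n : S.Index) : Fˣ := ∏ i, S.x i ^ (((m i : ℕ) + n i) / S.q i)

theorem addIndex_assoc (m n s : S.Index) :
    S.addIndex (S.addIndex m n) s = S.addIndex m (S.addIndex n s) := by
  funext i
  apply Fin.ext
  simp [addIndex, add_assoc]

theorem carry_cocycle (m n s : S.Index) :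
    S.carry m n * S.carry (S.addIndex m n) s = S.carry n s * S.carry m (S.addIndex n s) := by
  have key : ∀ a b q : ℕ, 0 < q → a / q + (a % q + b) / q = (a + b) / q := by
    intro a b q hq
    conv_rhs => rw [← Nat.div_add_mod a q, add_assoc, Nat.mul_add_div hq]
  simp only [carry, ← Finset.prod_mul_distrib, ← pow_add]
  refine Finset.prod_congr rfl fun i _ => ?_
  have hq : 0 < S.q i := Nat.zero_lt_of_lt (m i).2
  congr 1
  simp only [addIndex]
  rw [key _ _ _ hq, add_comm (m i : ℕ) (((n i : ℕ) + s i) % S.q i), key _ _ _ hq]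
  congr 1; ring

/-- The degree of `zPow m`. -/
noncomputable def zDeg (m : S.Index) : Γ := ∑ i, (m i : ℕ) • (S.δ i : Γ)

theorem zPow_mem (m : S.Index) : (S.zPow m : D) ∈ 𝒟 (S.zDeg m) := by
  have h := SetLike.list_prod_ofFn_mem_graded (A := 𝒟) (n := S.r)
    (fun i => (m i : ℕ) • (S.δ i : Γ)) (fun i => (S.z i : D) ^ (m i : ℕ))
    (fun i => SetLike.pow_mem_graded _ (S.z_mem i))
  rw [List.sum_ofFn] at h
  have e : (S.zPow m : D) = (List.ofFn fun i => (S.z i : D) ^ (m i : ℕ)).prod := by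
    rw [zPow, ← Units.coeHom_apply, map_list_prod, List.map_ofFn]
    rfl
  rw [e]
  exact h

theorem carry_mem (m n : S.Index) :
    (S.carry m n : F) ∈ ℱ (S.zDeg m + S.zDeg n - S.zDeg (S.addIndex m n)) := by
  have h : (∏ i, (S.x i : F) ^ (((m i : ℕ) + n i) / S.q i)) ∈
      ℱ (∑ i, (((m i : ℕ) + n i) / S.q i) • (S.q i • (S.δ i : Γ))) :=
    SetLike.prod_mem_graded _ _ _ (fun i _ => SetLike.pow_mem_graded _ (S.x_mem i))
  have e : (S.carry m n : F) = ∏ i, (S.x i : F) ^ (((m i : ℕ) + n i) / S.q i) := by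
    simp [carry]
  rw [e]
  refine mem_of_eq_degree ?_ h
  rw [eq_sub_iff_add_eq]
  simp only [zDeg, ← Finset.sum_add_distrib]
  refine Finset.sum_congr rfl fun i _ => ?_
  simp only [addIndex]
  rw [← mul_smul, ← add_smul, ← add_smul, mul_comm, Nat.div_add_mod]

/-- The element `z^m z^n (z^(m + n mod q))⁻¹ h(m, n)⁻¹`. -/
noncomputable def quot (m n : S.Index) : Dˣ :=
  S.zPow m * S.zPow n * (S.zPow (S.addIndex m n))⁻¹ *
    (Units.map (algebraMap F D : F →* D) (S.carry m n))⁻¹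

theorem quot_mem (m n : S.Index) : (S.quot m n : D) ∈ 𝒟 0 := by
  have h1 : ((Units.map (algebraMap F D : F →* D) (S.carry m n) : Dˣ) : D) ∈
      𝒟 (S.zDeg m + S.zDeg n - S.zDeg (S.addIndex m n)) :=
    algebraMap_mem (ℱ := ℱ) _ _ (S.carry_mem m n)
  refine mem_of_eq_degree ?_ (SetLike.GradedMul.mul_mem (SetLike.GradedMul.mul_mem
    (SetLike.GradedMul.mul_mem (S.zPow_mem m) (S.zPow_mem n))
    (inv_mem 𝒟 _ (S.zPow_mem (S.addIndex m n)))) (inv_mem 𝒟 _ h1))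
  abel

/-- The element `d(m, n)` of `D₀ˣ` with `z^m z^n = d(m, n) h(m, n) z^(m + n mod q)`. -/
noncomputable def dIndex (m n : S.Index) : (DegreeZero 𝒟)ˣ := unitZero 𝒟 (S.quot m n) (S.quot_mem m n)

theorem zPow_mul_zPow (m n : S.Index) :
    (S.zPow m : D) * S.zPow n
      = DegreeZero.incl 𝒟 (S.dIndex m n) * algebraMap F D (S.carry m n)
        * S.zPow (S.addIndex m n) := by
  rw [dIndex, incl_unitZero]
  have h : S.zPow m * S.zPow n
      = S.quot m n * Units.map (algebraMap F D : F →* D) (S.carry m n)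
        * S.zPow (S.addIndex m n) := by
    simp [quot]
  simpa using congrArg Units.val h

/-- The automorphism of `D₀ / F₀` attached to the class of degree `∑ mᵢ δᵢ` in `Γ_D / Γ_F`. -/
noncomputable def action (m : S.Index) : DegreeZero 𝒟 ≃ₐ[DegreeZero ℱ] DegreeZero 𝒟 :=
  conjZero ℱ 𝒟 (S.zPow m) (S.zPow_mem m)

theorem action_mul (m n : S.Index) : S.action m * S.action n = S.action (S.addIndex m n) := by
  rw [action, action, conjZero_mul ℱ 𝒟 _ _ _ _
    (SetLike.GradedMul.mul_mem (S.zPow_mem m) (S.zPow_mem n))]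
  exact conjZero_eq_of_eq_mul ℱ 𝒟 _ _ _ _ (S.dIndex m n) (S.carry m n) (S.zPow_mul_zPow m n)

theorem zPow_mul_incl (m : S.Index) (a : DegreeZero 𝒟) :
    (S.zPow m : D) * DegreeZero.incl 𝒟 a = DegreeZero.incl 𝒟 (S.action m a) * S.zPow m := by
  rw [action, incl_conjZero]; simp

theorem dIndex_cocycle (m n s : S.Index) :
    (S.dIndex m n : DegreeZero 𝒟) * S.dIndex (S.addIndex m n) s
      = S.action m (S.dIndex n s) * S.dIndex m (S.addIndex n s) := by
  apply DegreeZero.incl_injective 𝒟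
  have h1 : (S.zPow m : D) * S.zPow n * S.zPow s
      = DegreeZero.incl 𝒟 ((S.dIndex m n : DegreeZero 𝒟) * S.dIndex (S.addIndex m n) s)
        * algebraMap F D ((S.carry m n : F) * S.carry (S.addIndex m n) s)
        * S.zPow (S.addIndex (S.addIndex m n) s) := by
    rw [zPow_mul_zPow, mul_assoc _ (S.zPow (S.addIndex m n) : D), zPow_mul_zPow, map_mul, map_mul]
    have := Algebra.commutes (A := D) (S.carry m n : F)
      (DegreeZero.incl 𝒟 (S.dIndex (S.addIndex m n) s))
    simp only [mul_assoc]
    rw [← mul_assoc (algebraMap F D (S.carry m n : F)), this]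
    simp only [mul_assoc]
  have h2 : (S.zPow m : D) * S.zPow n * S.zPow s
      = DegreeZero.incl 𝒟 (S.action m (S.dIndex n s) * S.dIndex m (S.addIndex n s))
        * algebraMap F D ((S.carry n s : F) * S.carry m (S.addIndex n s))
        * S.zPow (S.addIndex m (S.addIndex n s)) := by
    rw [mul_assoc, zPow_mul_zPow S n s, map_mul, map_mul]
    have e1 := Algebra.commutes (A := D) (S.carry n s : F) (S.zPow m : D)
    have e2 := Algebra.commutes (A := D) (S.carry n s : F)
      (DegreeZero.incl 𝒟 (S.dIndex m (S.addIndex n s)))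
    have e3 := S.zPow_mul_zPow m (S.addIndex n s)
    calc (S.zPow m : D) * (DegreeZero.incl 𝒟 (S.dIndex n s) * algebraMap F D (S.carry n s)
            * S.zPow (S.addIndex n s))
        = (S.zPow m : D) * DegreeZero.incl 𝒟 (S.dIndex n s) * algebraMap F D (S.carry n s)
            * S.zPow (S.addIndex n s) := by simp only [mul_assoc]
      _ = DegreeZero.incl 𝒟 (S.action m (S.dIndex n s)) * (algebraMap F D (S.carry n s)
            * (S.zPow m * S.zPow (S.addIndex n s))) := by
          rw [zPow_mul_incl, mul_assoc _ (S.zPow m : D), ← e1]; simp only [mul_assoc]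
      _ = _ := by
          rw [e3, ← mul_assoc (algebraMap F D (S.carry n s : F)),
            ← mul_assoc (algebraMap F D (S.carry n s : F)), e2]
          simp only [mul_assoc]
  have hc : (S.carry m n : F) * S.carry (S.addIndex m n) s
      = (S.carry n s : F) * S.carry m (S.addIndex n s) := by
    exact_mod_cast congrArg Units.val (S.carry_cocycle m n s)
  rw [addIndex_assoc, h2, hc] at h1
  have hu := (S.carry n s * S.carry m (S.addIndex n s)).isUnit.map (algebraMap F D)
  rw [Units.val_mul] at hu
  exact (hu.mul_right_cancel ((S.zPow _).isUnit.mul_right_cancel h1)).symm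

end HomogeneousFrame

namespace IsSemiramified

open IsGradedDivisionRing IsGradedAlgebraOver

variable {Γ F D : Type*} [AddCommGroup Γ] [DecidableEq Γ] [IsAddTorsionFree Γ]
  [CommRing F] [Ring D] [Algebra F D]
  {ℱ : Γ → AddSubgroup F} {𝒟 : Γ → AddSubgroup D} [GradedRing ℱ] [GradedRing 𝒟]
  [IsGradedDivisionRing ℱ] [IsGradedDivisionRing 𝒟] [IsGradedAlgebraOver ℱ 𝒟]
  [Algebra.IsCentral F D] [Module.Finite F D] [IsCommDegreeZero 𝒟]

theorem gradedDegree_pos {Γ F D : Type*} [AddCommGroup Γ] [DecidableEq Γ] [IsAddTorsionFree Γ]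
    [CommRing F] [Ring D] [Algebra F D] (ℱ : Γ → AddSubgroup F) (𝒟 : Γ → AddSubgroup D)
    [GradedRing ℱ] [GradedRing 𝒟] [IsGradedDivisionRing ℱ] [IsGradedDivisionRing 𝒟]
    [IsGradedAlgebraOver ℱ 𝒟] [Module.Finite F D] : 0 < gradedDegree F D := by
  have := isDomain ℱ
  have := noZeroDivisors 𝒟
  have := IsGradedDivisionRing.nontrivial (𝒜 := 𝒟)
  have := faithfulSMul ℱ 𝒟
  have : Module.IsTorsionFree F D := inferInstance
  exact Nat.sqrt_pos.2 Module.finrank_pos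

theorem finiteDimensional (hD : IsSemiramified ℱ 𝒟) :
    FiniteDimensional (DegreeZero ℱ) (DegreeZero 𝒟) :=
  Module.finite_of_finrank_pos (by rw [hD.finrank_eq]; exact gradedDegree_pos ℱ 𝒟)

theorem exists_index (S : HomogeneousFrame ℱ 𝒟) {γ : Γ} (z : Dˣ) (hz : (z : D) ∈ 𝒟 γ) :
    ∃ (m : S.Index) (w : DegreeZero 𝒟) (c : F),
      (z : D) = DegreeZero.incl 𝒟 w * algebraMap F D c * S.zPow m := by
  have hγ : γ ∈ support 𝒟 := ne_bot_of_unit 𝒟 z hz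
  obtain ⟨m, hm⟩ := S.basis.2 ((⟨γ, hγ⟩ : support 𝒟) : SupportQuotient ℱ 𝒟)
  have hm' : ((∑ i, (m i : ℕ) • S.δ i : support 𝒟) : SupportQuotient ℱ 𝒟)
      = ((⟨γ, hγ⟩ : support 𝒟) : SupportQuotient ℱ 𝒟) := by
    rw [← hm]
    simp [QuotientAddGroup.mk_sum]
  rw [QuotientAddGroup.eq, AddSubgroup.mem_addSubgroupOf] at hm'
  have hm2 : -S.zDeg m + γ ∈ support ℱ := by
    simpa [HomogeneousFrame.zDeg] using hm'
  obtain ⟨c, hc⟩ := exists_unit ℱ hm2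
  have hc' : ((Units.map (algebraMap F D : F →* D) c : Dˣ) : D) ∈ 𝒟 (-S.zDeg m + γ) :=
    algebraMap_mem (ℱ := ℱ) _ _ hc
  have hw : ((z * (S.zPow m)⁻¹ * (Units.map (algebraMap F D : F →* D) c)⁻¹ : Dˣ) : D) ∈ 𝒟 0 :=
    mem_of_eq_degree (by abel) (SetLike.GradedMul.mul_mem (SetLike.GradedMul.mul_mem hz
      (inv_mem 𝒟 _ (S.zPow_mem m))) (inv_mem 𝒟 _ hc'))
  refine ⟨m, DegreeZero.ofMem 𝒟 _ hw, c, ?_⟩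
  have h : z = z * (S.zPow m)⁻¹ * (Units.map (algebraMap F D : F →* D) c)⁻¹
      * Units.map (algebraMap F D : F →* D) c * S.zPow m := by simp
  exact congrArg Units.val h

theorem mem_range_of_fixed (S : HomogeneousFrame ℱ 𝒟) (a : DegreeZero 𝒟)
    (ha : ∀ m, S.action m a = a) : ∃ c : DegreeZero ℱ, algebraMap _ (DegreeZero 𝒟) c = a := by
  have hcomm : ∀ b : D, b * DegreeZero.incl 𝒟 a = DegreeZero.incl 𝒟 a * b := by
    intro b
    induction b using DirectSum.Decomposition.inductionOn 𝒟 with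
    | zero => simp
    | @homogeneous i y =>
      by_cases hy : (y : D) = 0
      · simp [hy]
      obtain ⟨z, hz⟩ := isUnit_of_mem (𝒜 := 𝒟) i (y : D) y.2 hy
      obtain ⟨m, w, c, h⟩ := exists_index S z (γ := i) (hz ▸ y.2)
      rw [← hz, h, mul_assoc, S.zPow_mul_incl, ha, ← mul_assoc, mul_assoc (DegreeZero.incl 𝒟 w),
        Algebra.commutes, ← mul_assoc, ← map_mul, mul_comm w a, map_mul]
      simp only [mul_assoc]
    | add x y hx hy => rw [add_mul, mul_add, hx, hy]
  have hc : DegreeZero.incl 𝒟 a ∈ Subalgebra.center F D := Subalgebra.mem_center_iff.2 hcomm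
  obtain ⟨f, hf⟩ := Algebra.mem_bot.1 (Algebra.IsCentral.out hc)
  refine ⟨DegreeZero.ofMem ℱ (DirectSum.decompose ℱ f 0 : F) (SetLike.coe_mem _), ?_⟩
  apply DegreeZero.incl_injective 𝒟
  rw [incl_algebraMap, DegreeZero.incl_ofMem, ← decompose_algebraMap ℱ 𝒟, hf,
    DirectSum.decompose_of_mem_same 𝒟 (DegreeZero.incl_mem 𝒟 a)]

theorem isGalois_and_action_bijective (hD : IsSemiramified ℱ 𝒟) (S : HomogeneousFrame ℱ 𝒟) :
    IsGalois (DegreeZero ℱ) (DegreeZero 𝒟) ∧ Function.Bijective S.action := by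
  have hfin := hD.finiteDimensional
  have hconj : ∀ {γ : Γ} (z : Dˣ) (hz : (z : D) ∈ 𝒟 γ),
      ∃ m, S.action m = conjZero ℱ 𝒟 z hz := by
    intro γ z hz
    obtain ⟨m, w, c, h⟩ := exists_index S z hz
    exact ⟨m, (conjZero_eq_of_eq_mul ℱ 𝒟 z _ hz (S.zPow_mem m) w c h).symm⟩
  let R : Subgroup (DegreeZero 𝒟 ≃ₐ[DegreeZero ℱ] DegreeZero 𝒟) :=
    { carrier := Set.range S.action
      mul_mem' := by
        rintro _ _ ⟨m, rfl⟩ ⟨n, rfl⟩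
        exact ⟨_, (S.action_mul m n).symm⟩
      one_mem' := by
        obtain ⟨m, hm⟩ := hconj (γ := 0) (1 : Dˣ) SetLike.GradedOne.one_mem
        refine ⟨m, hm.trans ?_⟩
        ext a
        apply DegreeZero.incl_injective 𝒟
        simp [incl_conjZero]
      inv_mem' := by
        rintro _ ⟨m, rfl⟩
        obtain ⟨n, hn⟩ := hconj _ (inv_mem 𝒟 _ (S.zPow_mem m))
        refine ⟨n, hn.trans ?_⟩
        rw [eq_inv_iff_mul_eq_one]
        ext a
        apply DegreeZero.incl_injective 𝒟
        simp [HomogeneousFrame.action, AlgEquiv.mul_apply, incl_conjZero, mul_assoc] }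
  have hbot : IntermediateField.fixedField R = ⊥ := by
    rw [eq_bot_iff]
    intro a ha
    rw [IntermediateField.mem_bot]
    exact mem_range_of_fixed S a fun m => ha ⟨S.action m, m, rfl⟩
  have hR : R = ⊤ := by
    rw [← IntermediateField.fixingSubgroup_fixedField R, hbot,
      IntermediateField.fixingSubgroup_bot]
  have hgal : IsGalois (DegreeZero ℱ) (DegreeZero 𝒟) := by
    refine IsGalois.of_fixedField_eq_bot _ _ ?_
    rw [← hR, hbot]
  refine ⟨hgal, ?_⟩
  have hcard : Nat.card S.Index
      = Nat.card (DegreeZero 𝒟 ≃ₐ[DegreeZero ℱ] DegreeZero 𝒟) := by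
    rw [IsGalois.card_aut_eq_finrank, hD.finrank_eq, ← hD.card_eq]
    exact Nat.card_congr (Equiv.ofBijective _ S.basis)
  refine Function.Surjective.bijective_of_nat_card_le (fun σ => ?_) hcard.le
  have : σ ∈ R := hR ▸ Subgroup.mem_top σ
  exact this

end IsSemiramified

/-! ### Crossed products -/

/-- A factor set of the group `H` in the `k`-algebra `A`, where `H` acts by automorphisms over
`k`. -/
structure FactorSet (k H A : Type*) [CommRing k] [Group H] [Ring A] [Algebra k A] where
  ω : H → (A ≃ₐ[k] A)
  f : H → H → Aˣ
  ω_comp : ∀ σ τ a, ω σ (ω τ a) = f σ τ * ω (σ * τ) a * ((f σ τ)⁻¹ : Aˣ)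
  cocycle : ∀ σ τ μ, (f σ τ : A) * f (σ * τ) μ = ω σ (f τ μ) * f σ (τ * μ)

/-- The crossed product `(A, H, (ω, f)) = ⨁ A x_σ`. -/
def CrossedProduct {k H A : Type*} [CommRing k] [Group H] [Ring A] [Algebra k A]
    (_S : FactorSet k H A) : Type _ := H →₀ A

namespace CrossedProduct

variable {k H A : Type*} [CommRing k] [Group H] [Ring A] [Algebra k A] (S : FactorSet k H A)

noncomputable instance instAddCommGroup : AddCommGroup (CrossedProduct S) :=
  inferInstanceAs (AddCommGroup (H →₀ A))

noncomputable instance instModule : Module k (CrossedProduct S) :=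
  inferInstanceAs (Module k (H →₀ A))

/-- The element `a x_σ`. -/
noncomputable def term (σ : H) (a : A) : CrossedProduct S := Finsupp.single σ a

/-- `a ↦ a x_σ` as a homomorphism of additive groups. -/
noncomputable def termHom (σ : H) : A →+ CrossedProduct S := Finsupp.singleAddHom σ

theorem term_add (σ : H) (a b : A) : term S σ (a + b) = term S σ a + term S σ b :=
  (termHom S σ).map_add a b

theorem smul_term (c : k) (σ : H) (a : A) : c • term S σ a = term S σ (c • a) :=
  Finsupp.smul_single c σ a

theorem induction {p : CrossedProduct S → Prop} (y : CrossedProduct S) (h0 : p 0)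
    (hadd : ∀ y z, p y → p z → p (y + z)) (hterm : ∀ σ a, p (term S σ a)) : p y :=
  Finsupp.induction_linear (motive := p) y h0 hadd hterm

theorem term_zero (σ : H) : term S σ (0 : A) = 0 := (termHom S σ).map_zero

/-- `b ↦ (a x_σ) (b x_τ)`, as a homomorphism of additive groups. -/
noncomputable def mulTermHom (σ τ : H) (a : A) : A →+ CrossedProduct S :=
  AddMonoidHom.mk' (fun b => term S (σ * τ) (a * S.ω σ b * S.f σ τ)) fun b c => by
    rw [map_add, mul_add, add_mul, term_add]

theorem mulTermHom_add (σ τ : H) (a b : A) :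
    mulTermHom S σ τ (a + b) = mulTermHom S σ τ a + mulTermHom S σ τ b :=
  AddMonoidHom.ext fun c => by
    simp only [mulTermHom, AddMonoidHom.mk'_apply, AddMonoidHom.add_apply]
    rw [add_mul, add_mul, term_add]

/-- Additive homomorphisms out of the crossed product are determined termwise. -/
noncomputable def liftHom {B : Type*} [AddCommGroup B] (g : H → A →+ B) : CrossedProduct S →+ B :=
  (Finsupp.liftAddHom g : (H →₀ A) →+ B)

theorem liftHom_term {B : Type*} [AddCommGroup B] (g : H → A →+ B) (σ : H) (a : A) :
    liftHom S g (term S σ a) = g σ a :=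
  Finsupp.liftAddHom_apply_single g σ a

theorem liftHom_add {B : Type*} [AddCommGroup B] (g g' : H → A →+ B) :
    liftHom S (g + g') = liftHom S g + liftHom S g' :=
  (Finsupp.liftAddHom (α := H) (M := A) (N := B)).map_add g g'

/-- The multiplication, determined by `(a x_σ) (b x_τ) = a ω_σ(b) f(σ, τ) x_{στ}`. -/
noncomputable def mulHom : CrossedProduct S →+ CrossedProduct S →+ CrossedProduct S :=
  liftHom S fun σ =>
    AddMonoidHom.mk' (fun a => liftHom S fun τ => mulTermHom S σ τ a) fun a b => by
      rw [← liftHom_add]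
      congr 1
      funext τ
      exact mulTermHom_add S σ τ a b

noncomputable instance instMul : Mul (CrossedProduct S) := ⟨fun y z => mulHom S y z⟩

noncomputable instance instOne : One (CrossedProduct S) :=
  ⟨term S 1 (((S.f 1 1)⁻¹ : Aˣ) : A)⟩

theorem one_def : (1 : CrossedProduct S) = term S 1 (((S.f 1 1)⁻¹ : Aˣ) : A) := rfl

theorem mul_def (y z : CrossedProduct S) : y * z = mulHom S y z := rfl

theorem term_mul_term (σ τ : H) (a b : A) :
    term S σ a * term S τ b = term S (σ * τ) (a * S.ω σ b * S.f σ τ) := by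
  rw [mul_def, mulHom, liftHom_term, AddMonoidHom.mk'_apply, liftHom_term, mulTermHom,
    AddMonoidHom.mk'_apply]

theorem ω_one (a : A) : S.ω 1 a = S.f 1 1 * a * ((S.f 1 1)⁻¹ : Aˣ) := by
  obtain ⟨b, rfl⟩ := (S.ω 1).surjective a
  simpa using S.ω_comp 1 1 b

theorem f_one_left (μ : H) : S.f 1 μ = S.f 1 1 := by
  have h := S.cocycle 1 1 μ
  rw [one_mul, one_mul, ω_one] at h
  have h2 := (S.f 1 μ).isUnit.mul_right_cancel h
  rw [Units.eq_mul_inv_iff_mul_eq] at h2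
  exact Units.ext ((S.f 1 1).isUnit.mul_left_cancel h2).symm

theorem f_one_right (σ : H) : (S.f σ 1 : A) = S.ω σ (S.f 1 1) := by
  have h := S.cocycle σ 1 1
  rw [mul_one, mul_one] at h
  exact (S.f σ 1).isUnit.mul_right_cancel h

noncomputable instance instRing : Ring (CrossedProduct S) :=
  { instAddCommGroup S, instMul S, instOne S with
    left_distrib := fun a b c => by simp only [mul_def, map_add]
    right_distrib := fun a b c => by simp only [mul_def, map_add, AddMonoidHom.add_apply]
    zero_mul := fun a => by simp only [mul_def, map_zero, AddMonoidHom.zero_apply]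
    mul_zero := fun a => by simp only [mul_def, map_zero]
    mul_assoc := fun x y z => by
      induction x using induction with
      | h0 => simp only [mul_def, map_zero, AddMonoidHom.zero_apply]
      | hadd x x' hx hx' =>
        simp only [mul_def, map_add, AddMonoidHom.add_apply] at hx hx' ⊢
        rw [hx, hx']
      | hterm σ a =>
      induction y using induction with
      | h0 => simp only [mul_def, map_zero, AddMonoidHom.zero_apply]
      | hadd y y' hy hy' =>
        simp only [mul_def, map_add, AddMonoidHom.add_apply] at hy hy' ⊢
        rw [hy, hy']
      | hterm τ b =>
      induction z using induction with
      | h0 => simp only [mul_def, map_zero]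
      | hadd z z' hz hz' =>
        simp only [mul_def, map_add] at hz hz' ⊢
        rw [hz, hz']
      | hterm μ c =>
        rw [term_mul_term, term_mul_term, term_mul_term, term_mul_term, mul_assoc σ τ μ]
        congr 1
        simp only [map_mul, S.ω_comp]
        have h := S.cocycle σ τ μ
        calc a * S.ω σ b * S.f σ τ * S.ω (σ * τ) c * S.f (σ * τ) μ
            = a * (S.ω σ b * (S.f σ τ * S.ω (σ * τ) c * ((S.f σ τ)⁻¹ : Aˣ) *
                (S.f σ τ * S.f (σ * τ) μ))) := by simp [mul_assoc]
          _ = _ := by rw [h]; simp only [mul_assoc]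
    one_mul := fun x => by
      induction x using induction with
      | h0 => simp only [mul_def, map_zero]
      | hadd x x' hx hx' =>
        simp only [mul_def, map_add] at hx hx' ⊢
        rw [hx, hx']
      | hterm σ a =>
        rw [one_def, term_mul_term, one_mul, ω_one, f_one_left S σ]
        simp [mul_assoc]
    mul_one := fun x => by
      induction x using induction with
      | h0 => simp only [mul_def, map_zero, AddMonoidHom.zero_apply]
      | hadd x x' hx hx' =>
        simp only [mul_def, map_add, AddMonoidHom.add_apply] at hx hx' ⊢
        rw [hx, hx']
      | hterm σ a =>
        rw [one_def, term_mul_term, mul_one, f_one_right, mul_assoc, ← map_mul]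
        simp }

noncomputable instance instAlgebra : Algebra k (CrossedProduct S) :=
  Algebra.ofModule
    (fun c x y => by
      induction x using induction with
      | h0 => simp
      | hadd x x' hx hx' => rw [smul_add, add_mul, add_mul, smul_add, hx, hx']
      | hterm σ a =>
      induction y using induction with
      | h0 => simp
      | hadd y y' hy hy' => rw [mul_add, mul_add, smul_add, hy, hy']
      | hterm τ b => simp [smul_term, term_mul_term])
    (fun c x y => by
      induction x using induction with
      | h0 => simp
      | hadd x x' hx hx' => rw [add_mul, add_mul, smul_add, hx, hx']
      | hterm σ a =>
      induction y using induction with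
      | h0 => simp
      | hadd y y' hy hy' => rw [smul_add, mul_add, mul_add, smul_add, hy, hy']
      | hterm τ b => simp [smul_term, term_mul_term])

end CrossedProduct

/-- The factor set of the cyclic algebra `(L / k, σ, u) = ⨁_{0 ≤ i < e} L x ^ i`, where `e` is the
order of `σ`, `x a = σ(a) x` and `x ^ e = u`; the class of `i` modulo `e` corresponds to
`x ^ i` for `0 ≤ i < e`. -/
noncomputable def cyclicFactorSet {k L : Type*} [Field k] [Field L] [Algebra k L]
    (σ : L ≃ₐ[k] L) (hσ : 0 < orderOf σ) (u : kˣ) :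
    FactorSet k (Multiplicative (ZMod (orderOf σ))) L where
  ω i := σ ^ i.toAdd.val
  f i j := if i.toAdd.val + j.toAdd.val < orderOf σ then 1
    else Units.map (algebraMap k L : k →* L) u
  ω_comp i j a := by
    have : NeZero (orderOf σ) := ⟨hσ.ne'⟩
    rw [mul_right_comm, Units.mul_inv, one_mul, ← AlgEquiv.mul_apply, ← pow_add, toAdd_mul,
      ZMod.val_add, pow_mod_orderOf]
  cocycle i j l := by
    have : NeZero (orderOf σ) := ⟨hσ.ne'⟩
    have hi := ZMod.val_lt i.toAdd
    have hj := ZMod.val_lt j.toAdd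
    have hl := ZMod.val_lt l.toAdd
    simp only [toAdd_mul, ZMod.val_add]
    generalize i.toAdd.val = a at *
    generalize j.toAdd.val = b at *
    generalize l.toAdd.val = c at *
    generalize orderOf σ = e at *
    have key : ∀ x y, x < e → y < e → (x + y) % e = if x + y < e then x + y else x + y - e := by
      intro x y hx hy
      split_ifs with h
      · exact Nat.mod_eq_of_lt h
      · rw [Nat.mod_eq_sub_mod (by omega), Nat.mod_eq_of_lt (by omega)]
    rw [key a b hi hj, key b c hj hl]
    split_ifs <;> first | omega | simp

/-- The cyclic algebra `(L / k, σ, u)`. -/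
abbrev CyclicAlgebra {k L : Type*} [Field k] [Field L] [Algebra k L]
    (σ : L ≃ₐ[k] L) (hσ : 0 < orderOf σ) (u : kˣ) : Type _ :=
  CrossedProduct (cyclicFactorSet σ hσ u)

/-- Similarity (Brauer equivalence) of algebras over a field. -/
def BrauerSimilar (k A B : Type*) [Field k] [Ring A] [Algebra k A] [Ring B] [Algebra k B] : Prop :=
  ∃ n m : ℕ, n ≠ 0 ∧ m ≠ 0 ∧
    Nonempty (Matrix (Fin n) (Fin n) A ≃ₐ[k] Matrix (Fin m) (Fin m) B)

/-! ### Kummer groups -/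

/-- `KUM(L / k)`: the units `x` of `L` with `x ^ m ∈ k`, where `m` is the exponent of
`Gal(L / k)`. -/
noncomputable def KUM (k L : Type*) [Field k] [Field L] [Algebra k L] : Subgroup Lˣ :=
  (Units.map (algebraMap k L : k →* L)).range.comap (powMonoidHom (Monoid.exponent (L ≃ₐ[k] L)))

/-- `kum(L / k) = KUM(L / k) / kˣ`. -/
abbrev kum (k L : Type*) [Field k] [Field L] [Algebra k L] : Type _ :=
  KUM k L ⧸ ((Units.map (algebraMap k L : k →* L)).range.subgroupOf (KUM k L))

/-- `L / k` is a Galois extension with cyclic Galois group. -/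
def IsCyclicGalois (k L : Type*) [Field k] [Field L] [Algebra k L] : Prop :=
  IsGalois k L ∧ IsCyclic (L ≃ₐ[k] L)

/-! ### Cyclic graded division algebras -/

/-- A subalgebra `K` of the graded `F`-algebra `D` is a graded subfield if it is homogeneous and
commutative and if every nonzero homogeneous element of `K` has an inverse in `K`. -/
structure IsGradedSubfield {Γ F D : Type*} [AddCommGroup Γ] [DecidableEq Γ] [CommRing F] [Ring D]
    [Algebra F D] (𝒟 : Γ → AddSubgroup D) [GradedRing 𝒟] (K : Subalgebra F D) : Prop where
  homogeneous : ∀ a ∈ K, ∀ γ, (DirectSum.decompose 𝒟 a γ : D) ∈ K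
  comm : ∀ a ∈ K, ∀ b ∈ K, a * b = b * a
  exists_inv : ∀ γ, ∀ a ∈ K, a ∈ 𝒟 γ → a ≠ 0 → ∃ b ∈ K, a * b = 1

/-- The commutative ring structure of a graded subfield. -/
@[reducible] def IsGradedSubfield.commRing {Γ F D : Type*} [AddCommGroup Γ] [DecidableEq Γ]
    [CommRing F] [Ring D] [Algebra F D] {𝒟 : Γ → AddSubgroup D} [GradedRing 𝒟]
    {K : Subalgebra F D} (hK : IsGradedSubfield 𝒟 K) : CommRing K :=
  { K.toRing with mul_comm := fun a b => Subtype.ext (hK.comm a a.2 b b.2) }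

/-- For an injective extension of integral domains `K / F`: the extension `Frac(K) / Frac(F)` is
Galois with cyclic Galois group. -/
def IsCyclicFractionExtension (F K : Type*) [CommRing F] [IsDomain F] [CommRing K] [IsDomain K]
    [Algebra F K] [FaithfulSMul F K] : Prop :=
  letI : Algebra (FractionRing F) (FractionRing K) := FractionRing.liftAlgebra F (FractionRing K)
  IsCyclicGalois (FractionRing F) (FractionRing K)

/-- The graded subfield `K` of `D` is a cyclic Galois graded field extension of `F`. -/
def IsGradedSubfield.IsCyclicExtension {Γ F D : Type*} [AddCommGroup Γ] [DecidableEq Γ]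
    [IsAddTorsionFree Γ] [CommRing F] [Ring D] [Algebra F D] (ℱ : Γ → AddSubgroup F)
    {𝒟 : Γ → AddSubgroup D} [GradedRing ℱ] [GradedRing 𝒟] [IsGradedDivisionRing ℱ]
    [IsGradedDivisionRing 𝒟] [IsGradedAlgebraOver ℱ 𝒟] {K : Subalgebra F D}
    (hK : IsGradedSubfield 𝒟 K) : Prop :=
  letI : CommRing K := hK.commRing
  letI : Algebra F K := K.algebra
  have : IsDomain F := IsGradedDivisionRing.isDomain ℱ
  have : Nontrivial D := IsGradedDivisionRing.nontrivial (𝒜 := 𝒟)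
  have : NoZeroDivisors D := IsGradedDivisionRing.noZeroDivisors 𝒟
  have : NoZeroDivisors K := inferInstance
  have : IsDomain K := NoZeroDivisors.to_isDomain K
  have : FaithfulSMul F D := IsGradedAlgebraOver.faithfulSMul ℱ 𝒟
  have : FaithfulSMul F K := inferInstance
  IsCyclicFractionExtension F K

/-- A graded division algebra `D` over `F` is cyclic if it has a maximal graded subfield which is
a cyclic Galois graded field extension of `F`. -/
def IsCyclicGradedAlgebra {Γ F D : Type*} [AddCommGroup Γ] [DecidableEq Γ]
    [IsAddTorsionFree Γ] [CommRing F] [Ring D] [Algebra F D] (ℱ : Γ → AddSubgroup F)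
    (𝒟 : Γ → AddSubgroup D) [GradedRing ℱ] [GradedRing 𝒟] [IsGradedDivisionRing ℱ]
    [IsGradedDivisionRing 𝒟] [IsGradedAlgebraOver ℱ 𝒟] : Prop :=
  ∃ (K : Subalgebra F D) (hK : Maximal (IsGradedSubfield 𝒟) K), hK.prop.IsCyclicExtension ℱ

/-! ### The crossed product attached to a semiramified graded division algebra -/

namespace IsSemiramified

variable {Γ F D : Type*} [AddCommGroup Γ] [DecidableEq Γ] [IsAddTorsionFree Γ]
  [CommRing F] [Ring D] [Algebra F D]
  {ℱ : Γ → AddSubgroup F} {𝒟 : Γ → AddSubgroup D} [GradedRing ℱ] [GradedRing 𝒟]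
  [IsGradedDivisionRing ℱ] [IsGradedDivisionRing 𝒟] [IsGradedAlgebraOver ℱ 𝒟]
  [Algebra.IsCentral F D] [Module.Finite F D] [IsCommDegreeZero 𝒟]

/-- The identification `σ ↦ m` of `G = Gal(D₀ / F₀)` with the multi-indices, that is, with
`Γ_D / Γ_F`: the class of degree `∑ mᵢ δᵢ` acts on `D₀` as `σ`. -/
noncomputable def index (hD : IsSemiramified ℱ 𝒟) (S : HomogeneousFrame ℱ 𝒟) :
    (DegreeZero 𝒟 ≃ₐ[DegreeZero ℱ] DegreeZero 𝒟) ≃ S.Index :=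
  (Equiv.ofBijective S.action (hD.isGalois_and_action_bijective S).2).symm

theorem action_index (hD : IsSemiramified ℱ 𝒟) (S : HomogeneousFrame ℱ 𝒟)
    (σ : DegreeZero 𝒟 ≃ₐ[DegreeZero ℱ] DegreeZero 𝒟) : S.action (hD.index S σ) = σ :=
  (Equiv.ofBijective S.action (hD.isGalois_and_action_bijective S).2).apply_symm_apply σ

theorem index_mul (hD : IsSemiramified ℱ 𝒟) (S : HomogeneousFrame ℱ 𝒟)
    (σ τ : DegreeZero 𝒟 ≃ₐ[DegreeZero ℱ] DegreeZero 𝒟) :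
    hD.index S (σ * τ) = S.addIndex (hD.index S σ) (hD.index S τ) := by
  apply (hD.isGalois_and_action_bijective S).2.1
  rw [action_index, ← S.action_mul, action_index, action_index]

/-- The `2`-cocycle `d` of `G = Gal(D₀ / F₀)` in `D₀ˣ`, as a factor set. -/
noncomputable def factorSet (hD : IsSemiramified ℱ 𝒟) (S : HomogeneousFrame ℱ 𝒟) :
    FactorSet (DegreeZero ℱ) (DegreeZero 𝒟 ≃ₐ[DegreeZero ℱ] DegreeZero 𝒟) (DegreeZero 𝒟) where
  ω σ := σ
  f σ τ := S.dIndex (hD.index S σ) (hD.index S τ)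
  ω_comp σ τ a := by rw [mul_right_comm, Units.mul_inv, one_mul, AlgEquiv.mul_apply]
  cocycle σ τ μ := by
    have h := S.dIndex_cocycle (hD.index S σ) (hD.index S τ) (hD.index S μ)
    rw [action_index] at h
    rw [index_mul, index_mul, h]

theorem orderOf_pos (hD : IsSemiramified ℱ 𝒟)
    (M : IntermediateField (DegreeZero ℱ) (DegreeZero 𝒟)) (σ : DegreeZero 𝒟 ≃ₐ[M] DegreeZero 𝒟) :
    0 < orderOf σ := by
  have := hD.finiteDimensional
  have : FiniteDimensional M (DegreeZero 𝒟) := inferInstance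
  exact _root_.orderOf_pos σ

end IsSemiramified

/-! Write n for the degree of D, z_σ for the monomial in the z_i acting on D₀ as σ, and x_σ for the
corresponding basis element of the crossed product. Both conditions of the theorem amount to the
existence of one homogeneous element t of D with t ^ n in F and F[t] a maximal graded subfield.

The link is a comparison of powers. Let t act on D₀ as σ, let e be the order of σ and M its fixed
field, so that em = n with m = [M : F₀]. Then t = w c z_σ with w in D₀ and c in F, and t ^ e is N
times a homogeneous unit of F, where the same N in D₀ is the value of (w x_σ) ^ e in the crossed
product (`exists_pow_eq_of_pow_eq_one`). When N lies in M, the field D₀ and w x_σ span a copy of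
(D₀/M, σ, N) in the crossed product, and the crossed product tensored with M is a matrix algebra
over that copy (`nonempty_tensorProduct_algEquiv_matrix_cyclicAlgebra`).

From a cyclic maximal graded subfield K, with a generator Φ of the Galois group of its fraction
field: Φ permutes the homogeneous elements of each degree (`exists_fractionAut_eq`) and its n-th
iterate fixes them (`iterate_fractionAut`), so with enough roots of unity K is spanned by
homogeneous eigenvectors. The exponents of the eigenvalues form a cyclic group, and an element t
whose exponent generates it satisfies K = F[t] and t ^ n in F (`exists_generator`). With M = K₀,
maximality of K says that M is the fixed field of σ. The elements of degree 0 in F[t] are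
polynomials in N over F₀, so N is a Kummer generator of M.

Conversely, put v = x_σ ^ e, an element of M. The tensored crossed product is similar both to (D₀/M,
σ, v) and to (D₀/M, σ, u), hence u is v times the norm of some b
(`exists_norm_eq_of_brauerSimilar`). Then t = b z_σ has t ^ e equal to u up to F, so t ^ n lies in
F, the degree 0 part of F[t] contains F₀(u) = M, and F[t] is maximal because a homogeneous element
commuting with M acts on D₀ as a power of σ.

The comparison of cyclic algebras rests on an explicit Skolem-Noether argument
(`exists_conj_scalarMatrix`), in which the conjugating matrix is obtained by averaging over a pair
of trace-dual bases. -/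

/-! ### Trace-dual families -/

section TraceDual

variable (k L : Type*) [Field k] [Field L] [Algebra k L] [FiniteDimensional k L]

/-- Two families in `L / k`, each expanding elements with respect to the trace form against the
other one. -/
structure TraceDual where
  ι : Type
  [fin : Fintype ι]
  a : ι → L
  b : ι → L
  expand : ∀ x, ∑ i, Algebra.trace k L (x * b i) • a i = x
  expand' : ∀ x, ∑ i, Algebra.trace k L (a i * x) • b i = x

attribute [instance] TraceDual.fin

/-- A separable extension has trace-dual families extending a linearly independent family. -/
theorem exists_trace_dual_of_basis [Algebra.IsSeparable k L] {ι : Type*} [Finite ι] [DecidableEq ι]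
    (v : Module.Basis ι k L) :
    ∃ w : Module.Basis ι k L, ∀ i j, Algebra.trace k L (v i * w j) = if i = j then 1 else 0 := by
  refine ⟨(Algebra.traceForm k L).dualBasis (traceForm_nondegenerate k L) v, fun i j => ?_⟩
  have := LinearMap.BilinForm.apply_dualBasis_right (traceForm_nondegenerate k L)
    (Algebra.traceForm_isSymm k) v i j
  simpa [Algebra.traceForm_apply] using this

/-- A basis together with its dual for the trace form: the coordinates in either one are the traces
against the other. -/
theorem nonempty_traceDual [Algebra.IsSeparable k L] : Nonempty (TraceDual k L) := by
  classical
  let v := Module.finBasis k L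
  obtain ⟨w, hw⟩ := exists_trace_dual_of_basis k L v
  refine ⟨⟨Fin (Module.finrank k L), v, w, fun x => ?_, fun x => ?_⟩⟩
  · have h : ∀ j, Algebra.trace k L (x * w j) = v.repr x j := by
      intro j
      conv_lhs => rw [← v.sum_repr x]
      rw [Finset.sum_mul, map_sum]
      simp only [smul_mul_assoc, map_smul, hw]
      simp
    simp only [h, v.sum_repr]
  · have h : ∀ j, Algebra.trace k L (v j * x) = w.repr x j := by
      intro j
      conv_lhs => rw [← w.sum_repr x]
      rw [Finset.mul_sum, map_sum]
      simp only [mul_smul_comm, map_smul, hw]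
      simp
    simp only [h, w.sum_repr]

end TraceDual

namespace TraceDual

variable {k L : Type*} [Field k] [Field L] [Algebra k L] [FiniteDimensional k L]
  (T : TraceDual k L)

/-- The Casimir element of a trace-dual family is balanced. -/
theorem balanced {V : Type*} [AddCommGroup V] [Module k V] (B : L →ₗ[k] L →ₗ[k] V) (l : L) :
    ∑ i, B (l * T.a i) (T.b i) = ∑ i, B (T.a i) (T.b i * l) := by
  -- Expanding l a_i in the a_j on one side and b_i l in the b_j on the other gives the same double
  -- sum, with the two indices exchanged.
  have h1 : ∀ i, B (l * T.a i) (T.b i)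
      = ∑ j, Algebra.trace k L (l * T.a i * T.b j) • B (T.a j) (T.b i) := by
    intro i
    conv_lhs => rw [← T.expand (l * T.a i)]
    simp
  have h2 : ∀ i, B (T.a i) (T.b i * l)
      = ∑ j, Algebra.trace k L (l * T.a j * T.b i) • B (T.a i) (T.b j) := by
    intro i
    conv_lhs => rw [← T.expand' (T.b i * l)]
    simp only [map_sum, map_smul]
    refine Finset.sum_congr rfl fun j _ => ?_
    congr 2; ring
  simp only [h1, h2]
  exact Finset.sum_comm

/-- Orthogonality of automorphisms. Balancedness gives l s = s τ(l) for the sum s, so s vanishes as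
soon as τ moves some l. For τ = 1, write the trace in the expansion of 1 as a sum over the Galois
group: only the identity contributes. -/
theorem sum_mul_aut [IsGalois k L] [DecidableEq (L ≃ₐ[k] L)] (τ : L ≃ₐ[k] L) :
    ∑ i, T.a i * τ (T.b i) = if τ = 1 then 1 else 0 := by
  have hbal : ∀ (τ : L ≃ₐ[k] L) (l : L),
      l * ∑ i, T.a i * τ (T.b i) = (∑ i, T.a i * τ (T.b i)) * τ l := by
    intro τ l
    have := T.balanced ((LinearMap.mul k L).compl₂ τ.toLinearMap) l
    simp only [LinearMap.compl₂_apply, LinearMap.mul_apply', AlgEquiv.toLinearMap_apply,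
      map_mul] at this
    rw [Finset.mul_sum, Finset.sum_mul]
    simpa only [mul_assoc] using this
  have hne : ∀ τ : L ≃ₐ[k] L, τ ≠ 1 → ∑ i, T.a i * τ (T.b i) = 0 := by
    intro τ hτ
    by_contra h0
    refine hτ (AlgEquiv.ext fun l => ?_)
    have h := hbal τ l
    rw [mul_comm] at h
    exact (mul_left_cancel₀ h0 h).symm
  split_ifs with h
  · subst h
    have h1 := T.expand 1
    simp only [Algebra.smul_def, trace_eq_sum_automorphisms, Finset.sum_mul, one_mul] at h1
    rw [Finset.sum_comm, Finset.sum_eq_single (1 : L ≃ₐ[k] L)] at h1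
    · simpa only [mul_comm] using h1
    · intro ρ _ hρ
      simpa only [mul_comm] using hne ρ hρ
    · simp
  · exact hne τ h

end TraceDual

/-! ### Crossed products over a field -/

namespace CrossedProduct

section Comm

variable {k H L : Type*} [Field k] [Group H] [Field L] [Algebra k L] (S : FactorSet k H L)

theorem ω_mul (σ τ : H) (a : L) : S.ω (σ * τ) a = S.ω σ (S.ω τ a) := by
  rw [S.ω_comp, mul_right_comm, Units.mul_inv, one_mul]

/-- The action of `H` on `L` as a homomorphism. -/
def ωHom : H →* (L ≃ₐ[k] L) :=
  MonoidHom.mk' S.ω fun σ τ => AlgEquiv.ext fun a => ω_mul S σ τ a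

theorem ω_one_apply (a : L) : S.ω 1 a = a := by
  rw [ω_one, mul_right_comm, Units.mul_inv, one_mul]

/-- The embedding of `L` into the crossed product. -/
noncomputable def scalar : L →ₐ[k] CrossedProduct S where
  toFun l := term S 1 (l * ((S.f 1 1)⁻¹ : Lˣ))
  map_one' := by rw [one_mul, one_def]
  map_mul' a b := by
    rw [term_mul_term, one_mul, ω_one_apply]
    congr 1
    rw [mul_assoc (a * _), mul_assoc b, Units.inv_mul]; ring
  map_zero' := by rw [zero_mul, term_zero]
  map_add' a b := by rw [add_mul, term_add]
  commutes' c := by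
    rw [Algebra.algebraMap_eq_smul_one, Algebra.algebraMap_eq_smul_one, one_def, smul_term,
      Algebra.smul_mul_assoc, one_mul]

theorem scalar_mul_term (l : L) (σ : H) (a : L) : scalar S l * term S σ a = term S σ (l * a) := by
  change term S 1 _ * _ = _
  rw [term_mul_term, one_mul, ω_one_apply, f_one_left S σ]
  congr 1
  rw [mul_right_comm l, mul_assoc, Units.inv_mul, mul_one]

theorem term_mul_scalar (l : L) (σ : H) (a : L) :
    term S σ a * scalar S l = term S σ (S.ω σ l * a) := by
  change _ * term S 1 _ = _
  rw [term_mul_term, mul_one, f_one_right, mul_assoc, ← map_mul, mul_assoc, Units.inv_mul, mul_one,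
    mul_comm]

/-- The coefficient at `x_σ`. -/
def coeff (y : CrossedProduct S) (σ : H) : L := (show H →₀ L from y) σ

theorem coeff_zero (σ : H) : coeff S 0 σ = 0 := rfl

theorem coeff_add (y z : CrossedProduct S) (σ : H) :
    coeff S (y + z) σ = coeff S y σ + coeff S z σ := rfl

theorem coeff_sum {ι : Type*} (s : Finset ι) (y : ι → CrossedProduct S) (σ : H) :
    coeff S (∑ i ∈ s, y i) σ = ∑ i ∈ s, coeff S (y i) σ := by
  classical
  induction s using Finset.induction_on with
  | empty => simp [coeff_zero]
  | insert i s hi ih => rw [Finset.sum_insert hi, Finset.sum_insert hi, coeff_add, ih]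

theorem coeff_term [DecidableEq H] (σ τ : H) (a : L) :
    coeff S (term S σ a) τ = if σ = τ then a else 0 := Finsupp.single_apply

theorem ext_coeff {y z : CrossedProduct S} (h : ∀ σ, coeff S y σ = coeff S z σ) : y = z :=
  Finsupp.ext h

theorem coeff_scalar_mul (l : L) (y : CrossedProduct S) (σ : H) :
    coeff S (scalar S l * y) σ = l * coeff S y σ := by
  classical
  induction y using induction with
  | h0 => simp [coeff_zero]
  | hadd y z hy hz => rw [mul_add, coeff_add, hy, hz, coeff_add, mul_add]
  | hterm τ a => rw [scalar_mul_term, coeff_term, coeff_term]; split_ifs <;> simp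

theorem coeff_mul_scalar (l : L) (y : CrossedProduct S) (σ : H) :
    coeff S (y * scalar S l) σ = S.ω σ l * coeff S y σ := by
  classical
  induction y using induction with
  | h0 => simp [coeff_zero]
  | hadd y z hy hz => rw [add_mul, coeff_add, hy, hz, coeff_add, mul_add]
  | hterm τ a =>
    rw [term_mul_scalar, coeff_term, coeff_term]; split_ifs with h <;> simp [h]

/-- A nonzero term has a right inverse that is again a nonzero term; the latter being right
invertible too, the inverse is two-sided. -/
theorem isUnit_term (σ : H) (a : L) (ha : a ≠ 0) : IsUnit (term S σ a) := by
  have key : ∀ (σ : H) (a : L), a ≠ 0 → ∃ c ≠ 0, ∃ τ, term S σ a * term S τ c = 1 := by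
    intro σ a ha
    refine ⟨(S.ω σ).symm (a⁻¹ * ((S.f σ σ⁻¹)⁻¹ : Lˣ) * ((S.f 1 1)⁻¹ : Lˣ)), ?_, σ⁻¹, ?_⟩
    · simp [ha]
    rw [term_mul_term, mul_inv_cancel, AlgEquiv.apply_symm_apply, one_def]
    congr 1
    field_simp
    exact Units.inv_mul _
  obtain ⟨c, hc, τ, h⟩ := key σ a ha
  obtain ⟨d, -, ρ, hd⟩ := key τ c hc
  have : term S τ c * term S σ a = 1 := by
    have e : term S σ a = term S ρ d := by
      calc term S σ a = term S σ a * (term S τ c * term S ρ d) := by rw [hd, mul_one]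
        _ = term S ρ d := by rw [← mul_assoc, h, one_mul]
    rw [e, hd]
  exact ⟨⟨_, _, h, this⟩, rfl⟩

theorem finrank_eq [Fintype H] [FiniteDimensional k L] :
    Module.finrank k (CrossedProduct S) = Nat.card H * Module.finrank k L := by
  have h : Module.finrank k (H →₀ L) = Fintype.card H * Module.finrank k L := by
    rw [(Finsupp.linearEquivFunOnFinite k L H).finrank_eq, Module.finrank_pi_fintype]
    simp
  rw [Nat.card_eq_fintype_card (α := H)]
  exact h

theorem finiteDimensional [Finite H] [FiniteDimensional k L] :
    FiniteDimensional k (CrossedProduct S) :=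
  inferInstanceAs (Module.Finite k (H →₀ L))

end Comm

end CrossedProduct

/-! ### Embeddings of matrix algebras over `L` into matrix algebras over a crossed product -/

namespace CrossedProduct

section Conjugation

variable {k H L : Type*} [Field k] [Group H] [Field L] [Algebra k L] (T : FactorSet k H L)

/-- Used to move a nonzero coefficient to the position 1, where averaging can isolate it. -/
theorem coeff_mul_term (y : CrossedProduct T) (σ τ : H) (b : L) :
    coeff T (y * term T τ b) (σ * τ) = coeff T y σ * T.ω σ b * T.f σ τ := by
  classical
  induction y using induction with
  | h0 => simp [coeff_zero]
  | hadd y z hy hz => rw [add_mul, coeff_add, hy, hz, coeff_add]; ring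
  | hterm ρ a =>
    rw [term_mul_term, coeff_term, coeff_term]
    by_cases h : ρ = σ
    · simp [h]
    · simp [h]

instance instNontrivial : Nontrivial (CrossedProduct T) := by
  classical
  refine ⟨⟨0, 1, fun h => ?_⟩⟩
  have h1 := congrArg (fun y => coeff T y 1) h
  simp only [coeff_zero, one_def, coeff_term, if_true] at h1
  exact Units.ne_zero _ h1.symm

/-- Matrices over `L` as matrices over the crossed product. -/
noncomputable abbrev scalarMatrix (ι : Type*) [Fintype ι] [DecidableEq ι] :
    Matrix ι ι L →ₐ[k] Matrix ι ι (CrossedProduct T) := (scalar T).mapMatrix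

theorem scalarMatrix_single {ι : Type*} [Fintype ι] [DecidableEq ι] (i j : ι) (l : L) :
    scalarMatrix T ι (Matrix.single i j l) = Matrix.single i j (scalar T l) := by
  ext a b
  simp only [AlgHom.mapMatrix_apply, Matrix.map_apply, Matrix.single, Matrix.of_apply]
  split_ifs <;> simp

variable [FiniteDimensional k L] [IsGalois k L]

/-- The coefficient at `1` is extracted by averaging over a trace-dual family. -/
theorem sum_scalar_mul_mul_scalar [DecidableEq H]
    (hT : Function.Injective T.ω) (P : TraceDual k L) (c : CrossedProduct T) :
    ∑ s, scalar T (P.a s) * c * scalar T (P.b s) = term T 1 (coeff T c 1) := by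
  classical
  -- The sum multiplies the coefficient at x_τ by ∑ a_s ω_τ(b_s), which is 1 or 0 according as ω_τ
  -- is trivial or not; injectivity of ω leaves τ = 1 alone.
  refine ext_coeff T fun τ => ?_
  rw [coeff_sum, coeff_term]
  simp only [coeff_mul_scalar, coeff_scalar_mul]
  have h : ∑ s, T.ω τ (P.b s) * (P.a s * coeff T c τ)
      = (∑ s, P.a s * T.ω τ (P.b s)) * coeff T c τ := by
    rw [Finset.sum_mul]; exact Finset.sum_congr rfl fun s _ => by ring
  have h1 : T.ω τ = 1 ↔ 1 = τ := by
    rw [← (ωHom T).map_one]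
    exact ⟨fun h => (hT h).symm, fun h => by rw [← h]; rfl⟩
  rw [h, P.sum_mul_aut, if_congr h1 rfl rfl]
  split_ifs with h2
  · rw [one_mul, h2]
  · rw [zero_mul]

/-- Every homomorphism of the matrix algebra over `L` into the matrix algebra over the crossed
product is conjugate to the standard one. -/
theorem exists_conj_scalarMatrix [Finite H] (hT : Function.Bijective T.ω) {ι : Type*} [Fintype ι]
    [DecidableEq ι] [Nonempty ι] (f : Matrix ι ι L →ₐ[k] Matrix ι ι (CrossedProduct T)) :
    ∃ G : (Matrix ι ι (CrossedProduct T))ˣ, ∀ b,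
      f b * G = G * scalarMatrix T ι b := by
  classical
  obtain ⟨P⟩ := nonempty_traceDual k L
  have i0 : ι := Classical.arbitrary ι
  set g := scalarMatrix T ι with hg
  let E : ι → ι → L → Matrix ι ι L := fun i j l => Matrix.single i j l
  have hE : ∀ i j m (a b : L), E i j a * E j m b = E i m (a * b) := fun i j m a b =>
    Matrix.single_mul_single_same ..
  have hgE : ∀ i j (l : L), g (E i j l) = Matrix.single i j (scalar T l) :=
    scalarMatrix_single T
  have hone : ∀ φ : Matrix ι ι L →ₐ[k] Matrix ι ι (CrossedProduct T),
      ∑ i, φ (E i i 1) = 1 := by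
    intro φ
    rw [← map_sum, ← map_one φ]
    congr 1
    ext a b
    simp [E, Matrix.sum_apply, Matrix.single_apply, Matrix.one_apply, ite_and]
  -- Averaging r against the Casimir element makes it intertwine the two actions of L through the
  -- corner (i0, i0).
  let avg : Matrix ι ι (CrossedProduct T) → Matrix ι ι (CrossedProduct T) := fun r =>
    ∑ s, f (E i0 i0 (P.a s)) * r * g (E i0 i0 (P.b s))
  let El : L →ₗ[k] Matrix ι ι L := Matrix.singleLinearMap k i0 i0
  have hEl : ∀ l, El l = E i0 i0 l := fun l => rfl
  have havg : ∀ r l, f (E i0 i0 l) * avg r = avg r * g (E i0 i0 l) := by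
    intro r l
    let B : L →ₗ[k] L →ₗ[k] Matrix ι ι (CrossedProduct T) :=
      ((LinearMap.mul k _).compl₁₂ ((LinearMap.mulRight k r).comp (f.toLinearMap.comp El))
        (g.toLinearMap.comp El))
    have hB : ∀ x y, B x y = f (E i0 i0 x) * r * g (E i0 i0 y) := fun x y => rfl
    have := P.balanced B l
    simp only [hB] at this
    rw [Finset.mul_sum, Finset.sum_mul]
    simp only [← mul_assoc, ← map_mul, hE]
    simp only [mul_assoc, ← map_mul, hE]
    simpa only [mul_assoc] using this
  have hex : ∃ r, avg r ≠ 0 := by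
    by_contra! h0
    -- Replacing r by r x_τ and moving x_τ to the right twists every b_s by τ, so the vanishing of
    -- all averages gives the vanishing of all twisted ones.
    have h1 : ∀ (τ : H) r, ∑ s, f (E i0 i0 (P.a s)) * r * g (E i0 i0 (T.ω τ (P.b s))) = 0 := by
      intro τ r
      obtain ⟨w, hw⟩ := isUnit_term T τ 1 one_ne_zero
      have h2 : ∀ l, Matrix.scalar ι (w : CrossedProduct T) * g (E i0 i0 l)
          = g (E i0 i0 (T.ω τ l)) * Matrix.scalar ι (w : CrossedProduct T) := by
        intro l
        rw [hgE, hgE, hw]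
        ext a b
        simp only [Matrix.scalar_apply, Matrix.diagonal_mul, Matrix.mul_diagonal, Matrix.single,
          Matrix.of_apply]
        split_ifs
        · rw [term_mul_scalar, scalar_mul_term]
        · simp
      have h3 := h0 (r * Matrix.scalar ι (w : CrossedProduct T))
      simp only [avg, mul_assoc, h2] at h3
      simp only [← mul_assoc] at h3
      rw [← Finset.sum_mul] at h3
      have hu : IsUnit (Matrix.scalar ι (w : CrossedProduct T)) := w.isUnit.map (Matrix.scalar ι)
      exact hu.mul_left_eq_zero.1 h3
    -- Summing the twisted averages over the whole Galois group turns the b_s into traces, and ∑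
    -- tr(b_s) a_s = 1.
    have h2 : ∀ r, f (E i0 i0 1) * r * g (E i0 i0 1) = 0 := by
      intro r
      have e : ∀ l, E i0 i0 l = El l := fun _ => rfl
      have h3 : ∀ s, g (E i0 i0 (algebraMap k L (Algebra.trace k L (1 * P.b s))))
          = ∑ τ : L ≃ₐ[k] L, g (E i0 i0 (τ (P.b s))) := by
        intro s
        rw [trace_eq_sum_automorphisms]
        simp only [e, map_sum, one_mul]
      have h5 : ∀ τ : L ≃ₐ[k] L,
          ∑ s, f (E i0 i0 (P.a s)) * r * g (E i0 i0 (τ (P.b s))) = 0 := by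
        intro τ
        obtain ⟨h, rfl⟩ := hT.2 τ
        exact h1 h r
      have h6 : ∀ s, f (E i0 i0 (Algebra.trace k L (1 * P.b s) • P.a s)) * r * g (E i0 i0 1)
          = f (E i0 i0 (P.a s)) * r
            * g (E i0 i0 (algebraMap k L (Algebra.trace k L (1 * P.b s)))) := by
        intro s
        rw [Algebra.algebraMap_eq_smul_one]
        simp only [e, map_smul, Algebra.smul_mul_assoc, mul_smul_comm]
      calc f (E i0 i0 1) * r * g (E i0 i0 1)
          = ∑ s, f (E i0 i0 (Algebra.trace k L (1 * P.b s) • P.a s)) * r * g (E i0 i0 1) := by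
            have h7 : f (E i0 i0 1)
                = ∑ s, f (E i0 i0 (Algebra.trace k L (1 * P.b s) • P.a s)) := by
              simp only [e, ← map_sum]
              rw [P.expand]
            rw [h7, Finset.sum_mul, Finset.sum_mul]
        _ = ∑ s, ∑ τ : L ≃ₐ[k] L, f (E i0 i0 (P.a s)) * r * g (E i0 i0 (τ (P.b s))) :=
            Finset.sum_congr rfl fun s _ => by rw [h6, h3, Finset.mul_sum]
        _ = 0 := by
            rw [Finset.sum_comm]
            exact Finset.sum_eq_zero fun τ _ => h5 τ
    have h3 : f (E i0 i0 1) = 0 := by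
      ext i j
      have h4 := congrFun (congrFun (h2 (Matrix.single j i0 1)) i) i0
      rw [hgE, map_one, mul_assoc, Matrix.single_mul_single_same, Matrix.mul_single_apply_same,
        mul_one, mul_one] at h4
      exact h4
    have h4 : ∀ i, f (E i i 1) = 0 := by
      intro i
      have : E i i 1 = E i i0 1 * E i0 i0 1 * E i0 i 1 := by simp [hE]
      rw [this, map_mul, map_mul, h3]; simp
    have h5 := hone f
    simp only [h4, Finset.sum_const_zero] at h5
    exact zero_ne_one h5
  obtain ⟨r, hr⟩ := hex
  set g0 := avg r with hg0
  -- The intertwiner of the corners is spread to all matrix positions by the matrix units of both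
  -- embeddings.
  let G := ∑ i, f (E i i0 1) * g0 * g (E i0 i 1)
  have hEz : ∀ i j m n (a b : L), j ≠ m → E i j a * E m n b = 0 := fun i j m n a b h =>
    Matrix.single_mul_single_of_ne _ _ _ _ h _
  have hfE : ∀ p q l, f (E p q l) * G = f (E p i0 l) * g0 * g (E i0 q 1) := by
    intro p q l
    simp only [G, Finset.mul_sum]
    rw [Finset.sum_eq_single q]
    · simp only [← mul_assoc, ← map_mul, hE, mul_one]
    · intro i _ hi
      simp only [← mul_assoc, ← map_mul]
      rw [hEz _ _ _ _ _ _ hi.symm]; simp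
    · simp
  have hGE : ∀ p q l, G * g (E p q l) = f (E p i0 1) * g0 * g (E i0 q l) := by
    intro p q l
    simp only [G, Finset.sum_mul]
    rw [Finset.sum_eq_single p]
    · rw [mul_assoc, ← map_mul, hE, one_mul]
    · intro i _ hi
      rw [mul_assoc, ← map_mul, hEz _ _ _ _ _ _ hi]; simp
    · simp
  have hcommE : ∀ p q l, f (E p q l) * G = G * g (E p q l) := by
    intro p q l
    rw [hfE, hGE]
    have h1 : E p i0 l = E p i0 1 * E i0 i0 l := by rw [hE, one_mul]
    have h2 : E i0 q l = E i0 i0 l * E i0 q 1 := by rw [hE, mul_one]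
    rw [h1, h2, map_mul, map_mul, mul_assoc (f _) (f _), hg0, havg]
    simp only [mul_assoc]
  have hcomm : ∀ b, f b * G = G * g b := by
    intro b
    rw [Matrix.matrix_eq_sum_single b]
    simp only [map_sum, Finset.sum_mul, Finset.mul_sum]
    exact Finset.sum_congr rfl fun i _ => Finset.sum_congr rfl fun j _ => hcommE i j _
  have hG0 : G ≠ 0 := by
    intro h
    have h1 := hfE i0 i0 1
    rw [h, mul_zero] at h1
    apply hr
    have h2 : f (E i0 i0 1) * g0 * g (E i0 i0 1) = g0 := by
      rw [hg0]
      simp only [avg, Finset.mul_sum, Finset.sum_mul]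
      refine Finset.sum_congr rfl fun s _ => ?_
      simp only [← mul_assoc, ← map_mul, hE]
      simp only [mul_assoc, ← map_mul, hE, one_mul, mul_one]
    rw [← h2, ← h1]
  -- The right annihilator of G is a right ideal, and it is stable under left multiplication by
  -- matrices over L because G intertwines. From a nonzero element one extracts an entry, shifts a
  -- nonzero coefficient to x_1 and averages: a unit in the corner remains, hence G kills the corner
  -- and G = 0.
  have hinj : ∀ a, G * a = 0 → a = 0 := by
    intro a ha
    by_contra hne
    obtain ⟨i, j, hij⟩ : ∃ i j, a i j ≠ 0 := by
      by_contra! h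
      exact hne (by ext i j; exact h i j)
    obtain ⟨σ, hσ⟩ : ∃ σ, coeff T (a i j) σ ≠ 0 := by
      by_contra! h
      exact hij (ext_coeff T h)
    have hI : G * Matrix.single i0 i0 (a i j) = 0 := by
      have : Matrix.single i0 i0 (a i j)
          = g (E i0 i 1) * a * Matrix.single j i0 1 := by
        rw [hgE, Matrix.single_mul_mul_single, map_one, one_mul, mul_one]
      rw [this, ← mul_assoc, ← mul_assoc, ← hcomm, mul_assoc (f _), ha, mul_zero, zero_mul]
    have hI2 : G * Matrix.single i0 i0 (a i j * term T σ⁻¹ 1) = 0 := by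
      rw [← Matrix.single_mul_single_same (i := i0) (j := i0), ← mul_assoc, hI, zero_mul]
    set c := a i j * term T σ⁻¹ 1 with hc
    have hc1 : coeff T c 1 ≠ 0 := by
      have := coeff_mul_term T (a i j) σ σ⁻¹ 1
      rw [mul_inv_cancel] at this
      rw [hc, this, map_one, mul_one]
      exact mul_ne_zero hσ (Units.ne_zero _)
    have hI3 : G * Matrix.single i0 i0 (term T 1 (coeff T c 1)) = 0 := by
      rw [← sum_scalar_mul_mul_scalar T hT.1 P c]
      have : (Matrix.single i0 i0 (∑ s, scalar T (P.a s) * c * scalar T (P.b s)) :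
          Matrix ι ι (CrossedProduct T)) = ∑ s, Matrix.single i0 i0
            (scalar T (P.a s) * c * scalar T (P.b s)) := by
        exact map_sum (Matrix.singleAddMonoidHom i0 i0) _ _
      rw [this, Finset.mul_sum]
      refine Finset.sum_eq_zero fun s _ => ?_
      rw [← Matrix.single_mul_single_same (i := i0) (j := i0) (k := i0), ← Matrix.single_mul_single_same (i := i0) (j := i0) (k := i0),
        ← hgE, ← mul_assoc, ← mul_assoc, ← hcomm, mul_assoc (f _), hI2, mul_zero, zero_mul]
    obtain ⟨w, hw⟩ := isUnit_term T 1 _ hc1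
    have hI4 : G * Matrix.single i0 i0 1 = 0 := by
      have : (Matrix.single i0 i0 1 : Matrix ι ι (CrossedProduct T))
          = Matrix.single i0 i0 (term T 1 (coeff T c 1))
            * Matrix.single i0 i0 ((w⁻¹ : (CrossedProduct T)ˣ) : CrossedProduct T) := by
        rw [Matrix.single_mul_single_same, ← hw, Units.mul_inv]
      rw [this, ← mul_assoc, hI3, zero_mul]
    apply hG0
    rw [← mul_one G, ← hone g, Finset.mul_sum]
    refine Finset.sum_eq_zero fun p _ => ?_
    have : g (E p p 1) = g (E p i0 1) * Matrix.single i0 i0 1 * g (E i0 p 1) := by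
      rw [hgE, hgE, hgE, map_one, Matrix.single_mul_single_same, Matrix.single_mul_single_same]
      simp
    rw [this, ← mul_assoc, ← mul_assoc, ← hcomm, mul_assoc (f _), hI4, mul_zero, zero_mul]
  have := finiteDimensional T
  -- In finite dimension, injectivity of left multiplication by G yields a right inverse;
  -- injectivity once more makes it two-sided.
  obtain ⟨X, hX⟩ := (LinearMap.injective_iff_surjective (f := LinearMap.mulLeft k G)).1
    ((injective_iff_map_eq_zero _).2 hinj) 1
  have hX : G * X = 1 := hX
  have hX' : X * G = 1 := sub_eq_zero.1 (hinj _ (by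
    rw [mul_sub, ← mul_assoc, hX, one_mul, mul_one, sub_self]))
  exact ⟨⟨G, X, hX, hX'⟩, hcomm⟩

end Conjugation

end CrossedProduct

/-! ### Matrix-isomorphic crossed products have cohomologous factor sets. -/

namespace CrossedProduct

variable {k H L : Type*} [Field k] [Group H] [Field L] [Algebra k L] [FiniteDimensional k L]
  [IsGalois k L]

/-- Factor sets of the Galois group with isomorphic matrix algebras are cohomologous. -/
theorem exists_coboundary_of_matrix_algEquiv [Finite H] (S T : FactorSet k H L)
    (hST : S.ω = T.ω) (hT : Function.Bijective T.ω) {ι : Type*} [Fintype ι] [DecidableEq ι]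
    [Nonempty ι] (θ : Matrix ι ι (CrossedProduct S) ≃ₐ[k] Matrix ι ι (CrossedProduct T)) :
    ∃ b : H → Lˣ, ∀ σ τ, (S.f σ τ : L) * b (σ * τ) = b σ * T.ω σ (b τ) * T.f σ τ := by
  classical
  obtain ⟨G, hG⟩ := exists_conj_scalarMatrix T hT (θ.toAlgHom.comp (scalarMatrix S ι))
  replace hG : ∀ b, θ (scalarMatrix S ι b) * G = G * scalarMatrix T ι b := hG
  -- After correcting θ by an inner automorphism, the matrices over L are mapped identically.
  let ψ : Matrix ι ι (CrossedProduct S) →* Matrix ι ι (CrossedProduct T) :=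
    { toFun := fun x => ((G⁻¹ : (Matrix ι ι (CrossedProduct T))ˣ) :
        Matrix ι ι (CrossedProduct T)) * θ x * G
      map_one' := by simp
      map_mul' := fun x y => by simp [mul_assoc] }
  have hψ : ∀ x, ψ x = ((G⁻¹ : (Matrix ι ι (CrossedProduct T))ˣ) :
      Matrix ι ι (CrossedProduct T)) * θ x * G := fun x => rfl
  have hψs : ∀ b, ψ (scalarMatrix S ι b) = scalarMatrix T ι b := by
    intro b
    rw [hψ, mul_assoc, hG, ← mul_assoc, Units.inv_mul, one_mul]
  let i0 : ι := Classical.arbitrary ι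
  have hdiag : ∀ (V : FactorSet k H L) (l : L),
      scalarMatrix V ι (Matrix.scalar ι l) = Matrix.scalar ι (scalar V l) := by
    intro V l
    ext a b
    simp only [AlgHom.mapMatrix_apply, Matrix.map_apply, Matrix.scalar_apply,
      Matrix.diagonal_apply]
    split_ifs <;> simp
  -- The image of x_σ commutes with all matrix units, so it is a scalar matrix c; since c l = σ(l)
  -- c, only the coefficient of c at x_σ can be nonzero.
  have key : ∀ σ, ∃ b : Lˣ, ψ (Matrix.scalar ι (term S σ 1)) = Matrix.scalar ι (term T σ b) := by
    intro σ
    have hc : ψ (Matrix.scalar ι (term S σ 1)) ∈ Set.range (Matrix.scalar ι) := by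
      refine Matrix.mem_range_scalar_iff_commute_single'.2 fun i j => ?_
      have h1 : (Matrix.single i j 1 : Matrix ι ι (CrossedProduct T))
          = ψ (Matrix.single i j 1) := by
        have := hψs (Matrix.single i j 1)
        rw [scalarMatrix_single, scalarMatrix_single, map_one, map_one] at this
        exact this.symm
      rw [h1]
      refine Commute.map (f := ψ) ?_
      have : Matrix.scalar ι (term S σ 1) ∈ Set.range (Matrix.scalar ι) := ⟨_, rfl⟩
      exact Matrix.mem_range_scalar_iff_commute_single'.1 this i j
    obtain ⟨c, hc⟩ := hc
    have hcomm : ∀ l, c * scalar T l = scalar T (T.ω σ l) * c := by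
      intro l
      have h1 : Matrix.scalar ι (term S σ 1) * scalarMatrix S ι (Matrix.scalar ι l)
          = scalarMatrix S ι (Matrix.scalar ι (T.ω σ l)) * Matrix.scalar ι (term S σ 1) := by
        rw [hdiag, hdiag, ← map_mul, ← map_mul, term_mul_scalar, scalar_mul_term, hST]
      have h2 := congrArg ψ h1
      rw [map_mul, map_mul, hψs, hψs, hdiag, hdiag, ← hc, ← map_mul, ← map_mul] at h2
      exact Matrix.scalar_inj.1 h2
    have hc0 : ∀ τ, τ ≠ σ → coeff T c τ = 0 := by
      intro τ hτ
      by_contra h0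
      apply hτ
      apply hT.1
      ext l
      have := congrArg (fun y => coeff T y τ) (hcomm l)
      simp only [coeff_mul_scalar, coeff_scalar_mul] at this
      exact mul_right_cancel₀ h0 this
    have hc1 : c = term T σ (coeff T c σ) := by
      refine ext_coeff T fun τ => ?_
      rw [coeff_term]
      split_ifs with h
      · rw [h]
      · exact hc0 τ (Ne.symm h)
    have hne : coeff T c σ ≠ 0 := by
      intro h0
      rw [h0, term_zero] at hc1
      have hu : IsUnit (ψ (Matrix.scalar ι (term S σ 1))) :=
        ((isUnit_term S σ 1 one_ne_zero).map (Matrix.scalar ι)).map ψ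
      rw [← hc, hc1, map_zero] at hu
      exact not_isUnit_zero hu
    exact ⟨Units.mk0 _ hne, by rw [← hc, Units.val_mk0, ← hc1]⟩
  choose b hb using key
  refine ⟨b, fun σ τ => ?_⟩
  -- The coboundary relation is the image under ψ of x_σ x_τ = f(σ, τ) x_{στ}.
  have h1 : Matrix.scalar ι (term S σ 1) * Matrix.scalar ι (term S τ 1)
      = scalarMatrix S ι (Matrix.scalar ι (S.f σ τ : L))
        * Matrix.scalar ι (term S (σ * τ) 1) := by
    rw [hdiag, ← map_mul, ← map_mul, term_mul_term, map_one, one_mul, one_mul, scalar_mul_term,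
      mul_one]
  have h2 := congrArg ψ h1
  rw [map_mul, map_mul, hψs, hdiag, hb, hb, hb, ← map_mul, ← map_mul, term_mul_term,
    scalar_mul_term] at h2
  have h3 := congrArg (fun y => coeff T y (σ * τ)) (Matrix.scalar_inj.1 h2)
  simp only [coeff_term, if_true] at h3
  exact h3.symm

end CrossedProduct

theorem prod_zmod_val {M : Type*} [CommMonoid M] {e : ℕ} [NeZero e]
    [Fintype (Multiplicative (ZMod e))] (F : ℕ → M) :
    ∏ i : Multiplicative (ZMod e), F i.toAdd.val = ∏ n ∈ Finset.range e, F n := by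
  refine Finset.prod_nbij (fun i => i.toAdd.val) (fun i _ => Finset.mem_range.2 (ZMod.val_lt _))
    (fun i _ j _ h => Multiplicative.toAdd.injective (ZMod.val_injective _ h))
    (fun n hn => ⟨Multiplicative.ofAdd (n : ZMod e), Finset.mem_coe.2 (Finset.mem_univ _), ?_⟩)
    fun i _ => rfl
  exact ZMod.val_cast_of_lt (Finset.mem_range.1 (Finset.mem_coe.1 hn))

/-- Cyclic algebras with isomorphic matrix algebras have parameters differing by a norm. -/
theorem exists_norm_eq_of_cyclicAlgebra_matrix_algEquiv {k L : Type*} [Field k] [Field L]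
    [Algebra k L] [FiniteDimensional k L] [IsGalois k L] (σ : L ≃ₐ[k] L) (hσ : 0 < orderOf σ)
    (hgen : Subgroup.zpowers σ = ⊤) (u v : kˣ) {ι : Type*} [Fintype ι] [DecidableEq ι] [Nonempty ι]
    (θ : Matrix ι ι (CyclicAlgebra σ hσ u) ≃ₐ[k] Matrix ι ι (CyclicAlgebra σ hσ v)) :
    ∃ b : Lˣ, algebraMap k L u
      = (∏ i ∈ Finset.range (orderOf σ), (σ ^ i) (b : L)) * algebraMap k L v := by
  classical
  have hne : NeZero (orderOf σ) := ⟨hσ.ne'⟩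
  have : Fintype (Multiplicative (ZMod (orderOf σ))) := Multiplicative.fintype
  have hbij : Function.Bijective (cyclicFactorSet σ hσ v).ω := by
    constructor
    · intro i j hij
      have h : σ ^ i.toAdd.val = σ ^ j.toAdd.val := hij
      have := pow_injOn_Iio_orderOf (Set.mem_Iio.2 (ZMod.val_lt _)) (Set.mem_Iio.2 (ZMod.val_lt _)) h
      exact Multiplicative.toAdd.injective (ZMod.val_injective _ this)
    · intro τ
      have hτ : τ ∈ Subgroup.zpowers σ := hgen ▸ Subgroup.mem_top τ
      obtain ⟨n, rfl⟩ := mem_powers_iff_mem_zpowers.2 hτ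
      refine ⟨Multiplicative.ofAdd (n : ZMod (orderOf σ)), ?_⟩
      change σ ^ (n : ZMod (orderOf σ)).val = σ ^ n
      rw [ZMod.val_natCast, pow_mod_orderOf]
  obtain ⟨b, hb⟩ := CrossedProduct.exists_coboundary_of_matrix_algEquiv
    (cyclicFactorSet σ hσ u) (cyclicFactorSet σ hσ v) rfl hbij θ
  -- In ZMod 1 the class of 1 has value 0, so the general argument does not apply; here the norm of
  -- b is b itself and b = u / v works.
  by_cases he : orderOf σ = 1
  · refine ⟨Units.map (algebraMap k L : k →* L) (u * v⁻¹), ?_⟩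
    simp [he]
  · have h1e : 1 < orderOf σ := by omega
    have hfact : Fact (1 < orderOf σ) := ⟨h1e⟩
    let g : Multiplicative (ZMod (orderOf σ)) := Multiplicative.ofAdd 1
    have hg : g.toAdd.val = 1 := ZMod.val_one _
    have hprodf : ∀ w : kˣ, ∏ i, ((cyclicFactorSet σ hσ w).f i g : L) = algebraMap k L w := by
      intro w
      -- Adding 1 to an exponent below e produces a carry only at e - 1.
      have hval : ∀ i : Multiplicative (ZMod (orderOf σ)), ((cyclicFactorSet σ hσ w).f i g : L)
          = if i = g⁻¹ then algebraMap k L w else 1 := by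
        intro i
        have h1 : (cyclicFactorSet σ hσ w).f i g = if i.toAdd.val + g.toAdd.val < orderOf σ then 1
          else Units.map (algebraMap k L : k →* L) w := rfl
        have h2 : i = g⁻¹ ↔ ¬ (i.toAdd.val + g.toAdd.val < orderOf σ) := by
          rw [hg, eq_inv_iff_mul_eq_one, ← toAdd_eq_zero, toAdd_mul, ← ZMod.val_eq_zero,
            ZMod.val_add, hg]
          have := ZMod.val_lt i.toAdd
          constructor
          · intro h hlt
            rw [Nat.mod_eq_of_lt hlt] at h
            omega
          · intro h
            have : i.toAdd.val + 1 = orderOf σ := by omega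
            rw [this, Nat.mod_self]
        rw [h1]
        by_cases h : i.toAdd.val + g.toAdd.val < orderOf σ
        · rw [if_pos h, if_neg (fun h' => h2.1 h' h), Units.val_one]
        · rw [if_neg h, if_pos (h2.2 h)]; rfl
      simp only [hval, Finset.prod_ite_eq', Finset.mem_univ, if_true]
    -- Multiply the coboundary relations for (i, g) over all i. The factor set contributes u and v
    -- once each, the values of b cancel after a shift of the index, and the norm of b(g) remains.
    have hprod := Finset.prod_congr (rfl : (Finset.univ :
      Finset (Multiplicative (ZMod (orderOf σ)))) = Finset.univ) fun i _ => hb i g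
    simp only [Finset.prod_mul_distrib, hprodf] at hprod
    have hshift : ∏ i, (b (i * g) : L) = ∏ i, (b i : L) :=
      Fintype.prod_equiv (Equiv.mulRight g) _ _ fun i => rfl
    have hb0 : ∏ i, (b i : L) ≠ 0 := Finset.prod_ne_zero_iff.2 fun i _ => (b i).ne_zero
    rw [hshift, mul_comm, mul_assoc] at hprod
    refine ⟨b g, (mul_left_cancel₀ hb0 hprod).trans ?_⟩
    congr 1
    exact prod_zmod_val fun n => (σ ^ n) (b g : L)

/-! ### Scalar extension of an algebra to a subfield -/

section TensorMatrix

variable {k M A C ι : Type*} [Field k] [Field M] [Algebra k M] [FiniteDimensional k M]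
  [Ring A] [Algebra k A] [Ring C] [Algebra M C] [Algebra k C] [IsScalarTower k M C]
  [FiniteDimensional M C] [Fintype ι] [DecidableEq ι]

/-- If `A` is a free right module over a subalgebra `C` whose center contains `M`, with a basis
indexed by a set of size `[M : k]`, and if `M ⊗ A` acts faithfully on `A`, then `M ⊗ A` is a matrix
algebra over `C`. -/
theorem nonempty_tensorProduct_algEquiv_matrix (j : C →ₐ[k] A) (g : ι → A)
    (hbij : Function.Bijective fun c : ι → C => ∑ i, g i * j (c i))
    (hcard : Fintype.card ι = Module.finrank k M)
    (hinj : ∀ a : Fin (Module.finrank k M) → A,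
      (∀ y, ∑ i, a i * (y * j (algebraMap M C (Module.finBasis k M i))) = 0) → ∀ i, a i = 0) :
    Nonempty (M ⊗[k] A ≃ₐ[M] Matrix ι ι C) := by
  classical
  let e : (ι → C) ≃ A := Equiv.ofBijective _ hbij
  have he : ∀ c, e c = ∑ i, g i * j (c i) := fun _ => rfl
  -- Left multiplication by a is linear for the right action of C; this is its matrix in the basis
  -- g.
  let mat : A → Matrix ι ι C := fun a => Matrix.of fun i l => e.symm (a * g l) i
  have hmat : ∀ a l, a * g l = ∑ i, g i * j (mat a i l) := by
    intro a l
    rw [← he, show (fun i => mat a i l) = e.symm (a * g l) from rfl, e.apply_symm_apply]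
  have huniq : ∀ a X, (∀ l, a * g l = ∑ i, g i * j (X i l)) → mat a = X := by
    intro a X h
    ext i l
    have : e.symm (a * g l) = fun i => X i l := by
      rw [Equiv.symm_apply_eq, he, h l]
    exact congrFun this i
  let φ : A →ₐ[k] Matrix ι ι C :=
    { toFun := mat
      map_one' := huniq _ _ fun l => by
        rw [Finset.sum_eq_single l]
        · simp
        · intro i _ hi; simp [hi]
        · simp
      map_mul' := fun a b => huniq _ _ fun l => by
        rw [mul_assoc, hmat b l, Finset.mul_sum]
        simp only [← mul_assoc, hmat a, Matrix.mul_apply, map_sum, map_mul, Finset.mul_sum,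
          Finset.sum_mul]
        exact Finset.sum_comm
      map_zero' := huniq _ _ fun l => by simp
      map_add' := fun a b => huniq _ _ fun l => by
        rw [add_mul, hmat a, hmat b]
        simp only [Matrix.add_apply, map_add, mul_add, Finset.sum_add_distrib]
      commutes' := fun c => huniq _ _ fun l => by
        rw [Finset.sum_eq_single l]
        · simp [Matrix.algebraMap_matrix_apply, Algebra.commutes]
        · intro i _ hi; simp [Matrix.algebraMap_matrix_apply, hi]
        · simp }
  have hφ : ∀ a, φ a = mat a := fun _ => rfl
  -- Since M is central in C, scalar matrices over M commute with the image of A; on A they act as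
  -- right multiplication by M.
  let Φ : M ⊗[k] A →ₐ[M] Matrix ι ι C :=
    Algebra.TensorProduct.lift (Algebra.ofId M _) φ fun m a => Algebra.commutes m (φ a)
  have hΦ : ∀ m a, Φ (m ⊗ₜ a) = algebraMap M _ m * φ a := fun m a =>
    Algebra.TensorProduct.lift_tmul ..
  have hΦinj : Function.Injective Φ := by
    rw [injective_iff_map_eq_zero]
    intro z hz
    obtain ⟨c, rfl⟩ := TensorProduct.eq_repr_basis_left (Module.finBasis k M) z
    rw [Finsupp.sum_fintype _ _ (by simp)] at hz ⊢
    -- An element killed by Φ annihilates every basis vector g l, and then all of A because the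
    -- action commutes with right multiplication by C; faithfulness applies.
    have h0 : ∀ i, c i = 0 := by
      refine hinj _ fun y => ?_
      obtain ⟨d, rfl⟩ := e.surjective y
      have h1 : ∀ l, ∑ i, c i * (g l * j (algebraMap M C (Module.finBasis k M i))) = 0 := by
        intro l
        have h2 : ∀ i, c i * (g l * j (algebraMap M C (Module.finBasis k M i)))
            = ∑ p, g p * j (Φ (Module.finBasis k M i ⊗ₜ c i) p l) := by
          intro i
          rw [← mul_assoc, hmat, Finset.sum_mul]
          refine Finset.sum_congr rfl fun p _ => ?_
          rw [hΦ, ← Algebra.smul_def, Matrix.smul_apply, hφ, mul_assoc, ← map_mul,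
            ← Algebra.commutes, Algebra.smul_def]
        simp only [h2]
        rw [Finset.sum_comm]
        refine Finset.sum_eq_zero fun p _ => ?_
        rw [← Finset.mul_sum, ← map_sum]
        have h3 := congrFun (congrFun hz p) l
        rw [map_sum, Matrix.sum_apply] at h3
        rw [h3]; simp
      have h2 : ∀ i, c i * (e d * j (algebraMap M C (Module.finBasis k M i)))
          = ∑ l, c i * (g l * j (algebraMap M C (Module.finBasis k M i))) * j (d l) := by
        intro i
        rw [he, Finset.sum_mul, Finset.mul_sum]
        refine Finset.sum_congr rfl fun l _ => ?_
        rw [mul_assoc (g l), ← map_mul, ← Algebra.commutes, map_mul]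
        simp only [mul_assoc]
      simp only [h2]
      rw [Finset.sum_comm]
      refine Finset.sum_eq_zero fun l _ => ?_
      rw [← Finset.sum_mul, h1, zero_mul]
    simp [h0]
  let eL : (ι → C) ≃ₗ[k] A :=
    { e with
      map_add' := fun c d => by
        change e _ = e _ + e _
        simp [he, mul_add, Finset.sum_add_distrib]
      map_smul' := fun t c => by
        change e _ = t • e _
        simp [he, Finset.smul_sum] }
  have : FiniteDimensional k C := FiniteDimensional.trans k M C
  have : FiniteDimensional k A := eL.finiteDimensional
  -- Both dimensions over M equal the square of [M : k] times [C : M], so injectivity suffices.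
  have hdim : Module.finrank M (M ⊗[k] A) = Module.finrank M (Matrix ι ι C) := by
    rw [Module.finrank_baseChange, ← eL.finrank_eq, Module.finrank_pi_fintype,
      Module.finrank_matrix]
    simp only [Finset.sum_const, Finset.card_univ, smul_eq_mul]
    rw [← Module.finrank_mul_finrank k M C, hcard, mul_assoc]
  have hsurj : Function.Surjective Φ :=
    (LinearMap.injective_iff_surjective_of_finrank_eq_finrank (f := Φ.toLinearMap) hdim).1 hΦinj
  exact ⟨AlgEquiv.ofBijective Φ ⟨hΦinj, hsurj⟩⟩

end TensorMatrix

/-! ### Cyclic algebras inside a crossed product -/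

namespace CrossedProduct

variable {k L : Type*} [Field k] [Field L] [Algebra k L]

/-- Homomorphism from a cyclic algebra given by an element `y` with `y l = σ(l) y`, `y ^ e = v`. -/
noncomputable def cyclicLift {M A : Type*} [Field M] [Algebra M L] [Ring A] (σ : L ≃ₐ[M] L)
    (hσ : 0 < orderOf σ) (v : Mˣ) (s : L →+* A) (y : A) (hy : ∀ l, y * s l = s (σ l) * y)
    (hyv : y ^ orderOf σ = s (algebraMap M L v)) : CyclicAlgebra σ hσ v →+* A :=
  have hpow : ∀ (n : ℕ) l, y ^ n * s l = s ((σ ^ n) l) * y ^ n := by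
    intro n
    induction n with
    | zero => simp
    | succ n ih =>
      intro l
      rw [pow_succ, mul_assoc, hy, ← mul_assoc, ih, mul_assoc, pow_succ σ, AlgEquiv.mul_apply]
  let φ : CyclicAlgebra σ hσ v →+ A := liftHom (cyclicFactorSet σ hσ v) fun i =>
      AddMonoidHom.mk' (fun l => s l * y ^ i.toAdd.val) fun a b => by rw [map_add, add_mul]
  have hφ : ∀ i a, φ (term (cyclicFactorSet σ hσ v) i a) = s a * y ^ i.toAdd.val := fun i a => by
    simp only [φ, liftHom_term, AddMonoidHom.mk'_apply]
  { φ with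
    map_one' := by
      change φ 1 = 1
      have : (cyclicFactorSet σ hσ v).f 1 1 = 1 := if_pos (by
        have : NeZero (orderOf σ) := ⟨hσ.ne'⟩
        simpa using hσ)
      rw [one_def, hφ, this]
      simp
    map_mul' := fun a b => by
      change φ (a * b) = φ a * φ b
      induction a using induction with
      | h0 => simp
      | hadd a a' ha ha' => rw [add_mul, map_add, map_add, add_mul, ha, ha']
      | hterm i a =>
      induction b using induction with
      | h0 => simp
      | hadd b b' hb hb' => rw [mul_add, map_add, map_add, mul_add, hb, hb']
      | hterm l b =>
        have : NeZero (orderOf σ) := ⟨hσ.ne'⟩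
        have hi := ZMod.val_lt i.toAdd
        have hl := ZMod.val_lt l.toAdd
        rw [term_mul_term, hφ, hφ, hφ, toAdd_mul, ZMod.val_add]
        have h1 : (cyclicFactorSet σ hσ v).f i l = if i.toAdd.val + l.toAdd.val < orderOf σ then 1
          else Units.map (algebraMap M L : M →* L) v := rfl
        have h2 : (cyclicFactorSet σ hσ v).ω i b = (σ ^ i.toAdd.val) b := rfl
        rw [mul_assoc (s a), ← mul_assoc (y ^ _) (s b), hpow, h1, h2, map_mul, map_mul]
        simp only [mul_assoc]
        congr 2
        rw [← pow_add]
        split_ifs with h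
        · rw [Nat.mod_eq_of_lt h]; simp
        · rw [Nat.mod_eq_sub_mod (by omega), Nat.mod_eq_of_lt (by omega)]
          change s (algebraMap M L v) * _ = _
          rw [← hyv, ← pow_add]
          congr 1; omega }

theorem cyclicLift_term {M A : Type*} [Field M] [Algebra M L] [Ring A] (σ : L ≃ₐ[M] L)
    (hσ : 0 < orderOf σ) (v : Mˣ) (s : L →+* A) (y : A) (hy : ∀ l, y * s l = s (σ l) * y)
    (hyv : y ^ orderOf σ = s (algebraMap M L v)) (i : Multiplicative (ZMod (orderOf σ))) (a : L) :
    cyclicLift σ hσ v s y hy hyv (term (cyclicFactorSet σ hσ v) i a) = s a * y ^ i.toAdd.val := by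
  change liftHom (cyclicFactorSet σ hσ v) _ _ = _
  rw [liftHom_term, AddMonoidHom.mk'_apply]

/-- Only the position of the power matters here; the unit d is left unspecified. -/
theorem term_pow {H : Type*} [Group H] (S : FactorSet k H L) (σ : H) (w : Lˣ) (n : ℕ) :
    ∃ d : Lˣ, term S σ w ^ n = term S (σ ^ n) d := by
  induction n with
  | zero => exact ⟨(S.f 1 1)⁻¹, by rw [pow_zero, pow_zero, one_def]⟩
  | succ n ih =>
    obtain ⟨d, hd⟩ := ih
    refine ⟨d * Units.map (S.ω (σ ^ n) : L →* L) w * S.f (σ ^ n) σ, ?_⟩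
    rw [pow_succ, hd, term_mul_term, pow_succ]
    rfl

/-- The trace form pairs a basis of an intermediate field with suitable elements of `L`. -/
theorem exists_trace_mul_basis [FiniteDimensional k L] [Algebra.IsSeparable k L]
    (M : IntermediateField k L) {ι : Type*} [Finite ι] [DecidableEq ι] (v : Module.Basis ι k M)
    (j : ι) : ∃ l : L, ∀ i, Algebra.trace k L ((v i : L) * l) = if i = j then 1 else 0 := by
  obtain ⟨w, hw⟩ := exists_trace_dual_of_basis k M v
  obtain ⟨l, hl⟩ := Algebra.trace_surjective M L 1
  -- The dual basis vector w j of M / k times an element l of relative trace 1: by transitivity the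
  -- trace down to k is the one computed in M.
  refine ⟨(w j : L) * l, fun i => ?_⟩
  rw [← hw i j, ← Algebra.trace_trace (S := M), ← mul_assoc]
  congr 1
  have : (v i : L) * (w j : L) * l = (v i * w j) • l := rfl
  rw [this, map_smul, hl, smul_eq_mul, mul_one]

/-- Restriction of the crossed product of `Gal(L / k)` to a subfield `M` with `L / M` cyclic. -/
theorem nonempty_tensorProduct_algEquiv_matrix_cyclicAlgebra [FiniteDimensional k L] [IsGalois k L]
    (S : FactorSet k (L ≃ₐ[k] L) L) (hS : ∀ τ, S.ω τ = τ) (M : IntermediateField k L)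
    (σ : L ≃ₐ[M] L) (hσ : 0 < orderOf σ) (hgen : Subgroup.zpowers σ = ⊤) (w : Lˣ) (v : Mˣ)
    (hv : term S (σ.restrictScalars k) (w : L) ^ orderOf σ = scalar S (algebraMap M L v)) :
    Nonempty (M ⊗[k] CrossedProduct S ≃ₐ[M]
      Matrix (Fin (Module.finrank k M)) (Fin (Module.finrank k M)) (CyclicAlgebra σ hσ v)) := by
  classical
  set σk : L ≃ₐ[k] L := σ.restrictScalars k with hσk
  set C := CyclicAlgebra σ hσ v with hC
  have : NeZero (orderOf σ) := ⟨hσ.ne'⟩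
  let Fz : Fintype (Multiplicative (ZMod (orderOf σ))) := Multiplicative.fintype
  let _ : Algebra k C := Algebra.compHom C (algebraMap k M)
  have hmap : ∀ c : k, algebraMap k C c = algebraMap M C (algebraMap k M c) := fun c => rfl
  have : IsScalarTower k M C := IsScalarTower.of_algebraMap_eq hmap
  set y := term S σk (w : L) with hy
  have hycomm : ∀ l, y * scalar S l = scalar S (σ l) * y := by
    intro l
    rw [hy, term_mul_scalar, scalar_mul_term, hS]
    rfl
  -- The cyclic algebra maps to the crossed product with generator sent to y = w x_σ; the hypothesis
  -- on y ^ e is the defining relation.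
  let j0 : C →+* CrossedProduct S :=
    cyclicLift σ hσ v (scalar S : L →+* CrossedProduct S) y hycomm hv
  have hj0 : ∀ i a, j0 (term (cyclicFactorSet σ hσ v) i a) = scalar S a * y ^ i.toAdd.val :=
    cyclicLift_term σ hσ v (scalar S : L →+* CrossedProduct S) y hycomm hv
  have hj0M : ∀ m : M, j0 (algebraMap M C m) = scalar S (m : L) := by
    intro m
    have h1 : (cyclicFactorSet σ hσ v).f 1 1 = 1 := if_pos (by simpa using hσ)
    rw [Algebra.algebraMap_eq_smul_one, one_def, smul_term, hj0, h1]
    simp [Algebra.smul_def]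
  let j : C →ₐ[k] CrossedProduct S :=
    { j0 with
      commutes' := fun c => by
        change j0 (algebraMap k C c) = _
        rw [hmap, hj0M, ← (scalar S).commutes]
        rfl }
  have hj : ∀ x, j x = j0 x := fun _ => rfl
  let Z := Subgroup.zpowers σk
  -- Representatives of the cosets of ⟨σ⟩ give a basis of the crossed product as a right module over
  -- the cyclic algebra; there are [M : k] of them.
  let g : (L ≃ₐ[k] L) ⧸ Z → CrossedProduct S := fun q => term S q.out 1
  have hordσ : orderOf σ = Module.finrank M L := by
    rw [← IsGalois.card_aut_eq_finrank, ← Nat.card_zpowers, hgen]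
    exact Nat.card_congr Subgroup.topEquiv.toEquiv
  have hinjr : Function.Injective (fun τ : L ≃ₐ[M] L => τ.restrictScalars k) :=
    AlgEquiv.restrictScalars_injective k
  let rs : (L ≃ₐ[M] L) →* (L ≃ₐ[k] L) :=
    { toFun := fun τ => τ.restrictScalars k, map_one' := rfl, map_mul' := fun _ _ => rfl }
  have hord : orderOf σk = orderOf σ := orderOf_injective rs hinjr σ
  let FQ : Fintype ((L ≃ₐ[k] L) ⧸ Z) := Fintype.ofFinite _
  have hcard : Fintype.card ((L ≃ₐ[k] L) ⧸ Z) = Module.finrank k M := by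
    have h1 := Z.index_mul_card
    rw [Nat.card_zpowers, hord, hordσ, IsGalois.card_aut_eq_finrank,
      ← Module.finrank_mul_finrank k M L] at h1
    rw [← Nat.card_eq_fintype_card]
    exact Nat.eq_of_mul_eq_mul_right Module.finrank_pos h1
  have : FiniteDimensional M C := finiteDimensional _
  let E : (((L ≃ₐ[k] L) ⧸ Z) → C) →ₗ[k] CrossedProduct S :=
    { toFun := fun c => ∑ i, g i * j (c i)
      map_add' := fun c d => by simp [mul_add, Finset.sum_add_distrib]
      map_smul' := fun t c => by simp [Finset.smul_sum] }
  have hEsurj : Function.Surjective E := by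
    intro x
    induction x using induction with
    | h0 => exact ⟨0, map_zero _⟩
    | hadd x x' hx hx' =>
      obtain ⟨c, rfl⟩ := hx
      obtain ⟨c', rfl⟩ := hx'
      exact ⟨c + c', map_add _ _ _⟩
    | hterm τ a =>
      obtain ⟨h, hh⟩ := QuotientGroup.mk_out_eq_mul Z τ
      set ρ := (QuotientGroup.mk τ : (L ≃ₐ[k] L) ⧸ Z).out with hρ
      have hmem : ρ⁻¹ * τ ∈ Z := by
        rw [hh]; simp
      obtain ⟨n, hn⟩ := mem_powers_iff_mem_zpowers.2 hmem
      have hn : σk ^ n = ρ⁻¹ * τ := hn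
      obtain ⟨d, hd⟩ := term_pow S σk w (n % orderOf σ)
      have hd : y ^ (n % orderOf σ) = term S (ρ⁻¹ * τ) d := by
        rw [hy, hd, ← hord, pow_mod_orderOf, hn]
      -- With τ = ρ σ ^ n and y ^ n = d x_{σ ^ n}, the coefficient l is the solution of ρ(l d) f(ρ,
      -- ρ⁻¹ τ) = a, which says that x_ρ l y ^ n = a x_τ. The exponent n is reduced modulo e
      -- throughout.
      refine ⟨Pi.single (QuotientGroup.mk τ) (term (cyclicFactorSet σ hσ v)
        (Multiplicative.ofAdd (n : ZMod (orderOf σ)))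
        (ρ.symm (a * ((S.f ρ (ρ⁻¹ * τ))⁻¹ : Lˣ)) * ((d⁻¹ : Lˣ) : L))), ?_⟩
      change ∑ i, g i * j _ = _
      rw [Finset.sum_eq_single (QuotientGroup.mk τ)]
      · rw [Pi.single_eq_same, hj, hj0, toAdd_ofAdd, ZMod.val_natCast, hd, scalar_mul_term,
          mul_assoc, Units.inv_mul, mul_one]
        change term S ρ 1 * _ = _
        rw [term_mul_term, one_mul, hS, AlgEquiv.apply_symm_apply, mul_assoc, Units.inv_mul,
          mul_one, mul_inv_cancel_left]
      · intro i _ hi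
        rw [Pi.single_eq_of_ne hi, map_zero, mul_zero]
      · simp
  have : FiniteDimensional k C := FiniteDimensional.trans k M C
  have : FiniteDimensional k (CrossedProduct S) := finiteDimensional S
  have hdim : Module.finrank k (((L ≃ₐ[k] L) ⧸ Z) → C) = Module.finrank k (CrossedProduct S) := by
    rw [Module.finrank_pi_fintype, finrank_eq S, IsGalois.card_aut_eq_finrank]
    simp only [Finset.sum_const, Finset.card_univ, smul_eq_mul, hcard]
    rw [← Module.finrank_mul_finrank k M C, finrank_eq, Nat.card_congr Multiplicative.toAdd,
      Nat.card_zmod, hordσ, ← Module.finrank_mul_finrank k M L]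
    ring
  have hEbij : Function.Bijective E :=
    ⟨(LinearMap.injective_iff_surjective_of_finrank_eq_finrank hdim).2 hEsurj, hEsurj⟩
  obtain ⟨e⟩ := nonempty_tensorProduct_algEquiv_matrix (M := M) j g hEbij hcard (by
    intro a ha i
    -- Testing faithfulness on y = x_τ gives relations with all conjugates of the basis of M.
    -- Multiplying them by τ(l) and summing over τ gives traces, and l is chosen so that these
    -- isolate one coefficient.
    have h1 : ∀ τ : L ≃ₐ[k] L, ∑ i, a i * scalar S (τ (Module.finBasis k M i : L)) = 0 := by
      intro τ
      have h2 := ha (term S τ 1)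
      simp only [hj, hj0M] at h2
      have h3 : ∀ i, a i * (term S τ 1 * scalar S (Module.finBasis k M i : L))
          = a i * scalar S (τ (Module.finBasis k M i : L)) * term S τ 1 := by
        intro i
        rw [term_mul_scalar, mul_assoc, scalar_mul_term, hS]
      simp only [h3] at h2
      rw [← Finset.sum_mul] at h2
      exact (isUnit_term S τ 1 one_ne_zero).mul_left_eq_zero.1 h2
    refine ext_coeff S fun ρ => ?_
    have h4 : ∀ τ : L ≃ₐ[k] L, ∑ i, τ (Module.finBasis k M i : L) * coeff S (a i) ρ = 0 := by
      intro τ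
      have h5 := congrArg (fun x => coeff S x ρ) (h1 (ρ⁻¹ * τ))
      simp only [coeff_sum, coeff_mul_scalar, hS, coeff_zero] at h5
      simpa only [← AlgEquiv.mul_apply, mul_inv_cancel_left] using h5
    obtain ⟨l, hl⟩ := exists_trace_mul_basis M (Module.finBasis k M) i
    have h6 : ∑ p, algebraMap k L (Algebra.trace k L ((Module.finBasis k M p : L) * l))
        * coeff S (a p) ρ = 0 := by
      simp only [trace_eq_sum_automorphisms, Finset.sum_mul, map_mul]
      rw [Finset.sum_comm]
      refine Finset.sum_eq_zero fun τ _ => ?_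
      have := congrArg (fun x => τ l * x) (h4 τ)
      simp only [Finset.mul_sum, mul_zero] at this
      rw [← this]
      exact Finset.sum_congr rfl fun p _ => by ring
    simpa [hl, coeff_zero] using h6)
  exact ⟨e.trans (Matrix.reindexAlgEquiv M C
    (Fintype.equivFinOfCardEq hcard))⟩

end CrossedProduct

/-! ### Brauer equivalence with cyclic algebras -/

theorem brauerSimilar_of_algEquiv_matrix {k A B : Type*} [Field k] [Ring A] [Algebra k A] [Ring B]
    [Algebra k B] {m : ℕ} (hm : m ≠ 0) (e : A ≃ₐ[k] Matrix (Fin m) (Fin m) B) :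
    BrauerSimilar k A B :=
  ⟨1, m, one_ne_zero, hm, ⟨(e.mapMatrix (m := Fin 1)).trans
    ((Matrix.compAlgEquiv (Fin 1) (Fin m) B k).trans
      (Matrix.reindexAlgEquiv k B (Equiv.uniqueProd (Fin m) (Fin 1))))⟩⟩

theorem exists_norm_eq_of_brauerSimilar {k L A : Type*} [Field k] [Field L] [Algebra k L]
    [FiniteDimensional k L] [IsGalois k L] [Ring A] [Algebra k A] (σ : L ≃ₐ[k] L)
    (hσ : 0 < orderOf σ) (hgen : Subgroup.zpowers σ = ⊤) (u v : kˣ) {m : ℕ}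
    (e : A ≃ₐ[k] Matrix (Fin m) (Fin m) (CyclicAlgebra σ hσ v))
    (h : BrauerSimilar k A (CyclicAlgebra σ hσ u)) :
    ∃ b : Lˣ, algebraMap k L u
      = (∏ i ∈ Finset.range (orderOf σ), (σ ^ i) (b : L)) * algebraMap k L v := by
  have : NeZero (orderOf σ) := ⟨hσ.ne'⟩
  let Fz : Fintype (Multiplicative (ZMod (orderOf σ))) := Multiplicative.fintype
  obtain ⟨p, q, hp, hq, ⟨θ⟩⟩ := h
  have : NeZero q := ⟨hq⟩
  let ψ : Matrix (Fin p × Fin m) (Fin p × Fin m) (CyclicAlgebra σ hσ v) ≃ₐ[k]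
      Matrix (Fin q) (Fin q) (CyclicAlgebra σ hσ u) :=
    (Matrix.compAlgEquiv (Fin p) (Fin m) _ k).symm.trans
      ((e.symm.mapMatrix (m := Fin p)).trans θ)
  -- The two cyclic algebras have the same dimension, so comparing dimensions forces pm = q and
  -- makes the matrix sizes equal.
  have hd := ψ.toLinearEquiv.finrank_eq
  rw [Module.finrank_matrix, Module.finrank_matrix, CrossedProduct.finrank_eq,
    CrossedProduct.finrank_eq] at hd
  have hpos : 0 < Nat.card (Multiplicative (ZMod (orderOf σ))) * Module.finrank k L :=
    Nat.mul_pos Nat.card_pos Module.finrank_pos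
  have hd2 := Nat.eq_of_mul_eq_mul_right hpos hd
  have hd3 : Fintype.card (Fin p × Fin m) = Fintype.card (Fin q) := Nat.mul_self_inj.1 hd2
  exact exists_norm_eq_of_cyclicAlgebra_matrix_algEquiv σ hσ hgen u v
    (ψ.symm.trans (Matrix.reindexAlgEquiv k _ (Fintype.equivOfCardEq hd3)))

/-! ### Kummer extensions -/

theorem mem_fixedField_zpowers {k E : Type*} [Field k] [Field E] [Algebra k E] {τ : E ≃ₐ[k] E}
    {x : E} : x ∈ IntermediateField.fixedField (Subgroup.zpowers τ) ↔ τ x = x := by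
  rw [IntermediateField.mem_fixedField_iff]
  refine ⟨fun h => h τ (Subgroup.mem_zpowers τ), fun h f hf => ?_⟩
  have : Subgroup.zpowers τ ≤ MulAction.stabilizer (E ≃ₐ[k] E) x := by
    rw [Subgroup.zpowers_le, MulAction.mem_stabilizer_iff]
    exact h
  exact this hf

/-- The fixed field of the group generated by τ contains k and the generator t, hence everything. -/
theorem eq_one_of_apply_eq_of_adjoin_eq_top {k E : Type*} [Field k] [Field E] [Algebra k E] {t : E}
    (htop : IntermediateField.adjoin k {t} = ⊤) {τ : E ≃ₐ[k] E} (h : τ t = t) : τ = 1 := by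
  have h1 : IntermediateField.adjoin k {t} ≤ IntermediateField.fixedField (Subgroup.zpowers τ) := by
    rw [IntermediateField.adjoin_simple_le_iff]
    exact mem_fixedField_zpowers.2 h
  ext x
  exact mem_fixedField_zpowers.1 (h1 (htop ▸ IntermediateField.mem_top))

/-- An extension generated by an `n`-th root is cyclic in the presence of roots of unity. -/
theorem isCyclicGalois_of_adjoin_eq_top {k E : Type*} [Field k] [Field E] [Algebra k E] {n : ℕ}
    (hn : 0 < n) {ζ : k} (hζ : IsPrimitiveRoot ζ n) {t : E} {g : k} (ht : t ^ n = algebraMap k E g)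
    (ht0 : t ≠ 0) (htop : IntermediateField.adjoin k {t} = ⊤) : IsCyclicGalois k E := by
  classical
  have hint : IsIntegral k t := ⟨Polynomial.X ^ n - Polynomial.C g,
    Polynomial.monic_X_pow_sub_C _ hn.ne', by simp [ht]⟩
  have : NeZero n := ⟨hn.ne'⟩
  have : NeZero (n : k) := hζ.neZero'
  have hfin : FiniteDimensional k E := by
    have := IntermediateField.adjoin.finiteDimensional hint
    rw [htop] at this
    exact (IntermediateField.topEquiv (F := k) (E := E)).toLinearEquiv.finiteDimensional
  have hg : g ≠ 0 := by
    rintro rfl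
    rw [map_zero] at ht
    exact ht0 (pow_eq_zero_iff hn.ne' |>.1 ht)
  have hζE : IsPrimitiveRoot (algebraMap k E ζ) n :=
    hζ.map_of_injective (algebraMap k E).injective
  have hgal : IsGalois k E := by
    have : (Polynomial.X ^ n - Polynomial.C g).IsSplittingField k E := by
      refine ⟨?_, ?_⟩
      · rw [Polynomial.map_sub, Polynomial.map_pow, Polynomial.map_X, Polynomial.map_C]
        exact X_pow_sub_C_splits_of_isPrimitiveRoot hζE ht
      · have h1 : IntermediateField.adjoin k {t} ≤ ⊤ := le_top
        have h2 : Algebra.adjoin k {t} = ⊤ := by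
          rw [← IntermediateField.adjoin_simple_toSubalgebra_of_isAlgebraic hint.isAlgebraic, htop,
            IntermediateField.top_toSubalgebra]
        rw [eq_top_iff, ← h2]
        refine Algebra.adjoin_mono ?_
        rintro _ rfl
        rw [Polynomial.mem_rootSet]
        exact ⟨Polynomial.X_pow_sub_C_ne_zero hn _, by simp [ht]⟩
    exact IsGalois.of_separable_splitting_field
      (Polynomial.separable_X_pow_sub_C g (NeZero.ne (n : k)) hg)
  refine ⟨hgal, ?_⟩
  have hroot : ∀ τ : E ≃ₐ[k] E, ∃ c : k, τ t = algebraMap k E c * t := by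
    intro τ
    have h1 : (τ t / t) ^ n = 1 := by
      rw [div_pow, ← map_pow, ht, AlgEquiv.commutes, div_self]
      exact (map_ne_zero _).2 hg
    obtain ⟨i, -, hi⟩ := hζE.eq_pow_of_pow_eq_one h1
    exact ⟨ζ ^ i, by rw [map_pow, hi, div_mul_cancel₀ _ ht0]⟩
  -- The Kummer character τ ↦ τ(t) / t is multiplicative because its values are roots of unity of k.
  -- It is injective as t generates E, and a finite group embedded in the multiplicative monoid of a
  -- field is cyclic.
  let φ : (E ≃ₐ[k] E) →* E :=
    { toFun := fun τ => τ t / t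
      map_one' := div_self ht0
      map_mul' := fun τ ρ => by
        obtain ⟨c, hc⟩ := hroot ρ
        rw [AlgEquiv.mul_apply, hc, map_mul, AlgEquiv.commutes, mul_div_assoc, mul_div_assoc,
          div_self ht0, mul_one, mul_comm] }
  refine isCyclic_of_injective_ringHom φ fun τ ρ h => ?_
  have h1 : τ t = ρ t := by
    have : τ t / t = ρ t / t := h
    rwa [div_left_inj' ht0] at this
  have h2 : ρ⁻¹ * τ = 1 := eq_one_of_apply_eq_of_adjoin_eq_top htop (by
    rw [AlgEquiv.mul_apply, h1]; exact ρ.symm_apply_apply t)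
  exact (inv_mul_eq_one.1 h2).symm

section Kummer

variable {k M : Type*} [Field k] [Field M] [Algebra k M] [FiniteDimensional k M]

theorem exponent_eq_finrank (h : IsCyclicGalois k M) :
    Monoid.exponent (M ≃ₐ[k] M) = Module.finrank k M := by
  have := h.1
  have := h.2
  rw [IsCyclic.exponent_eq_card, IsGalois.card_aut_eq_finrank]

/-- In the cyclic case the exponent of the Galois group is its order, which is the degree. -/
theorem mem_KUM_iff (h : IsCyclicGalois k M) (u : Mˣ) :
    u ∈ KUM k M ↔ ∃ c : k, algebraMap k M c = (u : M) ^ Module.finrank k M := by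
  rw [KUM, Subgroup.mem_comap, powMonoidHom_apply, exponent_eq_finrank h]
  constructor
  · rintro ⟨c, hc⟩
    exact ⟨c, by simpa using congrArg Units.val hc⟩
  · rintro ⟨c, hc⟩
    have hc0 : c ≠ 0 := by
      rintro rfl
      rw [map_zero] at hc
      exact u.ne_zero (pow_eq_zero_iff Module.finrank_pos.ne' |>.1 hc.symm)
    exact ⟨Units.mk0 c hc0, Units.ext (by simpa using hc)⟩

/-- A Kummer generator of `M / k` generates the Kummer group. -/
theorem zpowers_kum_eq_top_of_adjoin_eq_top (h : IsCyclicGalois k M) {ζ : k}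
    (hζ : IsPrimitiveRoot ζ (Module.finrank k M)) (u : KUM k M)
    (htop : IntermediateField.adjoin k {((u : Mˣ) : M)} = ⊤) :
    Subgroup.zpowers (u : kum k M) = ⊤ := by
  have hg := h.1
  have := h.2
  set m := Module.finrank k M with hm
  have hm0 : 0 < m := Module.finrank_pos
  have : NeZero m := ⟨hm0.ne'⟩
  obtain ⟨τ, hτ⟩ := IsCyclic.exists_generator (α := M ≃ₐ[k] M)
  have hζM : IsPrimitiveRoot (algebraMap k M ζ) m :=
    hζ.map_of_injective (algebraMap k M).injective
  have hroot : ∀ w ∈ KUM k M, ∃ i : ℕ, τ w = algebraMap k M ζ ^ i * w := by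
    intro w hw
    obtain ⟨c, hc⟩ := (mem_KUM_iff h w).1 hw
    have h1 : (τ w / w) ^ m = 1 := by
      rw [div_pow, ← map_pow, ← hc, AlgEquiv.commutes, hc, div_self]
      exact pow_ne_zero _ w.ne_zero
    obtain ⟨i, -, hi⟩ := hζM.eq_pow_of_pow_eq_one h1
    exact ⟨i, by rw [hi, div_mul_cancel₀ _ w.ne_zero]⟩
  have hfix : ∀ x : M, τ x = x → ∃ c, algebraMap k M c = x := by
    intro x hx
    have : x ∈ IntermediateField.fixedField (Subgroup.zpowers τ) :=
      mem_fixedField_zpowers.2 hx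
    rw [(Subgroup.eq_top_iff' _).2 hτ, IsGalois.fixedField_top] at this
    exact IntermediateField.mem_bot.1 this
  obtain ⟨i, hi⟩ := hroot u u.2
  -- If the root of unity τ(u) / u had order s < m, then τ ^ s would fix the generator u and be
  -- trivial, although τ has order m.
  have hprim : IsPrimitiveRoot (algebraMap k M ζ ^ i) m := by
    refine (IsPrimitiveRoot.mk_of_lt _ hm0 ?_ ?_)
    · rw [← pow_mul, mul_comm, pow_mul, hζM.pow_eq_one, one_pow]
    · intro s hs0 hsm hs
      have hpow : ∀ s : ℕ, (τ ^ s) ((u : Mˣ) : M)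
          = (algebraMap k M ζ ^ i) ^ s * ((u : Mˣ) : M) := by
        intro s
        induction s with
        | zero => simp
        | succ s ih =>
          rw [pow_succ' τ, AlgEquiv.mul_apply, ih, map_mul, hi, ← map_pow, ← map_pow,
            AlgEquiv.commutes, pow_succ]
          simp only [map_pow]
          ring
      have h1 : (τ ^ s) ((u : Mˣ) : M) = (u : Mˣ) := by rw [hpow, hs, one_mul]
      have h2 : τ ^ s = 1 :=
        eq_one_of_apply_eq_of_adjoin_eq_top htop h1
      have h3 : orderOf τ = m := by
        rw [orderOf_eq_card_of_forall_mem_zpowers hτ, IsGalois.card_aut_eq_finrank]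
      have h4 := orderOf_dvd_of_pow_eq_one h2
      rw [h3] at h4
      exact absurd (Nat.le_of_dvd hs0 h4) (by omega)
  rw [Subgroup.eq_top_iff']
  intro x
  obtain ⟨w, rfl⟩ := QuotientGroup.mk_surjective x
  obtain ⟨l, hl⟩ := hroot w w.2
  have h1 : (algebraMap k M ζ ^ l) ^ m = 1 := by
    rw [← pow_mul, mul_comm, pow_mul, hζM.pow_eq_one, one_pow]
  obtain ⟨s, -, hs⟩ := hprim.eq_pow_of_pow_eq_one h1
  refine ⟨(s : ℤ), ?_⟩
  change (u : kum k M) ^ (s : ℤ) = (w : kum k M)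
  rw [zpow_natCast, ← QuotientGroup.mk_pow, QuotientGroup.eq, Subgroup.mem_subgroupOf]
  -- The exponent s is chosen so that u ^ s and w have the same eigenvalue under τ; their quotient
  -- is therefore fixed by τ and lies in k.
  obtain ⟨c, hc⟩ := hfix ((w : Mˣ) / ((u : Mˣ) : M) ^ s) (by
    rw [map_div₀, map_pow, hi, hl, mul_pow, ← hs]
    rw [mul_div_mul_left]
    exact pow_ne_zero _ (pow_ne_zero _ (hζM.ne_zero hm0.ne')))
  have hc0 : c ≠ 0 := by
    rintro rfl
    rw [map_zero] at hc
    exact div_ne_zero (w : Mˣ).ne_zero (pow_ne_zero _ (u : Mˣ).ne_zero) hc.symm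
  refine ⟨Units.mk0 c hc0, Units.ext ?_⟩
  change algebraMap k M c = _
  rw [hc]
  simp [div_eq_inv_mul]

/-- A generator of the Kummer group generates the cyclic extension `M / k`. -/
theorem adjoin_eq_top_of_zpowers_kum_eq_top (h : IsCyclicGalois k M) {ζ : k}
    (hζ : IsPrimitiveRoot ζ (Module.finrank k M)) (u : KUM k M)
    (hu : Subgroup.zpowers (u : kum k M) = ⊤) :
    IntermediateField.adjoin k {((u : Mˣ) : M)} = ⊤ := by
  have := h.1
  have := h.2
  obtain ⟨α, ⟨c, hc⟩, hα⟩ := exists_root_adjoin_eq_top_of_isCyclic k M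
    ⟨ζ, (mem_primitiveRoots Module.finrank_pos).2 hζ⟩
  rw [eq_top_iff, ← hα, IntermediateField.adjoin_simple_le_iff]
  -- The Kummer generator α may be 0 when M = k, and then it defines no class in the Kummer group.
  by_cases hα0 : α = 0
  · rw [hα0]; exact zero_mem _
  let a : KUM k M := ⟨Units.mk0 α hα0, (mem_KUM_iff h _).2 ⟨c, hc⟩⟩
  have ha : (a : kum k M) ∈ Subgroup.zpowers (u : kum k M) := hu ▸ Subgroup.mem_top _
  obtain ⟨s, hs⟩ := ha
  change (u : kum k M) ^ s = (a : kum k M) at hs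
  rw [← QuotientGroup.mk_zpow, QuotientGroup.eq, Subgroup.mem_subgroupOf] at hs
  obtain ⟨d, hd⟩ := hs
  have h1 := congrArg Units.val hd
  have h2 : α = ((u : Mˣ) : M) ^ s * algebraMap k M d := by
    have : algebraMap k M d = (((u : Mˣ) : M) ^ s)⁻¹ * α := by simpa [a] using h1
    rw [this, mul_inv_cancel_left₀]
    exact zpow_ne_zero _ (u : Mˣ).ne_zero
  rw [h2]
  exact mul_mem (zpow_mem (IntermediateField.mem_adjoin_simple_self k _) s)
    (IntermediateField.algebraMap_mem _ _)

end Kummer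

/-- A domain generated by an `n`-th root has a cyclic extension of fraction fields. -/
theorem isCyclicFractionExtension_of_adjoin_eq_top {F K : Type*} [CommRing F] [IsDomain F]
    [CommRing K] [IsDomain K] [Algebra F K] [FaithfulSMul F K] {n : ℕ} (hn : 0 < n) {ζ : F}
    (hζ : IsPrimitiveRoot ζ n) {t : K} (ht0 : t ≠ 0) {g : F} (ht : t ^ n = algebraMap F K g)
    (htop : Algebra.adjoin F {t} = ⊤) : IsCyclicFractionExtension F K := by
  unfold IsCyclicFractionExtension
  let _ : Algebra (FractionRing F) (FractionRing K) := FractionRing.liftAlgebra F (FractionRing K)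
  have : IsScalarTower F (FractionRing F) (FractionRing K) :=
    FractionRing.isScalarTower_liftAlgebra F (FractionRing K)
  refine isCyclicGalois_of_adjoin_eq_top (k := FractionRing F) (E := FractionRing K) hn
    (hζ.map_of_injective (IsFractionRing.injective F (FractionRing F)))
    (t := algebraMap K (FractionRing K) t) (g := algebraMap F (FractionRing F) g) ?_ ?_ ?_
  · rw [← map_pow, ht, ← IsScalarTower.algebraMap_apply, ← IsScalarTower.algebraMap_apply]
  · rwa [Ne, FaithfulSMul.algebraMap_eq_zero_iff]
  -- It is enough to reach the elements of K, since every element of the fraction field is a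
  -- quotient of two of them.
  · have h1 : ∀ x : K, algebraMap K (FractionRing K) x ∈
        IntermediateField.adjoin (FractionRing F) {algebraMap K (FractionRing K) t} := by
      intro x
      have hx : x ∈ Algebra.adjoin F {t} := htop ▸ Algebra.mem_top
      induction hx using Algebra.adjoin_induction with
      | mem x hx =>
        rw [Set.mem_singleton_iff.1 hx]
        exact IntermediateField.mem_adjoin_simple_self _ _
      | algebraMap r =>
        rw [← IsScalarTower.algebraMap_apply, IsScalarTower.algebraMap_apply F (FractionRing F)]
        exact IntermediateField.algebraMap_mem _ _
      | add x y _ _ hx hy => rw [map_add]; exact add_mem hx hy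
      | mul x y _ _ hx hy => rw [map_mul]; exact mul_mem hx hy
    rw [eq_top_iff]
    intro x _
    obtain ⟨p, q, -, rfl⟩ := IsFractionRing.div_surjective (A := K) x
    exact div_mem (h1 p) (h1 q)

/-! ### Homogeneous units of a semiramified graded division algebra -/

namespace IsSemiramified

open IsGradedDivisionRing IsGradedAlgebraOver

variable {Γ F D : Type*} [AddCommGroup Γ] [DecidableEq Γ] [IsAddTorsionFree Γ]
  [CommRing F] [Ring D] [Algebra F D]
  {ℱ : Γ → AddSubgroup F} {𝒟 : Γ → AddSubgroup D} [GradedRing ℱ] [GradedRing 𝒟]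
  [IsGradedDivisionRing ℱ] [IsGradedDivisionRing 𝒟] [IsGradedAlgebraOver ℱ 𝒟]
  [Algebra.IsCentral F D] [Module.Finite F D] [IsCommDegreeZero 𝒟]

variable (𝒟) in
/-- The units of `D₀` as units of `D`. -/
noncomputable def zeroUnit : (DegreeZero 𝒟)ˣ →* Dˣ := Units.map (DegreeZero.incl 𝒟 : DegreeZero 𝒟 →* D)

variable (F D) in
/-- The units of `F` as units of `D`. -/
def baseUnit : Fˣ →* Dˣ := Units.map (algebraMap F D : F →* D)

theorem coe_zeroUnit (w : (DegreeZero 𝒟)ˣ) : (zeroUnit 𝒟 w : D) = DegreeZero.incl 𝒟 w := rfl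

theorem coe_baseUnit (c : Fˣ) : (baseUnit F D c : D) = algebraMap F D c := rfl

theorem baseUnit_comm (c : Fˣ) (z : Dˣ) : baseUnit F D c * z = z * baseUnit F D c :=
  Units.ext (Algebra.commutes (A := D) (c : F) (z : D))

theorem zeroUnit_mem (w : (DegreeZero 𝒟)ˣ) : (zeroUnit 𝒟 w : D) ∈ 𝒟 0 := DegreeZero.incl_mem 𝒟 w

variable (ℱ 𝒟) in
include ℱ in
theorem baseUnit_mem {γ : Γ} (c : Fˣ) (hc : (c : F) ∈ ℱ γ) : (baseUnit F D c : D) ∈ 𝒟 γ :=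
  algebraMap_mem (ℱ := ℱ) γ _ hc

/-- The group of homogeneous units of `F`. -/
def homogeneousUnits {Γ F : Type*} [AddCommGroup Γ] [DecidableEq Γ] [Ring F]
    (ℱ : Γ → AddSubgroup F) [GradedRing ℱ] : Subgroup Fˣ where
  carrier := {c | ∃ γ, (c : F) ∈ ℱ γ}
  mul_mem' := by
    rintro a b ⟨γ, ha⟩ ⟨δ, hb⟩
    exact ⟨γ + δ, SetLike.GradedMul.mul_mem ha hb⟩
  one_mem' := ⟨0, SetLike.GradedOne.one_mem⟩
  inv_mem' := by
    rintro a ⟨γ, ha⟩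
    exact ⟨-γ, inv_mem ℱ a ha⟩

/-- The degree of z differs from that of some monomial by an element of Γ_F; dividing by the
monomial and by a homogeneous unit of F of that degree leaves a unit of D₀. -/
theorem exists_index_unit (S : HomogeneousFrame ℱ 𝒟) {γ : Γ} (z : Dˣ) (hz : (z : D) ∈ 𝒟 γ) :
    ∃ (m : S.Index) (w : (DegreeZero 𝒟)ˣ), ∃ c ∈ homogeneousUnits ℱ,
      z = zeroUnit 𝒟 w * baseUnit F D c * S.zPow m := by
  have hγ : γ ∈ support 𝒟 := ne_bot_of_unit 𝒟 z hz
  obtain ⟨m, hm⟩ := S.basis.2 ((⟨γ, hγ⟩ : support 𝒟) : SupportQuotient ℱ 𝒟)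
  have hm' : ((∑ i, (m i : ℕ) • S.δ i : support 𝒟) : SupportQuotient ℱ 𝒟)
      = ((⟨γ, hγ⟩ : support 𝒟) : SupportQuotient ℱ 𝒟) := by
    rw [← hm]
    simp [QuotientAddGroup.mk_sum]
  rw [QuotientAddGroup.eq, AddSubgroup.mem_addSubgroupOf] at hm'
  have hm2 : -S.zDeg m + γ ∈ support ℱ := by
    simpa [HomogeneousFrame.zDeg] using hm'
  obtain ⟨c, hc⟩ := exists_unit ℱ hm2
  have hw : ((z * (S.zPow m)⁻¹ * (baseUnit F D c)⁻¹ : Dˣ) : D) ∈ 𝒟 0 :=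
    mem_of_eq_degree (by abel) (SetLike.GradedMul.mul_mem (SetLike.GradedMul.mul_mem hz
      (inv_mem 𝒟 _ (S.zPow_mem m))) (inv_mem 𝒟 _ (baseUnit_mem ℱ 𝒟 c hc)))
  refine ⟨m, unitZero 𝒟 _ hw, c, ⟨_, hc⟩, ?_⟩
  have h1 : zeroUnit 𝒟 (unitZero 𝒟 _ hw) = z * (S.zPow m)⁻¹ * (baseUnit F D c)⁻¹ := Units.ext rfl
  rw [h1]
  simp

variable (hD : IsSemiramified ℱ 𝒟) (S : HomogeneousFrame ℱ 𝒟)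

/-- The monomial in the `z i` that acts on `D₀` as `σ`. -/
noncomputable def autUnit (σ : DegreeZero 𝒟 ≃ₐ[DegreeZero ℱ] DegreeZero 𝒟) : Dˣ :=
  S.zPow (hD.index S σ)

theorem autUnit_mem (σ : DegreeZero 𝒟 ≃ₐ[DegreeZero ℱ] DegreeZero 𝒟) :
    (hD.autUnit S σ : D) ∈ 𝒟 (S.zDeg (hD.index S σ)) := S.zPow_mem _

theorem autUnit_mul_zeroUnit (σ : DegreeZero 𝒟 ≃ₐ[DegreeZero ℱ] DegreeZero 𝒟)
    (w : (DegreeZero 𝒟)ˣ) :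
    hD.autUnit S σ * zeroUnit 𝒟 w
      = zeroUnit 𝒟 (Units.map (σ : DegreeZero 𝒟 →* DegreeZero 𝒟) w) * hD.autUnit S σ := by
  have h := S.zPow_mul_incl (hD.index S σ) w
  rw [action_index] at h
  exact Units.ext h

theorem conjZero_autUnit (σ : DegreeZero 𝒟 ≃ₐ[DegreeZero ℱ] DegreeZero 𝒟) :
    conjZero ℱ 𝒟 (hD.autUnit S σ) (hD.autUnit_mem S σ) = σ :=
  hD.action_index S σ

/-- The factors from D₀ and F act trivially on D₀, so the monomial in the decomposition of z is the
one with the same action. -/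
theorem eq_mul_autUnit {γ : Γ} (z : Dˣ) (hz : (z : D) ∈ 𝒟 γ) :
    ∃ (w : (DegreeZero 𝒟)ˣ), ∃ c ∈ homogeneousUnits ℱ,
      z = zeroUnit 𝒟 w * baseUnit F D c * hD.autUnit S (conjZero ℱ 𝒟 z hz) := by
  obtain ⟨m, w, c, hc, h⟩ := exists_index_unit S z hz
  have h1 : conjZero ℱ 𝒟 z hz = S.action m :=
    conjZero_eq_of_eq_mul ℱ 𝒟 z _ hz (S.zPow_mem m) w c (congrArg Units.val h)
  have h2 : hD.index S (conjZero ℱ 𝒟 z hz) = m := by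
    apply (hD.isGalois_and_action_bijective S).2.1
    rw [action_index, h1]
  exact ⟨w, c, hc, by rw [autUnit, h2]; exact h⟩

include hD S in
/-- Homogeneous units acting in the same way on `D₀` differ by elements of `D₀` and `F`. -/
theorem eq_mul_of_conjZero_eq {γ δ : Γ} (y z : Dˣ) (hy : (y : D) ∈ 𝒟 γ) (hz : (z : D) ∈ 𝒟 δ)
    (h : conjZero ℱ 𝒟 y hy = conjZero ℱ 𝒟 z hz) :
    ∃ (w : (DegreeZero 𝒟)ˣ), ∃ c ∈ homogeneousUnits ℱ,
      y = zeroUnit 𝒟 w * baseUnit F D c * z := by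
  obtain ⟨w, c, hc, h1⟩ := hD.eq_mul_autUnit S y hy
  obtain ⟨w', c', hc', h2⟩ := hD.eq_mul_autUnit S z hz
  rw [h] at h1
  refine ⟨w * w'⁻¹, c * c'⁻¹, mul_mem hc (inv_mem hc'), ?_⟩
  have h3 : hD.autUnit S (conjZero ℱ 𝒟 z hz)
      = (baseUnit F D c')⁻¹ * (zeroUnit 𝒟 w')⁻¹ * z := by
    conv_rhs => rw [h2]
    group
  rw [h1, h3, map_mul, map_mul, map_inv, map_inv]
  have e1 := baseUnit_comm (D := D) c (zeroUnit 𝒟 w')⁻¹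
  have e2 := baseUnit_comm (D := D) c'⁻¹ (zeroUnit 𝒟 w')⁻¹
  rw [map_inv] at e2
  calc zeroUnit 𝒟 w * baseUnit F D c * ((baseUnit F D c')⁻¹ * (zeroUnit 𝒟 w')⁻¹ * z)
      = zeroUnit 𝒟 w * (baseUnit F D c * (zeroUnit 𝒟 w')⁻¹) * (baseUnit F D c')⁻¹ * z := by
        rw [e2]; group
    _ = _ := by rw [e1]; group

theorem autUnit_mul_autUnit (σ τ : DegreeZero 𝒟 ≃ₐ[DegreeZero ℱ] DegreeZero 𝒟) :
    ∃ x ∈ homogeneousUnits ℱ, hD.autUnit S σ * hD.autUnit S τ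
      = zeroUnit 𝒟 ((hD.factorSet S).f σ τ) * baseUnit F D x * hD.autUnit S (σ * τ) := by
  refine ⟨S.carry (hD.index S σ) (hD.index S τ), ⟨_, S.carry_mem _ _⟩, Units.ext ?_⟩
  have h := S.zPow_mul_zPow (hD.index S σ) (hD.index S τ)
  rw [← index_mul] at h
  exact h

/-- The powers of `w z_σ` in `D` and of `w x_σ` in the crossed product have the same components in
`D₀`. -/
theorem exists_pow_eq (σ : DegreeZero 𝒟 ≃ₐ[DegreeZero ℱ] DegreeZero 𝒟) (n : ℕ) :
    ∃ (c : (DegreeZero 𝒟)ˣ), ∃ x ∈ homogeneousUnits ℱ, ∀ w : (DegreeZero 𝒟)ˣ,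
      (zeroUnit 𝒟 w * hD.autUnit S σ) ^ n
        = zeroUnit 𝒟 ((∏ i ∈ Finset.range n,
            Units.map ((σ ^ i : DegreeZero 𝒟 ≃ₐ[DegreeZero ℱ] DegreeZero 𝒟) :
              DegreeZero 𝒟 →* DegreeZero 𝒟) w) * c)
          * baseUnit F D x * hD.autUnit S (σ ^ n) ∧
      CrossedProduct.term (hD.factorSet S) σ (w : DegreeZero 𝒟) ^ n
        = CrossedProduct.term (hD.factorSet S) (σ ^ n)
          (((∏ i ∈ Finset.range n,
            Units.map ((σ ^ i : DegreeZero 𝒟 ≃ₐ[DegreeZero ℱ] DegreeZero 𝒟) :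
              DegreeZero 𝒟 →* DegreeZero 𝒟) w) * c : (DegreeZero 𝒟)ˣ) : DegreeZero 𝒟) := by
  -- The units c and x are chosen before w; the converse direction compares the powers for two
  -- different w.
  induction n with
  | zero =>
    -- Cancelling in z_1 z_1 = f(1, 1) x z_1 gives z_1 = f(1, 1) x. This matches the unit f(1, 1)⁻¹
    -- x_1 of the crossed product, so the cocycle need not be normalised.
    obtain ⟨x, hx, h⟩ := hD.autUnit_mul_autUnit S 1 1
    rw [mul_one] at h
    have h1 := mul_right_cancel h
    refine ⟨((hD.factorSet S).f 1 1)⁻¹, x⁻¹, inv_mem hx, fun w => ⟨?_, ?_⟩⟩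
    · rw [pow_zero, pow_zero, h1, Finset.range_zero, Finset.prod_empty, one_mul, map_inv, map_inv,
        ← baseUnit_comm x (zeroUnit 𝒟 _)]
      group
    · rw [pow_zero, pow_zero, CrossedProduct.one_def, Finset.range_zero, Finset.prod_empty, one_mul]
  | succ n ih =>
    obtain ⟨c, x, hx, h⟩ := ih
    obtain ⟨x', hx', h'⟩ := hD.autUnit_mul_autUnit S (σ ^ n) σ
    refine ⟨c * (hD.factorSet S).f (σ ^ n) σ, x * x', mul_mem hx hx', fun w => ⟨?_, ?_⟩⟩
    · rw [pow_succ, (h w).1, Finset.prod_range_succ]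
      set P := ∏ i ∈ Finset.range n, Units.map ((σ ^ i :
        DegreeZero 𝒟 ≃ₐ[DegreeZero ℱ] DegreeZero 𝒟) : DegreeZero 𝒟 →* DegreeZero 𝒟) w
      set w' := Units.map ((σ ^ n :
        DegreeZero 𝒟 ≃ₐ[DegreeZero ℱ] DegreeZero 𝒟) : DegreeZero 𝒟 →* DegreeZero 𝒟) w
      calc zeroUnit 𝒟 (P * c) * baseUnit F D x * hD.autUnit S (σ ^ n)
            * (zeroUnit 𝒟 w * hD.autUnit S σ)
          = zeroUnit 𝒟 (P * c) * baseUnit F D x * (hD.autUnit S (σ ^ n)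
            * zeroUnit 𝒟 w) * hD.autUnit S σ := by simp only [mul_assoc]
        _ = zeroUnit 𝒟 (P * c) * (baseUnit F D x * zeroUnit 𝒟 w')
            * (hD.autUnit S (σ ^ n) * hD.autUnit S σ) := by
            rw [autUnit_mul_zeroUnit]; simp only [mul_assoc]; rfl
        _ = zeroUnit 𝒟 (P * c) * zeroUnit 𝒟 w' * (baseUnit F D x
            * zeroUnit 𝒟 ((hD.factorSet S).f (σ ^ n) σ)) * baseUnit F D x'
              * hD.autUnit S (σ ^ (n + 1)) := by
            rw [h', baseUnit_comm, pow_succ]; simp only [mul_assoc]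
        _ = zeroUnit 𝒟 (P * c) * zeroUnit 𝒟 w' * zeroUnit 𝒟 ((hD.factorSet S).f (σ ^ n) σ)
            * (baseUnit F D x * baseUnit F D x') * hD.autUnit S (σ ^ (n + 1)) := by
            rw [baseUnit_comm]; simp only [mul_assoc]
        _ = _ := by
            rw [← map_mul, ← map_mul, ← map_mul]
            congr 3
            rw [mul_assoc (P * c), mul_mul_mul_comm]
    · rw [pow_succ, (h w).2, CrossedProduct.term_mul_term, pow_succ]
      congr 1
      have : ((hD.factorSet S).ω (σ ^ n)) (w : DegreeZero 𝒟) = (σ ^ n) (w : DegreeZero 𝒟) := rfl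
      rw [this, Finset.prod_range_succ]
      simp only [Units.val_mul, Units.coe_map]
      change _ * (σ ^ n) (w : DegreeZero 𝒟) * _ = _ * (σ ^ n) (w : DegreeZero 𝒟) * _
      ring

/-- If `σ ^ e = 1`, then `(w z_σ) ^ e` and `(w x_σ) ^ e` are the same element of `D₀`, up to a
homogeneous element of `F`. -/
theorem exists_pow_eq_of_pow_eq_one (σ : DegreeZero 𝒟 ≃ₐ[DegreeZero ℱ] DegreeZero 𝒟) {e : ℕ}
    (he : σ ^ e = 1) :
    ∃ (c : (DegreeZero 𝒟)ˣ), ∃ x ∈ homogeneousUnits ℱ, ∀ w : (DegreeZero 𝒟)ˣ,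
      (zeroUnit 𝒟 w * hD.autUnit S σ) ^ e
        = zeroUnit 𝒟 ((∏ i ∈ Finset.range e,
            Units.map ((σ ^ i : DegreeZero 𝒟 ≃ₐ[DegreeZero ℱ] DegreeZero 𝒟) :
              DegreeZero 𝒟 →* DegreeZero 𝒟) w) * c)
          * baseUnit F D x ∧
      CrossedProduct.term (hD.factorSet S) σ (w : DegreeZero 𝒟) ^ e
        = CrossedProduct.scalar (hD.factorSet S)
          (((∏ i ∈ Finset.range e,
            Units.map ((σ ^ i : DegreeZero 𝒟 ≃ₐ[DegreeZero ℱ] DegreeZero 𝒟) :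
              DegreeZero 𝒟 →* DegreeZero 𝒟) w) * c : (DegreeZero 𝒟)ˣ) : DegreeZero 𝒟) := by
  obtain ⟨c, x, hx, h⟩ := hD.exists_pow_eq S σ e
  obtain ⟨x', hx', h'⟩ := hD.autUnit_mul_autUnit S 1 1
  rw [mul_one] at h'
  have h1 := mul_right_cancel h'
  refine ⟨c * (hD.factorSet S).f 1 1, x * x', mul_mem hx hx', fun w => ⟨?_, ?_⟩⟩
  · rw [(h w).1, he, h1, ← mul_assoc _ c, map_mul (zeroUnit 𝒟) (_ * c), map_mul (baseUnit F D)]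
    rw [mul_assoc (zeroUnit 𝒟 _) (baseUnit F D x), ← mul_assoc (baseUnit F D x), baseUnit_comm]
    simp only [mul_assoc]
  · rw [(h w).2, he]
    change _ = CrossedProduct.term _ 1 _
    congr 1
    rw [← mul_assoc, Units.val_mul _ ((hD.factorSet S).f 1 1), mul_assoc, Units.mul_inv, mul_one]

end IsSemiramified

/-! ### Leading terms -/

/-- A torsion-free abelian group embeds into a linearly ordered one. -/
theorem exists_injective_addMonoidHom_linearOrder.{u} (Γ : Type u) [AddCommGroup Γ]
    [IsAddTorsionFree Γ] : ∃ (κ : Type u) (_ : LinearOrder κ) (φ : Γ →+ Lex (κ →₀ ℚ)),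
      Function.Injective φ := by
  -- The divisible hull is a rational vector space; coordinates in a basis with ordered index set
  -- are compared lexicographically.
  let b := Module.Basis.ofVectorSpace ℚ (DivisibleHull Γ)
  refine ⟨_, IsWellOrder.linearOrder (WellOrderingRel (α :=
    Module.Basis.ofVectorSpaceIndex ℚ (DivisibleHull Γ))),
    { toFun := fun γ => toLex (b.repr (DivisibleHull.coeAddMonoidHom (M := Γ) γ))
      map_zero' := by simp
      map_add' := fun x y => by rw [map_add, map_add]; rfl }, ?_⟩
  intro x y h
  exact DivisibleHull.coe_injective (b.repr.injective (toLex.injective h))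

section Leading

variable {Γ Λ A : Type*} [AddCommGroup Γ] [DecidableEq Γ] [AddCommGroup Λ] [LinearOrder Λ]
  [IsOrderedAddMonoid Λ] [Ring A] (𝒜 : Γ → AddSubgroup A) [GradedRing 𝒜] (φ : Γ →+ Λ)

/-- `p` has degree `γ` with respect to the order on the grading group induced by `φ`. -/
structure HasLeadingDegree (p : A) (γ : Γ) : Prop where
  ne_zero : (DirectSum.decompose 𝒜 p γ : A) ≠ 0
  le : ∀ δ, (DirectSum.decompose 𝒜 p δ : A) ≠ 0 → φ δ ≤ φ γ

variable {𝒜 φ}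

theorem exists_hasLeadingDegree {p : A} (hp : p ≠ 0) : ∃ γ, HasLeadingDegree 𝒜 φ p γ := by
  classical
  have hne : (DirectSum.decompose 𝒜 p).support.Nonempty := by
    rw [Finset.nonempty_iff_ne_empty]
    intro h
    rw [DFinsupp.support_eq_empty] at h
    exact hp (by simpa using congrArg (DirectSum.decompose 𝒜).symm h)
  obtain ⟨γ, hγ, hmax⟩ := Finset.exists_max_image _ φ hne
  refine ⟨γ, by simpa using hγ, fun δ hδ => hmax δ (by simpa using hδ)⟩

theorem HasLeadingDegree.of_mem {a : A} {γ : Γ} (ha : a ∈ 𝒜 γ) (h0 : a ≠ 0) :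
    HasLeadingDegree 𝒜 φ a γ := by
  refine ⟨by rwa [DirectSum.decompose_of_mem_same 𝒜 ha], fun δ hδ => ?_⟩
  by_cases h : γ = δ
  · rw [h]
  · rw [DirectSum.decompose_of_mem_ne 𝒜 ha h] at hδ
    exact absurd rfl hδ

theorem HasLeadingDegree.unique (hφ : Function.Injective φ) {p : A} {γ δ : Γ}
    (h : HasLeadingDegree 𝒜 φ p γ) (h' : HasLeadingDegree 𝒜 φ p δ) : γ = δ :=
  hφ (le_antisymm (h'.le _ h.ne_zero) (h.le _ h'.ne_zero))

variable [NoZeroDivisors A]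

/-- Among the pairs of degrees occurring in p and q, only (γ, δ) reaches the maximal sum, so the
leading component of the product is a single product, nonzero in a domain. -/
theorem HasLeadingDegree.mul (hφ : Function.Injective φ) {p q : A} {γ δ : Γ}
    (hp : HasLeadingDegree 𝒜 φ p γ) (hq : HasLeadingDegree 𝒜 φ q δ) :
    HasLeadingDegree 𝒜 φ (p * q) (γ + δ) ∧ (DirectSum.decompose 𝒜 (p * q) (γ + δ) : A)
      = DirectSum.decompose 𝒜 p γ * DirectSum.decompose 𝒜 q δ := by
  classical
  have hcomp : (DirectSum.decompose 𝒜 (p * q) (γ + δ) : A)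
      = DirectSum.decompose 𝒜 p γ * DirectSum.decompose 𝒜 q δ := by
    rw [DirectSum.decompose_mul, DirectSum.coe_mul_apply, Finset.sum_eq_single_of_mem (γ, δ)]
    · simp only [Finset.mem_filter, Finset.mem_product, DFinsupp.mem_support_toFun]
      refine ⟨⟨fun h => hp.ne_zero (by rw [h]; rfl), fun h => hq.ne_zero (by rw [h]; rfl)⟩, trivial⟩
    · rintro ⟨i, j⟩ hij hne
      simp only [Finset.mem_filter, Finset.mem_product, DFinsupp.mem_support_toFun] at hij
      have h1 := hp.le i (fun h => hij.1.1 (Subtype.ext h))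
      have h2 := hq.le j (fun h => hij.1.2 (Subtype.ext h))
      have h3 : φ i + φ j = φ γ + φ δ := by rw [← map_add, ← map_add, hij.2]
      have h4 : φ i = φ γ := by
        refine le_antisymm h1 (le_of_not_gt fun h => ?_)
        exact absurd h3 (add_lt_add_of_lt_of_le h h2).ne
      have h5 : φ j = φ δ := by rw [h4] at h3; exact add_left_cancel h3
      exact absurd (Prod.ext (hφ h4) (hφ h5)) hne
  refine ⟨⟨by rw [hcomp]; exact mul_ne_zero hp.ne_zero hq.ne_zero, fun ε hε => ?_⟩, hcomp⟩
  by_contra! hlt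
  apply hε
  rw [DirectSum.decompose_mul, DirectSum.coe_mul_apply]
  refine Finset.sum_eq_zero ?_
  rintro ⟨i, j⟩ hij
  simp only [Finset.mem_filter, Finset.mem_product, DFinsupp.mem_support_toFun] at hij
  have h1 := hp.le i (fun h => hij.1.1 (Subtype.ext h))
  have h2 := hq.le j (fun h => hij.1.2 (Subtype.ext h))
  have h3 : φ i + φ j = φ ε := by rw [← map_add, hij.2]
  rw [map_add, ← h3] at hlt
  exact absurd (add_le_add h1 h2) (not_le_of_gt hlt)

theorem HasLeadingDegree.pow [Nontrivial A] (hφ : Function.Injective φ) {p : A} {γ : Γ}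
    (hp : HasLeadingDegree 𝒜 φ p γ) (n : ℕ) :
    HasLeadingDegree 𝒜 φ (p ^ n) (n • γ) ∧ (DirectSum.decompose 𝒜 (p ^ n) (n • γ) : A)
      = (DirectSum.decompose 𝒜 p γ : A) ^ n := by
  induction n with
  | zero =>
    rw [pow_zero, zero_smul, pow_zero]
    exact ⟨.of_mem SetLike.GradedOne.one_mem one_ne_zero,
      DirectSum.decompose_of_mem_same 𝒜 SetLike.GradedOne.one_mem⟩
  | succ n ih =>
    rw [pow_succ, succ_nsmul, pow_succ, ← ih.2]
    exact ih.1.mul hφ hp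

/-- A relation `v q ^ e = p ^ e` with `v` of degree `0` holds for leading terms of `p` and `q`. -/
theorem exists_homogeneous_pow_eq [IsAddTorsionFree Γ] [Nontrivial A] {p q v : A} {e : ℕ}
    (he : e ≠ 0) (hq : q ≠ 0) (hv : v ∈ 𝒜 0) (hv0 : v ≠ 0) (h : v * q ^ e = p ^ e) :
    ∃ γ, (DirectSum.decompose 𝒜 q γ : A) ≠ 0 ∧
      v * (DirectSum.decompose 𝒜 q γ : A) ^ e = (DirectSum.decompose 𝒜 p γ : A) ^ e := by
  obtain ⟨κ, _, φ, hφ⟩ := exists_injective_addMonoidHom_linearOrder Γ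
  have hp : p ≠ 0 := by
    rintro rfl
    rw [zero_pow he] at h
    exact mul_ne_zero hv0 (pow_ne_zero e hq) h
  obtain ⟨γ, hγ⟩ := exists_hasLeadingDegree (𝒜 := 𝒜) (φ := φ) hp
  obtain ⟨δ, hδ⟩ := exists_hasLeadingDegree (𝒜 := 𝒜) (φ := φ) hq
  have h1 := (HasLeadingDegree.of_mem (φ := φ) hv hv0).mul hφ (hδ.pow hφ e).1
  have h2 := hγ.pow hφ e
  rw [zero_add, (hδ.pow hφ e).2, DirectSum.decompose_of_mem_same 𝒜 hv, h] at h1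
  -- As v has degree 0, both sides have the same leading degree; torsion-freeness then gives the
  -- same leading degree for p and q.
  have h3 : e • δ = e • γ := h1.1.unique hφ h2.1
  have h4 : δ = γ := nsmul_right_injective he h3
  subst h4
  exact ⟨δ, hδ.ne_zero, by rw [← h1.2, h2.2]⟩

end Leading

/-! ### Graded subfields -/

section Homogeneous

variable {Γ F D : Type*} [AddCommGroup Γ] [DecidableEq Γ] [CommRing F] [Ring D] [Algebra F D]

/-- A subalgebra generated by homogeneous elements is homogeneous. -/
theorem decompose_mem_adjoin (ℱ : Γ → AddSubgroup F) (𝒟 : Γ → AddSubgroup D) [GradedRing ℱ]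
    [GradedRing 𝒟] [IsGradedAlgebraOver ℱ 𝒟] {s : Set D} (hs : ∀ a ∈ s, ∃ γ, a ∈ 𝒟 γ) :
    ∀ a ∈ Algebra.adjoin F s, ∀ γ, (DirectSum.decompose 𝒟 a γ : D) ∈ Algebra.adjoin F s := by
  classical
  intro a ha
  induction ha using Algebra.adjoin_induction with
  | mem x hx =>
    intro γ
    obtain ⟨δ, hδ⟩ := hs x hx
    by_cases h : δ = γ
    · subst h
      rw [DirectSum.decompose_of_mem_same 𝒟 hδ]
      exact Algebra.subset_adjoin hx
    · rw [DirectSum.decompose_of_mem_ne 𝒟 hδ h]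
      exact zero_mem _
  | algebraMap r =>
    intro γ
    rw [IsGradedAlgebraOver.decompose_algebraMap ℱ 𝒟]
    exact Subalgebra.algebraMap_mem _ _
  | add x y _ _ hx hy =>
    intro γ
    rw [DirectSum.decompose_add]
    exact add_mem (hx γ) (hy γ)
  | mul x y _ _ hx hy =>
    intro γ
    rw [DirectSum.decompose_mul, DirectSum.coe_mul_apply]
    exact sum_mem fun ij _ => mul_mem (hx _) (hy _)

end Homogeneous

namespace IsSemiramified

open IsGradedDivisionRing IsGradedAlgebraOver

variable {Γ F D : Type*} [AddCommGroup Γ] [DecidableEq Γ] [IsAddTorsionFree Γ]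
  [CommRing F] [Ring D] [Algebra F D]
  {ℱ : Γ → AddSubgroup F} {𝒟 : Γ → AddSubgroup D} [GradedRing ℱ] [GradedRing 𝒟]
  [IsGradedDivisionRing ℱ] [IsGradedDivisionRing 𝒟] [IsGradedAlgebraOver ℱ 𝒟]
  [Algebra.IsCentral F D] [Module.Finite F D] [IsCommDegreeZero 𝒟]

/-- The component of degree `0` of a subalgebra, as an intermediate field of `D₀ / F₀`. -/
noncomputable def zeroField (hD : IsSemiramified ℱ 𝒟) (K : Subalgebra F D) :
    IntermediateField (DegreeZero ℱ) (DegreeZero 𝒟) :=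
  have := hD.finiteDimensional
  let K₀ : Subalgebra (DegreeZero ℱ) (DegreeZero 𝒟) :=
    { carrier := {a | DegreeZero.incl 𝒟 a ∈ K}
      mul_mem' := fun {a b} ha hb => by
        rw [Set.mem_ofPred_eq, map_mul]; exact mul_mem ha hb
      add_mem' := fun {a b} ha hb => by
        rw [Set.mem_ofPred_eq, map_add]; exact add_mem ha hb
      algebraMap_mem' := fun c => by
        rw [Set.mem_ofPred_eq, incl_algebraMap]; exact K.algebraMap_mem _ }
  K₀.toIntermediateField fun a ha =>
    K₀.inv_mem_of_algebraic (x := ⟨a, ha⟩) (Algebra.IsAlgebraic.isAlgebraic a)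

theorem mem_zeroField (hD : IsSemiramified ℱ 𝒟) (K : Subalgebra F D) (a : DegreeZero 𝒟) :
    a ∈ hD.zeroField K ↔ DegreeZero.incl 𝒟 a ∈ K := Iff.rfl

/-- The exponent is the order of the finite group Γ_D / Γ_F. -/
theorem exists_nsmul_mem_support (hD : IsSemiramified ℱ 𝒟) :
    ∃ n : ℕ, n ≠ 0 ∧ ∀ γ, γ ∈ support 𝒟 → n • γ ∈ support ℱ := by
  have h0 : Nat.card (SupportQuotient ℱ 𝒟) ≠ 0 := by
    rw [hD.card_eq]; exact (gradedDegree_pos ℱ 𝒟).ne'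
  refine ⟨Nat.card (SupportQuotient ℱ 𝒟), h0, fun γ hγ => ?_⟩
  have h : Nat.card (SupportQuotient ℱ 𝒟) • ((⟨γ, hγ⟩ : support 𝒟) : SupportQuotient ℱ 𝒟) = 0 :=
    card_nsmul_eq_zero'
  rw [← QuotientAddGroup.mk_nsmul, QuotientAddGroup.eq_zero_iff,
    AddSubgroup.mem_addSubgroupOf] at h
  exact h

/-- A homogeneous commutative subalgebra is a graded subfield. -/
theorem isGradedSubfield (hD : IsSemiramified ℱ 𝒟) {K : Subalgebra F D}
    (hom : ∀ a ∈ K, ∀ γ, (DirectSum.decompose 𝒟 a γ : D) ∈ K)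
    (comm : ∀ a ∈ K, ∀ b ∈ K, a * b = b * a) : IsGradedSubfield 𝒟 K := by
  refine ⟨hom, comm, fun γ a ha haγ ha0 => ?_⟩
  obtain ⟨z, rfl⟩ := isUnit_of_mem (𝒜 := 𝒟) γ a haγ ha0
  obtain ⟨n, hn0, hn⟩ := hD.exists_nsmul_mem_support
  obtain ⟨c, hc⟩ := exists_unit ℱ (hn γ (ne_bot_of_unit 𝒟 z haγ))
  -- A power of z divided by a unit of F lies in the degree 0 part of K. That part is a field, being
  -- algebraic over F₀, so the inverse of this quotient is in K and yields the inverse of z.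
  have hb : ((z ^ n * (baseUnit F D c)⁻¹ : Dˣ) : D) ∈ 𝒟 0 := by
    refine mem_of_eq_degree (add_neg_cancel (n • γ)) (SetLike.GradedMul.mul_mem ?_
      (inv_mem 𝒟 _ (baseUnit_mem ℱ 𝒟 c hc)))
    rw [Units.val_pow_eq_pow_val]
    exact SetLike.pow_mem_graded n haγ
  have hcK : (((baseUnit F D c)⁻¹ : Dˣ) : D) ∈ K := by
    rw [← map_inv]; exact K.algebraMap_mem _
  have hbK : unitZero 𝒟 _ hb ∈ (hD.zeroField K).toSubmonoid.comap (Units.coeHom _) := by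
    change ((z ^ n * (baseUnit F D c)⁻¹ : Dˣ) : D) ∈ K
    rw [Units.val_mul, Units.val_pow_eq_pow_val]
    exact mul_mem (pow_mem ha n) hcK
  have hbinv : DegreeZero.incl 𝒟 ((unitZero 𝒟 _ hb : DegreeZero 𝒟)⁻¹) ∈ K :=
    (hD.zeroField K).inv_mem hbK
  have hinv : DegreeZero.incl 𝒟 ((unitZero 𝒟 _ hb : DegreeZero 𝒟)⁻¹)
      = (((z ^ n * (baseUnit F D c)⁻¹)⁻¹ : Dˣ) : D) := by
    rw [← Units.val_inv_eq_inv_val]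
    rfl
  refine ⟨((z⁻¹ : Dˣ) : D), ?_, Units.mul_inv z⟩
  obtain ⟨m, rfl⟩ := Nat.exists_eq_succ_of_ne_zero hn0
  have hz : z⁻¹ = z ^ m * (baseUnit F D c)⁻¹ * (z ^ (m + 1) * (baseUnit F D c)⁻¹)⁻¹ := by
    rw [mul_inv_rev, inv_inv, pow_succ]; group
  rw [hz, Units.val_mul, Units.val_mul, ← hinv, Units.val_pow_eq_pow_val]
  exact mul_mem (mul_mem (pow_mem ha m) hcK) hbinv

theorem subset_of_decompose_mem {A : Type*} [Ring A] (𝒜 : Γ → AddSubgroup A) [GradedRing 𝒜] {K : Set A}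
    {B : AddSubgroup A} (hK : ∀ a ∈ K, ∀ γ, (DirectSum.decompose 𝒜 a γ : A) ∈ B) :
    K ⊆ B := by
  classical
  intro a ha
  rw [← DirectSum.sum_support_decompose 𝒜 a]
  exact sum_mem fun γ _ => hK a ha γ

/-- A maximal graded subfield contains the homogeneous elements commuting with it. -/
theorem mem_of_commute (hD : IsSemiramified ℱ 𝒟) {K : Subalgebra F D}
    (hK : Maximal (IsGradedSubfield 𝒟) K) {c : D} {γ : Γ} (hc : c ∈ 𝒟 γ)
    (hcomm : ∀ δ, ∀ a ∈ K, a ∈ 𝒟 δ → c * a = a * c) : c ∈ K := by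
  -- The homogeneous elements of K together with c commute pairwise and generate a graded subfield
  -- containing K; maximality puts c in K.
  set s : Set D := {a | a ∈ K ∧ ∃ δ, a ∈ 𝒟 δ} ∪ {c} with hs
  have hKs : K ≤ Algebra.adjoin F s := by
    refine subset_of_decompose_mem 𝒟 (K := (K : Set D)) (B := (Algebra.adjoin F s).toSubring.toAddSubgroup)
      fun a ha δ => Algebra.subset_adjoin (Or.inl ⟨hK.prop.homogeneous a ha δ, δ, SetLike.coe_mem _⟩)
  have hss : ∀ a ∈ s, ∀ b ∈ s, Commute a b := by
    rintro a (⟨haK, δ, ha⟩ | rfl) b (⟨hbK, ε, hb⟩ | rfl)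
    · exact hK.prop.comm a haK b hbK
    · exact (hcomm δ a haK ha).symm
    · exact hcomm ε b hbK hb
    · exact Commute.refl _
  have hfield : IsGradedSubfield 𝒟 (Algebra.adjoin F s) := by
    refine hD.isGradedSubfield (decompose_mem_adjoin ℱ 𝒟 ?_) ?_
    · rintro a (⟨-, δ, ha⟩ | rfl)
      · exact ⟨δ, ha⟩
      · exact ⟨γ, hc⟩
    · intro a ha b hb
      have h1 : ∀ x ∈ s, Commute x b := fun x hx =>
        Algebra.commute_of_mem_adjoin_of_forall_mem_commute hb fun y hy => hss x hx y hy
      exact (Algebra.commute_of_mem_adjoin_of_forall_mem_commute ha fun x hx => (h1 x hx).symm).symm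
  exact hK.le_of_ge hfield hKs (Algebra.subset_adjoin (Or.inr rfl))

end IsSemiramified

/-! ### Automorphisms of the fraction field of a graded subfield -/

/-- An automorphism `Φ` of the fraction field `E` of `K` whose fixed field is the fraction field of
`F`. -/
structure FractionAut {F D : Type*} [CommRing F] [Ring D] [Algebra F D] (K : Subalgebra F D)
    (E : Type*) [Field E] where
  ε : K →+* E
  Φ : E ≃+* E
  injective : Function.Injective ε
  exists_div : ∀ z, ∃ p q : K, q ≠ 0 ∧ z * ε q = ε p
  map_base : ∀ f : F, Φ (ε (algebraMap F K f)) = ε (algebraMap F K f)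
  exists_base : ∀ z, Φ z = z → ∃ f g : F, g ≠ 0 ∧
    z * ε (algebraMap F K g) = ε (algebraMap F K f)

/-- The automorphism is a generator of the cyclic Galois group, so the elements it fixes are fixed
by the whole group. -/
theorem IsGradedSubfield.IsCyclicExtension.exists_fractionAut.{u} {Γ F : Type*} {D : Type u}
    [AddCommGroup Γ] [DecidableEq Γ] [IsAddTorsionFree Γ] [CommRing F] [Ring D] [Algebra F D]
    {ℱ : Γ → AddSubgroup F} {𝒟 : Γ → AddSubgroup D} [GradedRing ℱ] [GradedRing 𝒟]
    [IsGradedDivisionRing ℱ] [IsGradedDivisionRing 𝒟] [IsGradedAlgebraOver ℱ 𝒟]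
    {K : Subalgebra F D} {hK : IsGradedSubfield 𝒟 K} (h : hK.IsCyclicExtension ℱ) :
    ∃ (E : Type u) (_ : Field E), Nonempty (FractionAut K E) := by
  let _ : CommRing K := hK.commRing
  let _ : Algebra F K := K.algebra
  have : IsDomain F := IsGradedDivisionRing.isDomain ℱ
  have : Nontrivial D := IsGradedDivisionRing.nontrivial (𝒜 := 𝒟)
  have : NoZeroDivisors D := IsGradedDivisionRing.noZeroDivisors 𝒟
  have : NoZeroDivisors K := inferInstance
  have : IsDomain K := NoZeroDivisors.to_isDomain K
  have : FaithfulSMul F D := IsGradedAlgebraOver.faithfulSMul ℱ 𝒟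
  have : FaithfulSMul F K := inferInstance
  let _ : Algebra (FractionRing F) (FractionRing K) := FractionRing.liftAlgebra F (FractionRing K)
  have hst : IsScalarTower F (FractionRing F) (FractionRing K) :=
    FractionRing.isScalarTower_liftAlgebra F (FractionRing K)
  obtain ⟨hgal, hcyc⟩ : IsCyclicGalois (FractionRing F) (FractionRing K) := h
  obtain ⟨τ, hτ⟩ := IsCyclic.exists_generator (α := FractionRing K ≃ₐ[FractionRing F] FractionRing K)
  have hbase : ∀ f : F, algebraMap K (FractionRing K) (algebraMap F K f)
      = algebraMap (FractionRing F) (FractionRing K) (algebraMap F (FractionRing F) f) := by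
    intro f
    rw [← IsScalarTower.algebraMap_apply, ← IsScalarTower.algebraMap_apply]
  refine ⟨FractionRing K, inferInstance, ⟨
    { ε := algebraMap K (FractionRing K)
      Φ := τ.toRingEquiv
      injective := IsFractionRing.injective K (FractionRing K)
      exists_div := fun z => ?_
      map_base := fun f => ?_
      exists_base := fun z hz => ?_ }⟩⟩
  · obtain ⟨p, q, hq, rfl⟩ := IsFractionRing.div_surjective (A := K) z
    have hq0 : q ≠ 0 := nonZeroDivisors.ne_zero hq
    refine ⟨p, q, hq0, div_mul_cancel₀ _ ?_⟩
    rwa [Ne, FaithfulSMul.algebraMap_eq_zero_iff]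
  · change τ _ = _
    rw [hbase, AlgEquiv.commutes]
  · have hz' : τ z = z := hz
    have h1 : z ∈ (⊥ : IntermediateField (FractionRing F) (FractionRing K)) := by
      rw [InfiniteGalois.mem_bot_iff_fixed]
      intro f
      have h2 : z ∈ IntermediateField.fixedField (Subgroup.zpowers τ) :=
        mem_fixedField_zpowers.2 hz'
      exact (IntermediateField.mem_fixedField_iff _ _).1 h2 f (hτ f)
    obtain ⟨w, rfl⟩ := IntermediateField.mem_bot.1 h1
    obtain ⟨f, g, hg, rfl⟩ := IsFractionRing.div_surjective (A := F) w
    have hg0 : algebraMap F (FractionRing F) g ≠ 0 := by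
      rw [Ne, FaithfulSMul.algebraMap_eq_zero_iff]
      exact nonZeroDivisors.ne_zero hg
    refine ⟨f, g, nonZeroDivisors.ne_zero hg, ?_⟩
    change _ * algebraMap K (FractionRing K) (algebraMap F K g)
      = algebraMap K (FractionRing K) (algebraMap F K f)
    rw [hbase, hbase, ← map_mul, div_mul_cancel₀ _ hg0]

/-! ### Degree 0 parts of graded subfields and powers of homogeneous elements. -/

namespace IsSemiramified

open IsGradedDivisionRing IsGradedAlgebraOver

variable {Γ F D : Type*} [AddCommGroup Γ] [DecidableEq Γ] [IsAddTorsionFree Γ]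
  [CommRing F] [Ring D] [Algebra F D]
  {ℱ : Γ → AddSubgroup F} {𝒟 : Γ → AddSubgroup D} [GradedRing ℱ] [GradedRing 𝒟]
  [IsGradedDivisionRing ℱ] [IsGradedDivisionRing 𝒟] [IsGradedAlgebraOver ℱ 𝒟]
  [Algebra.IsCentral F D] [Module.Finite F D] [IsCommDegreeZero 𝒟]

/-- The Galois group is the image of the symmetric law on multi-indices. Commutativity makes every
intermediate field, in particular K₀, normal over F₀. -/
theorem isAbelianGalois (hD : IsSemiramified ℱ 𝒟) (S : HomogeneousFrame ℱ 𝒟) :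
    IsAbelianGalois (DegreeZero ℱ) (DegreeZero 𝒟) := by
  have h := hD.isGalois_and_action_bijective S
  have := h.1
  refine { toIsGalois := h.1, toIsMulCommutative := ⟨⟨fun σ τ => ?_⟩⟩ }
  obtain ⟨m, rfl⟩ := h.2.2 σ
  obtain ⟨n, rfl⟩ := h.2.2 τ
  rw [S.action_mul, S.action_mul]
  congr 1
  funext i
  simp [HomogeneousFrame.addIndex, add_comm]

/-- The inclusion of `K₀` in `K`. -/
noncomputable def zeroFieldIncl (hD : IsSemiramified ℱ 𝒟) (K : Subalgebra F D) :
    hD.zeroField K →+* K where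
  toFun a := ⟨DegreeZero.incl 𝒟 a, a.2⟩
  map_one' := Subtype.ext (map_one (DegreeZero.incl 𝒟))
  map_mul' _ _ := Subtype.ext (map_mul (DegreeZero.incl 𝒟) _ _)
  map_zero' := Subtype.ext (map_zero (DegreeZero.incl 𝒟))
  map_add' _ _ := Subtype.ext (map_add (DegreeZero.incl 𝒟) _ _)

theorem exists_zeroFieldIncl_eq (hD : IsSemiramified ℱ 𝒟) {K : Subalgebra F D} (a : K)
    (ha : (a : D) ∈ 𝒟 0) : ∃ b, hD.zeroFieldIncl K b = a :=
  ⟨⟨DegreeZero.ofMem 𝒟 a ha, a.2⟩, rfl⟩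

theorem zeroFieldIncl_algebraMap (hD : IsSemiramified ℱ 𝒟) (K : Subalgebra F D)
    (c : DegreeZero ℱ) : hD.zeroFieldIncl K (algebraMap _ _ c)
      = algebraMap F K (DegreeZero.incl ℱ c) := rfl

theorem pow_mem_graded {γ : Γ} (y : Dˣ) (hy : (y : D) ∈ 𝒟 γ) (n : ℕ) :
    ((y ^ n : Dˣ) : D) ∈ 𝒟 (n • γ) := by
  rw [Units.val_pow_eq_pow_val]; exact SetLike.pow_mem_graded n hy

theorem conjZero_pow {γ : Γ} (y : Dˣ) (hy : (y : D) ∈ 𝒟 γ) (n : ℕ) :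
    conjZero ℱ 𝒟 (y ^ n) (pow_mem_graded y hy n) = conjZero ℱ 𝒟 y hy ^ n := by
  induction n with
  | zero =>
    ext a
    apply DegreeZero.incl_injective 𝒟
    simp [incl_conjZero]
  | succ n ih =>
    rw [pow_succ (conjZero ℱ 𝒟 y hy), ← ih]
    ext a
    apply DegreeZero.incl_injective 𝒟
    simp [incl_conjZero, pow_succ, mul_assoc]

/-- The relative degree of `D₀` over `K₀` annihilates the degrees of `K` modulo those of `F`. -/
theorem pow_finrank_eq (hD : IsSemiramified ℱ 𝒟) (S : HomogeneousFrame ℱ 𝒟) {K : Subalgebra F D}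
    (hK : IsGradedSubfield 𝒟 K) {γ : Γ} (y : Dˣ) (hyK : (y : D) ∈ K) (hy : (y : D) ∈ 𝒟 γ) :
    ∃ v : hD.zeroField K, v ≠ 0 ∧ ∃ x ∈ homogeneousUnits ℱ,
      (y : D) ^ Module.finrank (hD.zeroField K) (DegreeZero 𝒟)
        = hD.zeroFieldIncl K v * algebraMap F D x := by
  have hfin := hD.finiteDimensional
  have hgal := (hD.isGalois_and_action_bijective S).1
  set M := hD.zeroField K
  set e := Module.finrank M (DegreeZero 𝒟)
  -- Since y commutes with K₀, it acts on D₀ through Gal(D₀ / K₀), a group of order e; its e-th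
  -- power acts trivially and so lies in D₀ times F.
  have hfix : conjZero ℱ 𝒟 y hy ∈ M.fixingSubgroup := by
    rw [IntermediateField.mem_fixingSubgroup_iff]
    intro a ha
    apply DegreeZero.incl_injective 𝒟
    rw [incl_conjZero, hK.comm _ hyK _ ha, mul_assoc, Units.mul_inv, mul_one]
  have hone : conjZero ℱ 𝒟 y hy ^ e = 1 := by
    have h1 := pow_card_eq_one' (x := (⟨_, hfix⟩ : M.fixingSubgroup))
    rw [IsGalois.card_fixingSubgroup_eq_finrank] at h1
    exact congrArg Subtype.val h1
  have hone' : conjZero ℱ 𝒟 (1 : Dˣ) (γ := 0) SetLike.GradedOne.one_mem = 1 := by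
    ext a
    apply DegreeZero.incl_injective 𝒟
    simp [incl_conjZero]
  obtain ⟨w, x, hx, h⟩ := hD.eq_mul_of_conjZero_eq S (y ^ e) 1 (pow_mem_graded y hy e) SetLike.GradedOne.one_mem
    (by rw [conjZero_pow y hy, hone, hone'])
  rw [mul_one] at h
  have hw : zeroUnit 𝒟 w = y ^ e * baseUnit F D x⁻¹ := by
    rw [h, map_inv, mul_inv_cancel_right]
  have hwK : DegreeZero.incl 𝒟 w ∈ K := by
    rw [← coe_zeroUnit, hw, Units.val_mul, Units.val_pow_eq_pow_val]
    exact mul_mem (pow_mem hyK e) (K.algebraMap_mem _)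
  refine ⟨⟨w, hwK⟩, fun h0 => w.ne_zero (congrArg Subtype.val h0), x, hx, ?_⟩
  rw [← Units.val_pow_eq_pow_val, h]
  rfl

end IsSemiramified

/-! ### Eigenvectors of an automorphism with cyclic fixed field -/

/-- A normal extension embedded in E is stable under every automorphism of E fixing its base field.
-/
theorem exists_algEquiv_of_normal {k M E : Type*} [Field k] [Field M] [Field E] [Algebra k M]
    [Normal k M] (i : M →+* E) (Φ : E ≃+* E)
    (h : ∀ c : k, Φ (i (algebraMap k M c)) = i (algebraMap k M c)) :
    ∃ φ : M ≃ₐ[k] M, ∀ a, Φ (i a) = i (φ a) := by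
  let _ : Algebra M E := i.toAlgebra
  let _ : Algebra k E := (i.comp (algebraMap k M)).toAlgebra
  have : IsScalarTower k M E := IsScalarTower.of_algebraMap_eq fun _ => rfl
  let Ψ : E ≃ₐ[k] E := AlgEquiv.ofRingEquiv (f := Φ) h
  exact ⟨Ψ.restrictNormal M, fun a => (Ψ.restrictNormal_commutes M a).symm⟩

/-- Decomposition into eigenvectors under an automorphism of finite order. -/
theorem exists_sum_eigenvectors {E : Type*} [Field E] (Φ : E ≃+* E) {ζ : E} {n : ℕ} (hn : 0 < n)
    (hζ : IsPrimitiveRoot ζ n) (hΦ : Φ ζ = ζ) (B : AddSubgroup E)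
    (hBζ : ∀ b ∈ B, ζ⁻¹ * b ∈ B) (hBn : ∀ b ∈ B, (n : E)⁻¹ * b ∈ B) (hBΦ : ∀ b ∈ B, Φ b ∈ B)
    {z : E} (hz : z ∈ B) (hzn : Φ^[n] z = z) :
    ∃ s : ℕ → E, (∀ i, s i ∈ B ∧ Φ (s i) = ζ ^ i * s i) ∧ z = ∑ i ∈ Finset.range n, s i := by
  have : NeZero n := ⟨hn.ne'⟩
  have hn0 : (n : E) ≠ 0 := hζ.neZero'.ne
  have hζ0 : ζ ≠ 0 := hζ.ne_zero hn.ne'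
  have hmem : ∀ j, Φ^[j] z ∈ B := fun j => by
    induction j with
    | zero => exact hz
    | succ j ih => rw [Function.iterate_succ_apply']; exact hBΦ _ ih
  have hpow : ∀ m : ℕ, ∀ b ∈ B, ζ⁻¹ ^ m * b ∈ B := fun m => by
    induction m with
    | zero => intro b hb; simpa using hb
    | succ m ih => intro b hb; rw [pow_succ, mul_assoc]; exact ih _ (hBζ b hb)
  -- The projections onto the eigenspaces, as discrete Fourier sums over the orbit of z. Only the
  -- orbit of z needs to be periodic.
  refine ⟨fun i => (n : E)⁻¹ * ∑ j ∈ Finset.range n, ζ⁻¹ ^ (i * j) * Φ^[j] z, fun i => ⟨?_, ?_⟩, ?_⟩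
  · exact hBn _ (sum_mem fun j _ => hpow _ _ (hmem j))
  · have hshift : ∑ j ∈ Finset.range n, ζ⁻¹ ^ (i * (j + 1)) * Φ^[j + 1] z
        = ∑ j ∈ Finset.range n, ζ⁻¹ ^ (i * j) * Φ^[j] z := by
      have h1 := Finset.sum_range_succ (fun j => ζ⁻¹ ^ (i * j) * Φ^[j] z) n
      rw [Finset.sum_range_succ' , hzn] at h1
      have h2 : ζ⁻¹ ^ (i * n) = 1 := by rw [mul_comm, pow_mul, inv_pow, hζ.pow_eq_one]; simp
      rw [h2] at h1
      simpa using h1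
    beta_reduce
    rw [map_mul, map_inv₀, map_natCast, map_sum, mul_left_comm, ← hshift]
    congr 1
    rw [Finset.mul_sum]
    refine Finset.sum_congr rfl fun j _ => ?_
    rw [map_mul, map_pow, map_inv₀, hΦ, Function.iterate_succ_apply', ← mul_assoc]
    congr 1
    rw [mul_add, pow_add, mul_one, mul_left_comm, ← mul_pow, mul_inv_cancel₀ hζ0, one_pow, mul_one]
  · rw [← Finset.mul_sum, Finset.sum_comm, eq_inv_mul_iff_mul_eq₀ hn0]
    rw [Finset.sum_eq_single_of_mem 0 (Finset.mem_range.2 hn)]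
    · simp
    · intro j hj hj0
      have h1 : ∑ i ∈ Finset.range n, ζ⁻¹ ^ (i * j) = 0 := by
        have h2 : ζ⁻¹ ^ j ≠ 1 := by
          rw [inv_pow, Ne, inv_eq_one]
          exact hζ.pow_ne_one_of_pos_of_lt hj0 (Finset.mem_range.1 hj)
        have h3 : (∑ i ∈ Finset.range n, (ζ⁻¹ ^ j) ^ i) * (ζ⁻¹ ^ j - 1) = 0 := by
          rw [geom_sum_mul, ← pow_mul, mul_comm, pow_mul, inv_pow, hζ.pow_eq_one]; simp
        have h4 := (mul_eq_zero.1 h3).resolve_right (sub_ne_zero.2 h2)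
        rw [← h4]
        exact Finset.sum_congr rfl fun i _ => by rw [← pow_mul, mul_comm]
      rw [← Finset.sum_mul, h1, zero_mul]

/-! ### Action of the automorphism on homogeneous elements of a graded subfield. -/

namespace IsSemiramified

open IsGradedDivisionRing IsGradedAlgebraOver

variable {Γ F D : Type*} [AddCommGroup Γ] [DecidableEq Γ] [IsAddTorsionFree Γ]
  [CommRing F] [Ring D] [Algebra F D]
  {ℱ : Γ → AddSubgroup F} {𝒟 : Γ → AddSubgroup D} [GradedRing ℱ] [GradedRing 𝒟]
  [IsGradedDivisionRing ℱ] [IsGradedDivisionRing 𝒟] [IsGradedAlgebraOver ℱ 𝒟]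
  [Algebra.IsCentral F D] [Module.Finite F D] [IsCommDegreeZero 𝒟]

theorem finrank_mul_finrank_zeroField (hD : IsSemiramified ℱ 𝒟)
    (M : IntermediateField (DegreeZero ℱ) (DegreeZero 𝒟)) :
    Module.finrank (DegreeZero ℱ) M * Module.finrank M (DegreeZero 𝒟) = gradedDegree F D := by
  rw [Module.finrank_mul_finrank, hD.finrank_eq]

section

variable (hD : IsSemiramified ℱ 𝒟) (S : HomogeneousFrame ℱ 𝒟) {K : Subalgebra F D}
  (hK : IsGradedSubfield 𝒟 K) {E : Type*} [Field E] (P : FractionAut K E)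

include hD S in
theorem exists_fractionAut_zeroField :
    ∃ φ : hD.zeroField K ≃ₐ[DegreeZero ℱ] hD.zeroField K,
      ∀ a, P.Φ (P.ε (hD.zeroFieldIncl K a)) = P.ε (hD.zeroFieldIncl K (φ a)) := by
  have := hD.isAbelianGalois S
  have := hD.finiteDimensional
  exact exists_algEquiv_of_normal (P.ε.comp (hD.zeroFieldIncl K)) P.Φ fun c => by
    rw [RingHom.comp_apply, zeroFieldIncl_algebraMap, P.map_base]

-- The quotient β = Φ(y) / y has its e-th power in K₀, because y ^ e lies in K₀ times F. Write β = p
-- / q with p, q in K: leading terms produce c in K₀ with the same e-th power, so β is c times a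
-- root of unity of F₀, and multiplying y by it keeps the degree.
include hD S hK in
theorem exists_fractionAut_eq {ζ : DegreeZero ℱ} (hζ : IsPrimitiveRoot ζ (gradedDegree F D))
    {γ : Γ} (y : K) (hy : (y : D) ∈ 𝒟 γ) :
    ∃ y' : K, (y' : D) ∈ 𝒟 γ ∧ P.Φ (P.ε y) = P.ε y' := by
  have hD0 : Nontrivial D := IsGradedDivisionRing.nontrivial (𝒜 := 𝒟)
  have : NoZeroDivisors D := IsGradedDivisionRing.noZeroDivisors 𝒟
  have hfin := hD.finiteDimensional
  have hn := gradedDegree_pos ℱ 𝒟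
  by_cases hy0 : y = 0
  · exact ⟨0, zero_mem _, by rw [hy0, map_zero, map_zero]⟩
  have hεy : P.ε y ≠ 0 := (map_ne_zero_iff _ P.injective).2 hy0
  obtain ⟨yu, hyu⟩ := isUnit_of_mem (𝒜 := 𝒟) γ (y : D) hy fun h => hy0 (Subtype.ext h)
  obtain ⟨φ, hφ⟩ := hD.exists_fractionAut_zeroField S P
  obtain ⟨v, hv0, x, hx, hyv⟩ := hD.pow_finrank_eq S hK yu (hyu ▸ y.2) (hyu ▸ hy)
  set e := Module.finrank (hD.zeroField K) (DegreeZero 𝒟) with he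
  have he0 : e ≠ 0 := Module.finrank_pos.ne'
  have hyv' : y ^ e = hD.zeroFieldIncl K v * algebraMap F K x := by
    apply Subtype.ext
    rw [Subalgebra.coe_pow, ← hyu, hyv]
    rfl
  set i : hD.zeroField K →+* E := P.ε.comp (hD.zeroFieldIncl K) with hi
  obtain ⟨p, q, hq, hpq⟩ := P.exists_div (P.Φ (P.ε y) / P.ε y)
  have hβ : (P.Φ (P.ε y) / P.ε y) ^ e = i (φ v * v⁻¹) := by
    have hx0 : P.ε (algebraMap F K x) ≠ 0 := (x.isUnit.map (P.ε.comp (algebraMap F K))).ne_zero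
    have hv0' : i v ≠ 0 := (map_ne_zero i).2 hv0
    rw [div_pow, ← map_pow, ← map_pow, hyv', map_mul, map_mul, P.map_base, hφ,
      mul_div_mul_right _ _ hx0, map_mul, map_inv₀, div_eq_mul_inv]
    rfl
  have hw0 : φ v * v⁻¹ ≠ 0 := mul_ne_zero (by simpa using hv0) (inv_ne_zero hv0)
  have hpq' : hD.zeroFieldIncl K (φ v * v⁻¹) * q ^ e = p ^ e := by
    apply P.injective
    rw [map_mul, map_pow, map_pow, ← hpq, mul_pow, hβ]
    rfl
  obtain ⟨δ, hqδ, hδ⟩ := exists_homogeneous_pow_eq (𝒜 := 𝒟) (p := (p : D)) (q := (q : D))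
    (v := DegreeZero.incl 𝒟 (φ v * v⁻¹ : hD.zeroField K)) he0 (fun h => hq (Subtype.ext h))
    (DegreeZero.incl_mem 𝒟 _)
    (fun h => hw0 (Subtype.ext (DegreeZero.incl_injective 𝒟 (h.trans (map_zero _).symm))))
    (congrArg Subtype.val hpq')
  set q₀ : K := ⟨_, hK.homogeneous q q.2 δ⟩ with hq₀
  set p₀ : K := ⟨_, hK.homogeneous p p.2 δ⟩ with hp₀
  obtain ⟨b', hb'K, hb'⟩ := hK.exists_inv δ q₀ q₀.2 (SetLike.coe_mem _) hqδ
  set b : K := ⟨b', hb'K⟩ with hb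
  have hqb : q₀ * b = 1 := Subtype.ext hb'
  have hb0 : (b : D) ∈ 𝒟 (-δ) := by
    obtain ⟨qu, hqu⟩ := isUnit_of_mem (𝒜 := 𝒟) δ (q₀ : D) (SetLike.coe_mem _) hqδ
    have h1 : b' = ((qu⁻¹ : Dˣ) : D) := by
      rw [← hqu] at hb'
      exact (Units.inv_eq_of_mul_eq_one_right hb').symm
    change b' ∈ _
    rw [h1]
    exact inv_mem 𝒟 qu (hqu ▸ SetLike.coe_mem _)
  -- The components p₀ and q₀ have the same degree, so their quotient c has degree 0.
  obtain ⟨c, hc⟩ := hD.exists_zeroFieldIncl_eq (p₀ * b)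
    (mem_of_eq_degree (add_neg_cancel δ) (SetLike.GradedMul.mul_mem (SetLike.coe_mem _) hb0))
  have hce : i c ^ e = i (φ v * v⁻¹) := by
    have h1 : hD.zeroFieldIncl K (φ v * v⁻¹) * q₀ ^ e = p₀ ^ e := Subtype.ext hδ
    have h2 : P.ε q₀ * P.ε b = 1 := by rw [← map_mul, hqb, map_one]
    change P.ε (hD.zeroFieldIncl K c) ^ e = P.ε (hD.zeroFieldIncl K _)
    rw [hc, map_mul, mul_pow, ← map_pow, ← h1, map_mul, map_pow, mul_assoc, ← mul_pow, h2, one_pow,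
      mul_one]
  have hic : i c ≠ 0 := by
    intro h
    rw [h, zero_pow he0] at hce
    exact (map_ne_zero i).2 hw0 hce.symm
  have hroot : (P.Φ (P.ε y) / P.ε y / i c) ^ gradedDegree F D = 1 := by
    rw [← hD.finrank_mul_finrank_zeroField (hD.zeroField K), mul_comm, pow_mul, ← he,
      div_pow _ (i c), hβ, hce, div_self ((map_ne_zero i).2 hw0), one_pow]
  have hζE : IsPrimitiveRoot (i (algebraMap _ _ ζ)) (gradedDegree F D) :=
    (hζ.map_of_injective (algebraMap (DegreeZero ℱ) (hD.zeroField K)).injective).map_of_injective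
      i.injective
  have : NeZero (gradedDegree F D) := ⟨hn.ne'⟩
  obtain ⟨l, -, hl⟩ := hζE.eq_pow_of_pow_eq_one hroot
  refine ⟨hD.zeroFieldIncl K (algebraMap _ _ ζ ^ l * c) * y,
    mem_of_eq_degree (zero_add γ) (SetLike.GradedMul.mul_mem (DegreeZero.incl_mem 𝒟 _) hy), ?_⟩
  rw [map_mul]
  change _ = i _ * _
  rw [map_mul, map_pow, hl, div_mul_cancel₀ _ hic, div_mul_cancel₀ _ hεy]

-- With m = [K₀ : F₀], the iterate Φ^m is trivial on K₀, so it multiplies y by an e-th root of unity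
-- ω. As ω comes from F₀ it is fixed, and iterating e more times multiplies by ω ^ e = 1. Here me is
-- the degree of D.
include hD S hK in
theorem iterate_fractionAut {ζ : DegreeZero ℱ} (hζ : IsPrimitiveRoot ζ (gradedDegree F D))
    {γ : Γ} (y : K) (hy : (y : D) ∈ 𝒟 γ) :
    P.Φ^[gradedDegree F D] (P.ε y) = P.ε y := by
  have hD0 : Nontrivial D := IsGradedDivisionRing.nontrivial (𝒜 := 𝒟)
  have hfin := hD.finiteDimensional
  have hgal := hD.isAbelianGalois S
  have hn := gradedDegree_pos ℱ 𝒟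
  have hiter : ∀ (j : ℕ) (z : E), P.Φ^[j] z = ((P.Φ : RingAut E) ^ j) z := fun j z => by
    induction j with
    | zero => rfl
    | succ j ih => rw [Function.iterate_succ_apply', ih, pow_succ']; rfl
  by_cases hy0 : y = 0
  · rw [hiter, hy0, map_zero, map_zero]
  have hεy : P.ε y ≠ 0 := (map_ne_zero_iff _ P.injective).2 hy0
  obtain ⟨yu, hyu⟩ := isUnit_of_mem (𝒜 := 𝒟) γ (y : D) hy fun h => hy0 (Subtype.ext h)
  set M := hD.zeroField K
  obtain ⟨φ, hφ⟩ := hD.exists_fractionAut_zeroField S P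
  obtain ⟨v, hv0, x, hx, hyv⟩ := hD.pow_finrank_eq S hK yu (hyu ▸ y.2) (hyu ▸ hy)
  set e := Module.finrank M (DegreeZero 𝒟) with he
  set m := Module.finrank (DegreeZero ℱ) M with hm
  have hme : m * e = gradedDegree F D := hD.finrank_mul_finrank_zeroField M
  have hyv' : y ^ e = hD.zeroFieldIncl K v * algebraMap F K x := by
    apply Subtype.ext
    rw [Subalgebra.coe_pow, ← hyu, hyv]
    rfl
  set i : M →+* E := P.ε.comp (hD.zeroFieldIncl K) with hi
  have hφj : ∀ j a, P.Φ^[j] (i a) = i ((φ ^ j) a) := fun j a => by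
    induction j with
    | zero => rfl
    | succ j ih => rw [Function.iterate_succ_apply', ih, pow_succ']; exact hφ _
  have hφm : φ ^ m = 1 := by
    rw [hm, ← IsGalois.card_aut_eq_finrank]; exact pow_card_eq_one'
  have hbase : ∀ j, P.Φ^[j] (P.ε (algebraMap F K x)) = P.ε (algebraMap F K x) := fun j =>
    Function.iterate_fixed (P.map_base _) j
  have hζE : IsPrimitiveRoot (i (algebraMap _ _ ζ)) (gradedDegree F D) :=
    (hζ.map_of_injective (algebraMap (DegreeZero ℱ) M).injective).map_of_injective i.injective
  have hpow : (P.Φ^[m] (P.ε y) / P.ε y) ^ e = 1 := by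
    rw [div_pow, div_eq_one_iff_eq (pow_ne_zero _ hεy), hiter, ← map_pow, ← map_pow, hyv', map_mul,
      map_mul, ← hiter, ← hiter, hbase]
    congr 1
    exact (hφj m v).trans (by rw [hφm]; rfl)
  have : NeZero (gradedDegree F D) := ⟨hn.ne'⟩
  obtain ⟨l, -, hl⟩ := hζE.eq_pow_of_pow_eq_one (ξ := P.Φ^[m] (P.ε y) / P.ε y)
    (by rw [← hme, mul_comm, pow_mul, hpow, one_pow])
  set ω := P.Φ^[m] (P.ε y) / P.ε y with hω
  have hωfix : P.Φ^[m] ω = ω := by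
    rw [← hl, ← map_pow, hφj, hφm]; rfl
  have hy1 : P.Φ^[m] (P.ε y) = ω * P.ε y := by rw [hω, div_mul_cancel₀ _ hεy]
  have hy2 : ∀ j, (P.Φ^[m])^[j] (P.ε y) = ω ^ j * P.ε y := fun j => by
    induction j with
    | zero => simp
    | succ j ih =>
      rw [Function.iterate_succ_apply', ih, hiter, map_mul, map_pow, ← hiter, ← hiter, hωfix, hy1,
        pow_succ, mul_assoc]
  rw [← hme, Function.iterate_mul, hy2, hpow, one_mul]

variable (ℱ) in
include ℱ hK in
/-- The homogeneous elements fixed by the automorphism lie in `F`. -/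
theorem exists_algebraMap_eq_of_fixed {γ : Γ} (a : K) (ha : (a : D) ∈ 𝒟 γ)
    (hfix : P.Φ (P.ε a) = P.ε a) : ∃ f : F, (a : D) = algebraMap F D f := by
  obtain ⟨f, g, hg, h⟩ := P.exists_base _ hfix
  rw [← map_mul] at h
  have h1 : (a : D) * algebraMap F D g = algebraMap F D f := congrArg Subtype.val (P.injective h)
  have h2 : ∃ δ, (DirectSum.decompose ℱ g δ : F) ≠ 0 := by
    by_contra! hcon
    apply hg
    have : DirectSum.decompose ℱ g = 0 := by
      ext δ; simpa using hcon δ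
    simpa using congrArg (DirectSum.decompose ℱ).symm this
  -- A fixed element is a fraction f / g over F. Comparing components in a degree where g is nonzero
  -- replaces g by a homogeneous unit.
  obtain ⟨δ, hδ⟩ := h2
  obtain ⟨u, hu⟩ := isUnit_of_mem (𝒜 := ℱ) δ _ (SetLike.coe_mem _) hδ
  have h3 := DirectSum.coe_decompose_mul_add_of_left_mem 𝒟 (i := γ) (j := δ)
    (b := algebraMap F D g) ha
  rw [h1, decompose_algebraMap ℱ 𝒟, decompose_algebraMap ℱ 𝒟, ← hu] at h3
  refine ⟨(DirectSum.decompose ℱ f (γ + δ) : F) * ((u⁻¹ : Fˣ) : F), ?_⟩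
  rw [map_mul, h3, mul_assoc, ← map_mul, Units.mul_inv, map_one, mul_one]

end

end IsSemiramified

/-! ### A generator of a cyclic maximal graded subfield -/

namespace IsSemiramified

open IsGradedDivisionRing IsGradedAlgebraOver

variable {Γ F D : Type*} [AddCommGroup Γ] [DecidableEq Γ] [IsAddTorsionFree Γ]
  [CommRing F] [Ring D] [Algebra F D]
  {ℱ : Γ → AddSubgroup F} {𝒟 : Γ → AddSubgroup D} [GradedRing ℱ] [GradedRing 𝒟]
  [IsGradedDivisionRing ℱ] [IsGradedDivisionRing 𝒟] [IsGradedAlgebraOver ℱ 𝒟]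
  [Algebra.IsCentral F D] [Module.Finite F D] [IsCommDegreeZero 𝒟]

theorem inv_mem_of_isGradedSubfield {K : Subalgebra F D} (hK : IsGradedSubfield 𝒟 K) {γ : Γ}
    (y : Dˣ) (hyK : (y : D) ∈ K) (hy : (y : D) ∈ 𝒟 γ) : ((y⁻¹ : Dˣ) : D) ∈ K := by
  have := IsGradedDivisionRing.nontrivial (𝒜 := 𝒟)
  obtain ⟨b, hb, h⟩ := hK.exists_inv γ y hyK hy y.ne_zero
  rwa [Units.inv_eq_of_mul_eq_one_right h]

/-- The exponents of the eigenvalues of homogeneous elements. -/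
def eigenExponents {K : Subalgebra F D} (hK : IsGradedSubfield 𝒟 K) {E : Type*} [Field E]
    (P : FractionAut K E) {ξ : E} (hξ : ξ ≠ 0) : AddSubgroup ℤ where
  carrier := {i | ∃ γ, ∃ (y : Dˣ) (hyK : (y : D) ∈ K), (y : D) ∈ 𝒟 γ ∧
    P.Φ (P.ε ⟨y, hyK⟩) = ξ ^ i * P.ε ⟨y, hyK⟩}
  zero_mem' := ⟨0, 1, one_mem K, SetLike.GradedOne.one_mem, by
    change P.Φ (P.ε 1) = ξ ^ (0 : ℤ) * P.ε 1
    simp⟩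
  add_mem' := by
    rintro i j ⟨γ, y, hyK, hy, h⟩ ⟨δ, z, hzK, hz, h'⟩
    refine ⟨γ + δ, y * z, mul_mem hyK hzK, SetLike.GradedMul.mul_mem hy hz, ?_⟩
    change P.Φ (P.ε (⟨y, hyK⟩ * ⟨z, hzK⟩)) = _ * P.ε (⟨y, hyK⟩ * ⟨z, hzK⟩)
    rw [map_mul, map_mul, h, h', zpow_add₀ hξ, mul_mul_mul_comm]
  neg_mem' := by
    rintro i ⟨γ, y, hyK, hy, h⟩
    have hinv := inv_mem_of_isGradedSubfield hK y hyK hy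
    refine ⟨-γ, y⁻¹, hinv, inv_mem 𝒟 y hy, ?_⟩
    have h1 : P.ε ⟨y, hyK⟩ * P.ε ⟨((y⁻¹ : Dˣ) : D), hinv⟩ = 1 := by
      rw [← map_mul, ← map_one P.ε]
      exact congrArg P.ε (Subtype.ext (Units.mul_inv y))
    rw [← inv_eq_of_mul_eq_one_right h1, map_inv₀, h, mul_inv, zpow_neg]

/-- The eigenvalue exponents of homogeneous units of K form a subgroup of the integers; t realises a
generator. Any homogeneous eigenvector divided by a suitable power of t is fixed, hence lies in F,
and eigenvectors span each component of K. -/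
theorem exists_generator (hD : IsSemiramified ℱ 𝒟) (S : HomogeneousFrame ℱ 𝒟)
    {K : Subalgebra F D} (hK : IsGradedSubfield 𝒟 K) {E : Type*} [Field E] (P : FractionAut K E)
    {ζ : DegreeZero ℱ} (hζ : IsPrimitiveRoot ζ (gradedDegree F D)) :
    ∃ γ, ∃ t : Dˣ, (t : D) ∈ K ∧ (t : D) ∈ 𝒟 γ ∧
      (∃ x : F, (t : D) ^ gradedDegree F D = algebraMap F D x) ∧
      ∀ δ, ∀ y ∈ K, y ∈ 𝒟 δ → ∃ (f : ℕ → F) (j : ℕ → ℕ),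
        y = ∑ i ∈ Finset.range (gradedDegree F D), algebraMap F D (f i) * (t : D) ^ j i ∧
        ∀ i, algebraMap F D (f i) * (t : D) ^ j i ∈ 𝒟 δ := by
  have hn := gradedDegree_pos ℱ 𝒟
  set n := gradedDegree F D with hn_def
  set i : DegreeZero ℱ →+* E := (P.ε.comp (algebraMap F K)).comp (DegreeZero.incl ℱ) with hi
  have hζE : IsPrimitiveRoot (i ζ) n := hζ.map_of_injective i.injective
  have hi0 : ∀ c, P.Φ (i c) = i c := fun c => P.map_base _
  have hξ : i ζ ≠ 0 := hζE.ne_zero hn.ne'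
  obtain ⟨a, ha⟩ := Int.subgroup_cyclic (eigenExponents (𝒟 := 𝒟) hK P hξ)
  obtain ⟨γ, t, htK, ht, hΦt⟩ : a ∈ eigenExponents (𝒟 := 𝒟) hK P hξ := by
    rw [ha]; exact AddSubgroup.mem_closure_singleton_self a
  refine ⟨γ, t, htK, ht, ?_, fun δ y hyK hy => ?_⟩
  · refine exists_algebraMap_eq_of_fixed ℱ hK P (⟨t, htK⟩ ^ n) (SetLike.pow_mem_graded n ht) ?_
    rw [map_pow, map_pow, hΦt, mul_pow, ← zpow_natCast, zpow_comm, zpow_natCast, hζE.pow_eq_one,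
      one_zpow, one_mul]
  · set B : AddSubgroup E := AddSubgroup.map (P.ε : K →+ E)
      ((𝒟 δ).comap (K.val : K →+ D)) with hB
    have hBi : ∀ c, ∀ b ∈ B, i c * b ∈ B := by
      rintro c _ ⟨z, hz, rfl⟩
      refine ⟨algebraMap F K (DegreeZero.incl ℱ c) * z, ?_, map_mul P.ε _ _⟩
      have h := SetLike.GradedMul.mul_mem (A := 𝒟)
        (algebraMap_mem (ℱ := ℱ) (𝒟 := 𝒟) 0 _ (DegreeZero.incl_mem ℱ c))
        (show (z : D) ∈ 𝒟 δ from hz)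
      rw [zero_add] at h
      exact h
    obtain ⟨s, hs, hsum⟩ := exists_sum_eigenvectors P.Φ hn hζE (hi0 ζ) B
      (fun b hb => by rw [← map_inv₀]; exact hBi _ b hb)
      (fun b hb => by rw [← map_natCast i, ← map_inv₀]; exact hBi _ b hb)
      (by
        rintro _ ⟨z, hz, rfl⟩
        obtain ⟨z', hz', h⟩ := hD.exists_fractionAut_eq S hK P hζ z hz
        exact ⟨z', hz', h.symm⟩)
      (z := P.ε ⟨y, hyK⟩) ⟨⟨y, hyK⟩, hy, rfl⟩ (hD.iterate_fractionAut S hK P hζ _ hy)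
    choose hsB hsΦ using hs
    choose z hz hzs using hsB
    have hterm : ∀ l, ∃ (f : F) (j : ℕ), (z l : D) = algebraMap F D f * (t : D) ^ j := by
      intro l
      by_cases h0 : z l = 0
      · exact ⟨0, 0, by simp [h0]⟩
      obtain ⟨u, hu⟩ := isUnit_of_mem (𝒜 := 𝒟) δ (z l : D) (hz l) fun h => h0 (Subtype.ext h)
      have hzl : P.Φ (P.ε (z l)) = i ζ ^ l * P.ε (z l) := by
        have := hsΦ l
        rwa [← hzs l] at this
      have hl : (l : ℤ) ∈ eigenExponents (𝒟 := 𝒟) hK P hξ := by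
        refine ⟨δ, u, hu ▸ (z l).2, hu ▸ hz l, ?_⟩
        have : (⟨u, hu ▸ (z l).2⟩ : K) = z l := Subtype.ext hu
        rw [this, zpow_natCast, hzl]
      rw [ha, AddSubgroup.mem_closure_singleton] at hl
      obtain ⟨m, hm⟩ := hl
      -- The exponent m may be negative. Reducing it modulo n keeps the eigenvalue, and the
      -- coefficient f absorbs the change in the power of t.
      obtain ⟨j, hj⟩ : ∃ j : ℕ, (j : ℤ) = m % n :=
        ⟨(m % n).toNat, Int.toNat_of_nonneg (Int.emod_nonneg _ (by exact_mod_cast hn.ne'))⟩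
      have hζj : (i ζ ^ a) ^ j = i ζ ^ l := by
        rw [← zpow_natCast _ l, ← hm, ← zpow_natCast, hj, smul_eq_mul, mul_comm m a, zpow_mul]
        have h1 : (i ζ ^ a) ^ (n : ℤ) = 1 := by
          rw [zpow_comm, zpow_natCast, hζE.pow_eq_one, one_zpow]
        conv_rhs => rw [← Int.emod_add_mul_ediv m n, zpow_add₀ (zpow_ne_zero _ hξ), zpow_mul, h1,
          one_zpow, mul_one]
      have htinv := inv_mem_of_isGradedSubfield hK t htK ht
      have htε : P.ε ⟨t, htK⟩ * P.ε ⟨((t⁻¹ : Dˣ) : D), htinv⟩ = 1 := by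
        rw [← map_mul, ← map_one P.ε]
        exact congrArg P.ε (Subtype.ext (Units.mul_inv t))
      obtain ⟨f, hf⟩ := exists_algebraMap_eq_of_fixed ℱ hK P
        (z l * (⟨((t⁻¹ : Dˣ) : D), htinv⟩ : K) ^ j)
        (SetLike.GradedMul.mul_mem (hz l) (SetLike.pow_mem_graded j (inv_mem 𝒟 t ht))) (by
          have hne : (i ζ ^ a) ^ j ≠ 0 := pow_ne_zero _ (zpow_ne_zero _ hξ)
          rw [map_mul, map_mul, hzl, map_pow, map_pow, ← inv_eq_of_mul_eq_one_right htε, map_inv₀,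
            hΦt, mul_inv, mul_pow, inv_pow, ← hζj]
          field_simp)
      refine ⟨f, j, ?_⟩
      rw [← hf]
      change _ = (z l : D) * ((t⁻¹ : Dˣ) : D) ^ j * (t : D) ^ j
      rw [mul_assoc, ← Units.val_pow_eq_pow_val, ← Units.val_pow_eq_pow_val, inv_pow, Units.inv_mul,
        mul_one]
    choose f j hfj using hterm
    refine ⟨f, j, ?_, fun l => hfj l ▸ hz l⟩
    have h1 : (⟨y, hyK⟩ : K) = ∑ l ∈ Finset.range n, z l := by
      apply P.injective
      rw [hsum, map_sum]
      exact Finset.sum_congr rfl fun l _ => (hzs l).symm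
    have h2 := congrArg Subtype.val h1
    rw [AddSubmonoidClass.coe_finsetSum] at h2
    rw [← Finset.sum_congr rfl fun l _ => hfj l]
    exact h2

end IsSemiramified

/-! ### Cyclicity in terms of the crossed product -/

/-- The fixed field of a generator of the Galois group. -/
theorem exists_algebraMap_eq_of_apply_eq {k E : Type*} [Field k] [Field E] [Algebra k E]
    [IsGalois k E] {σ : E ≃ₐ[k] E} (hσ : Subgroup.zpowers σ = ⊤) {a : E} (h : σ a = a) :
    ∃ b, algebraMap k E b = a := by
  have h1 : a ∈ (⊥ : IntermediateField k E) := by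
    rw [InfiniteGalois.mem_bot_iff_fixed]
    intro f
    exact (IntermediateField.mem_fixedField_iff _ _).1 (mem_fixedField_zpowers.2 h) f
      (hσ ▸ Subgroup.mem_top f)
  exact IntermediateField.mem_bot.1 h1

theorem orderOf_eq_finrank_of_zpowers_eq_top {k E : Type*} [Field k] [Field E] [Algebra k E]
    [FiniteDimensional k E] [IsGalois k E] {σ : E ≃ₐ[k] E} (hσ : Subgroup.zpowers σ = ⊤) :
    orderOf σ = Module.finrank k E := by
  rw [← Nat.card_zpowers, hσ, Subgroup.card_top, IsGalois.card_aut_eq_finrank]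

namespace IsSemiramified

open IsGradedDivisionRing IsGradedAlgebraOver

variable {Γ F D : Type*} [AddCommGroup Γ] [DecidableEq Γ] [IsAddTorsionFree Γ]
  [CommRing F] [Ring D] [Algebra F D]
  {ℱ : Γ → AddSubgroup F} {𝒟 : Γ → AddSubgroup D} [GradedRing ℱ] [GradedRing 𝒟]
  [IsGradedDivisionRing ℱ] [IsGradedDivisionRing 𝒟] [IsGradedAlgebraOver ℱ 𝒟]
  [Algebra.IsCentral F D] [Module.Finite F D] [IsCommDegreeZero 𝒟]

variable (ℱ 𝒟) in
theorem exists_incl_eq_of_algebraMap_mem {g : F} (hg : algebraMap F D g ∈ 𝒟 0) :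
    ∃ c : DegreeZero ℱ, DegreeZero.incl ℱ c = g := by
  have h := decompose_algebraMap ℱ 𝒟 g 0
  rw [DirectSum.decompose_of_mem_same 𝒟 hg] at h
  refine ⟨DegreeZero.ofMem ℱ g ?_, rfl⟩
  rw [algebraMap_injective ℱ 𝒟 h]
  exact SetLike.coe_mem _

theorem commute_zeroUnit_baseUnit (w : (DegreeZero 𝒟)ˣ) (c : Fˣ) :
    Commute (zeroUnit 𝒟 w) (baseUnit F D c) :=
  (baseUnit_comm c _).symm

/-- A homogeneous unit commuting with `M`, as an automorphism of `D₀ / M`. -/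
noncomputable def conjZeroOver (M : IntermediateField (DegreeZero ℱ) (DegreeZero 𝒟)) {γ : Γ}
    (y : Dˣ) (hy : (y : D) ∈ 𝒟 γ)
    (h : ∀ a ∈ M, (y : D) * DegreeZero.incl 𝒟 a = DegreeZero.incl 𝒟 a * y) :
    DegreeZero 𝒟 ≃ₐ[M] DegreeZero 𝒟 :=
  AlgEquiv.ofRingEquiv (f := (conjZero ℱ 𝒟 y hy).toRingEquiv) fun a =>
    DegreeZero.incl_injective 𝒟 (by
      change DegreeZero.incl 𝒟 (conjZero ℱ 𝒟 y hy a) = _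
      rw [incl_conjZero, h _ a.2, mul_assoc, Units.mul_inv, mul_one]
      rfl)

theorem exists_of_isCyclicGradedAlgebra (hD : IsSemiramified ℱ 𝒟) (S : HomogeneousFrame ℱ 𝒟)
    {ζ : DegreeZero ℱ} (hζ : IsPrimitiveRoot ζ (gradedDegree F D))
    (h : IsCyclicGradedAlgebra ℱ 𝒟) :
    ∃ M : IntermediateField (DegreeZero ℱ) (DegreeZero 𝒟),
      (IsCyclicGalois (DegreeZero ℱ) M ∧ IsCyclicGalois M (DegreeZero 𝒟)) ∧
      ∃ (σ : DegreeZero 𝒟 ≃ₐ[M] DegreeZero 𝒟) (u : KUM (DegreeZero ℱ) M),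
        Subgroup.zpowers σ = ⊤ ∧
        Subgroup.zpowers (u : kum (DegreeZero ℱ) M) = ⊤ ∧
        BrauerSimilar M (M ⊗[DegreeZero ℱ] CrossedProduct (hD.factorSet S))
          (CyclicAlgebra σ (hD.orderOf_pos M σ) u) := by
  have hD0 : Nontrivial D := IsGradedDivisionRing.nontrivial (𝒜 := 𝒟)
  have hnzd : NoZeroDivisors D := IsGradedDivisionRing.noZeroDivisors 𝒟
  have hfin := hD.finiteDimensional
  have hgal := hD.isAbelianGalois S
  have hn := gradedDegree_pos ℱ 𝒟
  obtain ⟨K, hK, hcyc⟩ := h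
  obtain ⟨E, _, ⟨P⟩⟩ := hcyc.exists_fractionAut
  obtain ⟨γ, t, htK, ht, ⟨g, hg⟩, hgenK⟩ := hD.exists_generator S hK.prop P hζ
  set M := hD.zeroField K with hM
  set σ := conjZeroOver M t ht fun a ha => hK.prop.comm _ htK _ ha with hσ
  have hσk : σ.restrictScalars (DegreeZero ℱ) = conjZero ℱ 𝒟 t ht := rfl
  have hσa : ∀ a, (t : D) * DegreeZero.incl 𝒟 a = DegreeZero.incl 𝒟 (σ a) * t := fun a => by
    change _ = DegreeZero.incl 𝒟 (conjZero ℱ 𝒟 t ht a) * t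
    rw [incl_conjZero, mul_assoc, Units.inv_mul, mul_one]
  have hgen : Subgroup.zpowers σ = ⊤ := by
    have hfixed : IntermediateField.fixedField (Subgroup.zpowers σ) = ⊥ := by
      rw [eq_bot_iff]
      intro a ha
      have ha' : σ a = a := mem_fixedField_zpowers.1 ha
      have hcomm : Commute (DegreeZero.incl 𝒟 a) (t : D) := by
        have := hσa a
        rw [ha'] at this
        exact this.symm
      -- An element of D₀ fixed by σ commutes with t, hence with K = F[t]; maximality places it in
      -- K₀ = M. So M is the fixed field of ⟨σ⟩.
      have haM : a ∈ M := hD.mem_of_commute hK (DegreeZero.incl_mem 𝒟 a) fun δ y hyK hy => by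
        obtain ⟨f, j, hyf, -⟩ := hgenK δ y hyK hy
        rw [hyf]
        exact Commute.sum_right _ _ _ fun i _ =>
          (Algebra.commute_algebraMap_right _ _).mul_right (hcomm.pow_right _)
      exact IntermediateField.mem_bot.2 ⟨⟨a, haM⟩, rfl⟩
    rw [← IntermediateField.fixingSubgroup_fixedField (Subgroup.zpowers σ), hfixed,
      IntermediateField.fixingSubgroup_bot]
  set e := orderOf σ with he
  have hme : e * Module.finrank (DegreeZero ℱ) M = gradedDegree F D := by
    rw [mul_comm, he, orderOf_eq_finrank_of_zpowers_eq_top hgen, hD.finrank_mul_finrank_zeroField]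
  set m := Module.finrank (DegreeZero ℱ) M with hm
  have hσpow : ∀ (l : ℕ) a, (conjZero ℱ 𝒟 t ht ^ l) a = (σ ^ l) a := fun l a => by
    induction l with
    | zero => rfl
    | succ l ih => rw [pow_succ', pow_succ', AlgEquiv.mul_apply, ih]; rfl
  have hσke : conjZero ℱ 𝒟 t ht ^ e = 1 := by
    ext a
    rw [hσpow, he, pow_orderOf_eq_one]
    rfl
  obtain ⟨w, c, hc, htw⟩ := hD.eq_mul_autUnit S t ht
  -- With the w of t = w c z_σ, the same N governs t ^ e in D and (w x_σ) ^ e in the crossed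
  -- product.
  obtain ⟨c', x, hx, hpow⟩ := hD.exists_pow_eq_of_pow_eq_one S _ hσke
  obtain ⟨hpow1, hpow2⟩ := hpow w
  set N := (∏ i ∈ Finset.range e, Units.map ((conjZero ℱ 𝒟 t ht ^ i :
      DegreeZero 𝒟 ≃ₐ[DegreeZero ℱ] DegreeZero 𝒟) : DegreeZero 𝒟 →* DegreeZero 𝒟) w) * c' with hN
  have hte : t ^ e = zeroUnit 𝒟 N * baseUnit F D (c ^ e * x) := by
    have h1 : t = zeroUnit 𝒟 w * hD.autUnit S (conjZero ℱ 𝒟 t ht) * baseUnit F D c := by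
      conv_lhs => rw [htw]
      rw [mul_assoc, baseUnit_comm, mul_assoc]
    have h2 : Commute (zeroUnit 𝒟 w * hD.autUnit S (conjZero ℱ 𝒟 t ht)) (baseUnit F D c) :=
      (baseUnit_comm c _).symm
    rw [h1, h2.mul_pow, hpow1, ← map_pow, mul_assoc, ← map_mul, mul_comm x]
  set X := c ^ e * x with hX
  have htel : ∀ l, t ^ (e * l) = zeroUnit 𝒟 (N ^ l) * baseUnit F D (X ^ l) := fun l => by
    rw [pow_mul, hte, (commute_zeroUnit_baseUnit N X).mul_pow, map_pow, map_pow]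
  have hNM : (N : DegreeZero 𝒟) ∈ M := by
    change DegreeZero.incl 𝒟 (N : DegreeZero 𝒟) ∈ K
    have h1 : zeroUnit 𝒟 N = t ^ e * baseUnit F D X⁻¹ := by
      rw [hte, map_inv, mul_inv_cancel_right]
    rw [← coe_zeroUnit, h1, Units.val_mul, Units.val_pow_eq_pow_val]
    exact mul_mem (pow_mem htK e) (K.algebraMap_mem _)
  set NM : Mˣ := Units.mk0 ⟨(N : DegreeZero 𝒟), hNM⟩ (fun h0 => N.ne_zero (congrArg Subtype.val h0))
    with hNM_def
  have hNMval : algebraMap M (DegreeZero 𝒟) NM = N := rfl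
  have htop : IntermediateField.adjoin (DegreeZero ℱ) {(NM : M)} = ⊤ := by
    rw [eq_top_iff]
    intro a _
    obtain ⟨f, j, hyf, hdeg⟩ := hgenK 0 _ a.2 (DegreeZero.incl_mem 𝒟 (a : DegreeZero 𝒟))
    have hmemK : ∀ i, algebraMap F D (f i) * (t : D) ^ j i ∈ K := fun i =>
      mul_mem (K.algebraMap_mem _) (pow_mem htK _)
    let b : ℕ → M := fun i => ⟨DegreeZero.ofMem 𝒟 _ (hdeg i), hmemK i⟩
    have hab : a = ∑ i ∈ Finset.range (gradedDegree F D), b i := by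
      apply Subtype.ext
      apply DegreeZero.incl_injective 𝒟
      rw [hyf, AddSubmonoidClass.coe_finsetSum, map_sum]
      rfl
    rw [hab]
    refine sum_mem fun i _ => ?_
    by_cases hf0 : f i = 0
    · have : b i = 0 := Subtype.ext (DegreeZero.incl_injective 𝒟 (by
        change algebraMap F D (f i) * (t : D) ^ j i = _
        rw [hf0, map_zero, zero_mul]
        exact (map_zero (DegreeZero.incl 𝒟)).symm))
      rw [this]
      exact zero_mem _
    have hf0' : algebraMap F D (f i) ≠ 0 := fun h =>
      hf0 (algebraMap_injective ℱ 𝒟 (h.trans (map_zero _).symm))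
    -- A nonzero monomial f t ^ j of degree 0 lies in the commutative ring D₀, so t ^ j acts
    -- trivially and e divides j. The monomial is then a power of N times an element of F₀.
    have hconj : conjZero ℱ 𝒟 t ht ^ j i = 1 := by
      rw [← conjZero_pow t ht]
      ext l
      apply DegreeZero.incl_injective 𝒟
      rw [incl_conjZero, Units.mul_inv_eq_iff_eq_mul, Units.val_pow_eq_pow_val]
      apply mul_left_cancel₀ hf0'
      have h1 := IsCommDegreeZero.comm (𝒜 := 𝒟) _ _ (hdeg i) (DegreeZero.incl_mem 𝒟 l)
      rw [← mul_assoc, h1, ← mul_assoc, ← mul_assoc, ← Algebra.commutes]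
      rfl
    have hdvd : e ∣ j i := by
      rw [he]
      apply orderOf_dvd_of_pow_eq_one
      ext l
      rw [← hσpow, hconj]
      rfl
    obtain ⟨l, hl⟩ := hdvd
    have hs : algebraMap F D (f i) * (t : D) ^ j i
        = DegreeZero.incl 𝒟 ((N : DegreeZero 𝒟) ^ l) * algebraMap F D (f i * (X ^ l : Fˣ)) := by
      rw [hl, ← Units.val_pow_eq_pow_val, htel, Units.val_mul, coe_zeroUnit, coe_baseUnit,
        Units.val_pow_eq_pow_val, map_mul, ← mul_assoc, ← mul_assoc, Algebra.commutes]
    have hg0 : algebraMap F D (f i * (X ^ l : Fˣ)) ∈ 𝒟 0 := by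
      have h1 : algebraMap F D (f i * (X ^ l : Fˣ))
          = DegreeZero.incl 𝒟 ((N ^ l)⁻¹ : (DegreeZero 𝒟)ˣ)
            * (algebraMap F D (f i) * (t : D) ^ j i) := by
        rw [hs, ← mul_assoc, ← map_mul, ← Units.val_pow_eq_pow_val, Units.inv_mul, map_one, one_mul]
      rw [h1]
      exact mem_of_eq_degree (add_zero 0) (SetLike.GradedMul.mul_mem (DegreeZero.incl_mem 𝒟 _) (hdeg i))
    obtain ⟨g', hg'⟩ := exists_incl_eq_of_algebraMap_mem ℱ 𝒟 hg0
    have hbi : b i = (NM : M) ^ l * algebraMap (DegreeZero ℱ) M g' := by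
      apply Subtype.ext
      apply DegreeZero.incl_injective 𝒟
      change algebraMap F D (f i) * (t : D) ^ j i = _
      rw [hs, ← hg']
      rfl
    rw [hbi]
    exact mul_mem (pow_mem (IntermediateField.mem_adjoin_simple_self _ _) l)
      (IntermediateField.algebraMap_mem _ _)
  -- From t ^ n in F and n = em, the power N ^ m lies in F and has degree 0.
  have hNm : ∃ r : DegreeZero ℱ, (NM : M) ^ m = algebraMap (DegreeZero ℱ) M r := by
    have h1 : DegreeZero.incl 𝒟 ((N : DegreeZero 𝒟) ^ m)
        = algebraMap F D (g * ((X ^ m)⁻¹ : Fˣ)) := by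
      have h2 := congrArg Units.val (htel m)
      rw [hme, Units.val_pow_eq_pow_val, hg, Units.val_mul, coe_zeroUnit, coe_baseUnit,
        Units.val_pow_eq_pow_val] at h2
      rw [map_mul, h2, mul_assoc, ← map_mul, Units.mul_inv, map_one, mul_one]
    obtain ⟨r, hr⟩ := exists_incl_eq_of_algebraMap_mem ℱ 𝒟
      (h1 ▸ DegreeZero.incl_mem 𝒟 ((N : DegreeZero 𝒟) ^ m))
    refine ⟨r, Subtype.ext (DegreeZero.incl_injective 𝒟 ?_)⟩
    change DegreeZero.incl 𝒟 ((N : DegreeZero 𝒟) ^ m) = algebraMap F D (DegreeZero.incl ℱ r)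
    rw [h1, hr]
  obtain ⟨r, hr⟩ := hNm
  have hζm : IsPrimitiveRoot (ζ ^ e) m := hζ.pow hn hme.symm
  have hMcyc : IsCyclicGalois (DegreeZero ℱ) M :=
    isCyclicGalois_of_adjoin_eq_top Module.finrank_pos hζm hr NM.ne_zero htop
  have hLM : IsCyclicGalois M (DegreeZero 𝒟) :=
    ⟨inferInstance, ⟨σ, fun τ => (hgen ▸ Subgroup.mem_top τ : τ ∈ Subgroup.zpowers σ)⟩⟩
  refine ⟨M, ⟨hMcyc, hLM⟩, σ, ⟨NM, (mem_KUM_iff hMcyc NM).2 ⟨r, hr.symm⟩⟩, hgen,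
    zpowers_kum_eq_top_of_adjoin_eq_top hMcyc hζm _ htop, ?_⟩
  obtain ⟨θ⟩ := CrossedProduct.nonempty_tensorProduct_algEquiv_matrix_cyclicAlgebra
    (hD.factorSet S) (fun _ => rfl) M σ (hD.orderOf_pos M σ) hgen w NM hpow2
  exact brauerSimilar_of_algEquiv_matrix Module.finrank_pos.ne' θ

end IsSemiramified

/-! ### Construction of a cyclic maximal graded subfield. -/

namespace IsSemiramified

open IsGradedDivisionRing IsGradedAlgebraOver

variable {Γ F D : Type*} [AddCommGroup Γ] [DecidableEq Γ] [IsAddTorsionFree Γ]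
  [CommRing F] [Ring D] [Algebra F D]
  {ℱ : Γ → AddSubgroup F} {𝒟 : Γ → AddSubgroup D} [GradedRing ℱ] [GradedRing 𝒟]
  [IsGradedDivisionRing ℱ] [IsGradedDivisionRing 𝒟] [IsGradedAlgebraOver ℱ 𝒟]
  [Algebra.IsCentral F D] [Module.Finite F D] [IsCommDegreeZero 𝒟]

/-- The subalgebra generated by a homogeneous unit is a graded subfield. -/
theorem isGradedSubfield_adjoin_singleton (hD : IsSemiramified ℱ 𝒟) {γ : Γ} {t : D}
    (ht : t ∈ 𝒟 γ) : IsGradedSubfield 𝒟 (Algebra.adjoin F {t}) := by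
  refine hD.isGradedSubfield (decompose_mem_adjoin ℱ 𝒟 ?_) fun a ha b hb => ?_
  · rintro _ rfl
    exact ⟨γ, ht⟩
  · have h1 : Commute t b := Algebra.commute_of_mem_adjoin_of_forall_mem_commute hb (by
      rintro _ rfl
      exact Commute.refl _)
    exact (Algebra.commute_of_mem_adjoin_of_forall_mem_commute ha (by
      rintro _ rfl
      exact h1.symm)).symm

theorem isCyclicExtension_adjoin_singleton (hD : IsSemiramified ℱ 𝒟) {ζ : DegreeZero ℱ}
    (hζ : IsPrimitiveRoot ζ (gradedDegree F D)) {γ : Γ} {t : D} (ht : t ∈ 𝒟 γ) (ht0 : t ≠ 0) {g : F}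
    (hg : t ^ gradedDegree F D = algebraMap F D g) :
    (hD.isGradedSubfield_adjoin_singleton ht).IsCyclicExtension ℱ := by
  unfold IsGradedSubfield.IsCyclicExtension
  have : IsDomain F := IsGradedDivisionRing.isDomain ℱ
  refine @isCyclicFractionExtension_of_adjoin_eq_top F (Algebra.adjoin F {t}) _ _ (_) (_) (_) (_)
    (gradedDegree F D) (gradedDegree_pos ℱ 𝒟) (DegreeZero.incl ℱ ζ)
    (hζ.map_of_injective (DegreeZero.incl_injective ℱ))
    ⟨t, Algebra.self_mem_adjoin_singleton F t⟩ (fun h => ht0 (congrArg Subtype.val h)) g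
    (Subtype.ext hg) ?_
  have h := Algebra.adjoin_adjoin_coe_preimage (R := F) (s := ({t} : Set D))
  have hs : ((↑) : Algebra.adjoin F {t} → D) ⁻¹' {t}
      = {⟨t, Algebra.self_mem_adjoin_singleton F t⟩} := by
    ext x
    exact (Subtype.ext_iff (a1 := x) (a2 := ⟨t, Algebra.self_mem_adjoin_singleton F t⟩)).symm
  rw [hs] at h
  exact h

theorem isCyclicGradedAlgebra_of_exists (hD : IsSemiramified ℱ 𝒟) (S : HomogeneousFrame ℱ 𝒟)
    {ζ : DegreeZero ℱ} (hζ : IsPrimitiveRoot ζ (gradedDegree F D))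
    (M : IntermediateField (DegreeZero ℱ) (DegreeZero 𝒟))
    (hM : IsCyclicGalois (DegreeZero ℱ) M) (σ : DegreeZero 𝒟 ≃ₐ[M] DegreeZero 𝒟)
    (u : KUM (DegreeZero ℱ) M) (hσ : Subgroup.zpowers σ = ⊤)
    (hu : Subgroup.zpowers (u : kum (DegreeZero ℱ) M) = ⊤)
    (hB : BrauerSimilar M (M ⊗[DegreeZero ℱ] CrossedProduct (hD.factorSet S))
      (CyclicAlgebra σ (hD.orderOf_pos M σ) u)) :
    IsCyclicGradedAlgebra ℱ 𝒟 := by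
  have hfin := hD.finiteDimensional
  have hgal := hD.isAbelianGalois S
  have hn := gradedDegree_pos ℱ 𝒟
  set σk := σ.restrictScalars (DegreeZero ℱ) with hσk
  set e := orderOf σ with he
  have hσpow : ∀ (l : ℕ) a, (σk ^ l) a = (σ ^ l) a := fun l a => by
    induction l with
    | zero => rfl
    | succ l ih => rw [pow_succ', pow_succ', AlgEquiv.mul_apply, ih]; rfl
  have hσke : σk ^ e = 1 := by
    ext a
    rw [hσpow, he, pow_orderOf_eq_one]
    rfl
  have hme : e * Module.finrank (DegreeZero ℱ) M = gradedDegree F D := by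
    rw [mul_comm, he, orderOf_eq_finrank_of_zpowers_eq_top hσ, hD.finrank_mul_finrank_zeroField]
  set m := Module.finrank (DegreeZero ℱ) M with hm
  obtain ⟨c, x, hx, hpow⟩ := hD.exists_pow_eq_of_pow_eq_one S σk hσke
  obtain ⟨hp1, hp2⟩ := hpow 1
  simp only [map_one, Finset.prod_const_one, one_mul] at hp1 hp2
  -- Up to F, c is the e-th power of z_σ and so commutes with z_σ, which acts as σ.
  have hcfix : σ c = c := by
    set T := hD.autUnit S σk with hT
    have h1 : Commute T (zeroUnit 𝒟 c) := by
      have h2 : zeroUnit 𝒟 c = T ^ e * (baseUnit F D x)⁻¹ := by rw [hp1, mul_inv_cancel_right]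
      rw [h2]
      exact (Commute.self_pow T e).mul_right
        (show Commute (baseUnit F D x) T from baseUnit_comm x T).symm.inv_right
    have h2 := hD.autUnit_mul_zeroUnit S σk c
    rw [h1.eq] at h2
    exact (DegreeZero.incl_injective 𝒟 (congrArg Units.val (mul_right_cancel h2))).symm
  obtain ⟨v₀, hv₀⟩ := exists_algebraMap_eq_of_apply_eq hσ hcfix
  have hv0 : v₀ ≠ 0 := by
    rintro rfl
    rw [map_zero] at hv₀
    exact c.ne_zero hv₀.symm
  obtain ⟨θ⟩ := CrossedProduct.nonempty_tensorProduct_algEquiv_matrix_cyclicAlgebra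
    (hD.factorSet S) (fun _ => rfl) M σ (hD.orderOf_pos M σ) hσ 1 (Units.mk0 v₀ hv0)
    (by rw [Units.val_mk0, hv₀]; exact hp2)
  obtain ⟨b, hb⟩ := exists_norm_eq_of_brauerSimilar σ (hD.orderOf_pos M σ) hσ u (Units.mk0 v₀ hv0)
    θ hB
  set U : (DegreeZero 𝒟)ˣ := Units.map (algebraMap M (DegreeZero 𝒟) : M →* DegreeZero 𝒟) u with hU
  -- Multiplying z_σ by b changes its e-th power by the norm of b, which replaces the invariant v₀
  -- of the crossed product by u.
  set t := zeroUnit 𝒟 b * hD.autUnit S σk with ht_def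
  have hte : t ^ e = zeroUnit 𝒟 U * baseUnit F D x := by
    rw [ht_def, (hpow b).1]
    congr 2
    apply Units.ext
    rw [hU, Units.val_mul, Units.coe_prod]
    change _ = algebraMap M (DegreeZero 𝒟) ((u : Mˣ) : M)
    rw [hb, Units.val_mk0, hv₀]
    congr 1
    exact Finset.prod_congr rfl fun i _ => hσpow i b
  obtain ⟨γ, ht⟩ : ∃ γ, (t : D) ∈ 𝒟 γ :=
    ⟨_, SetLike.GradedMul.mul_mem (zeroUnit_mem b) (hD.autUnit_mem S σk)⟩
  have hconj : conjZero ℱ 𝒟 t ht = σk := by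
    rw [← hD.conjZero_autUnit S σk]
    exact conjZero_eq_of_eq_mul ℱ 𝒟 _ _ _ _ b 1 (by rw [map_one, mul_one]; rfl)
  obtain ⟨r, hr⟩ := (mem_KUM_iff hM u).1 u.2
  have htn : (t : D) ^ gradedDegree F D = algebraMap F D (DegreeZero.incl ℱ r * (x ^ m : Fˣ)) := by
    rw [← hme, ← Units.val_pow_eq_pow_val, pow_mul, hte, (commute_zeroUnit_baseUnit U x).mul_pow,
      ← map_pow, ← map_pow, map_mul, ← incl_algebraMap ℱ 𝒟, Units.val_mul]
    congr 1
    · rw [coe_zeroUnit, IsScalarTower.algebraMap_apply (DegreeZero ℱ) M (DegreeZero 𝒟), hr, map_pow,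
        Units.val_pow_eq_pow_val]
      rfl
    · rw [← map_pow]
      rfl
  have htK : (t : D) ∈ Algebra.adjoin F {(t : D)} := Algebra.self_mem_adjoin_singleton F _
  have hζm : IsPrimitiveRoot (ζ ^ e) m := hζ.pow hn hme.symm
  -- The element u generates M over F₀ and equals t ^ e up to a unit of F.
  have hMK : M ≤ hD.zeroField (Algebra.adjoin F {(t : D)}) := by
    have h1 := congrArg IntermediateField.lift (adjoin_eq_top_of_zpowers_kum_eq_top hM hζm u hu)
    rw [IntermediateField.lift_adjoin_simple, IntermediateField.lift_top] at h1
    rw [← h1, IntermediateField.adjoin_simple_le_iff, mem_zeroField]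
    have h2 : zeroUnit 𝒟 U = t ^ e * baseUnit F D x⁻¹ := by
      rw [hte, map_inv, mul_inv_cancel_right]
    change (zeroUnit 𝒟 U : D) ∈ _
    rw [h2, Units.val_mul (t ^ e), Units.val_pow_eq_pow_val]
    exact mul_mem (pow_mem htK e) (Subalgebra.algebraMap_mem _ _)
  refine ⟨Algebra.adjoin F {(t : D)},
    ⟨hD.isGradedSubfield_adjoin_singleton ht, fun K' hK' hle => ?_⟩,
    hD.isCyclicExtension_adjoin_singleton hζ ht ?_ htn⟩
  · have htK' : (t : D) ∈ K' := hle htK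
    refine subset_of_decompose_mem 𝒟 (K := (K' : Set D))
      (B := (Algebra.adjoin F {(t : D)}).toSubring.toAddSubgroup) fun a ha δ => ?_
    change (DirectSum.decompose 𝒟 a δ : D) ∈ Algebra.adjoin F {(t : D)}
    by_cases h0 : (DirectSum.decompose 𝒟 a δ : D) = 0
    · rw [h0]; exact zero_mem _
    obtain ⟨y, hy⟩ := isUnit_of_mem (𝒜 := 𝒟) δ _ (SetLike.coe_mem _) h0
    have hyδ : (y : D) ∈ 𝒟 δ := hy ▸ SetLike.coe_mem _
    have hyK : (y : D) ∈ K' := hy ▸ hK'.homogeneous a ha δ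
    rw [← hy]
    have hcomm : ∀ l ∈ M, (y : D) * DegreeZero.incl 𝒟 l = DegreeZero.incl 𝒟 l * y := fun l hl =>
      hK'.comm _ hyK _ (hle (hMK hl))
    -- A homogeneous y in a larger graded subfield commutes with M, so it acts on D₀ as some power
    -- of σ and equals w f t ^ i with w in D₀ and f in F.
    obtain ⟨i, hi⟩ : ∃ i : ℕ, σ ^ i = conjZeroOver M y hyδ hcomm := by
      have h1 : conjZeroOver M y hyδ hcomm ∈ Subgroup.zpowers σ := hσ ▸ Subgroup.mem_top _
      rwa [← mem_powers_iff_mem_zpowers] at h1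
    have hconjy : conjZero ℱ 𝒟 y hyδ = conjZero ℱ 𝒟 (t ^ i) (pow_mem_graded t ht i) := by
      rw [conjZero_pow t ht, hconj]
      ext l
      rw [hσpow, hi]
      rfl
    obtain ⟨w, f, hf, hyw⟩ := hD.eq_mul_of_conjZero_eq S _ _ _ _ hconjy
    have hwK : (zeroUnit 𝒟 w : D) ∈ K' := by
      have h1 : zeroUnit 𝒟 w = y * (t⁻¹) ^ i * baseUnit F D f⁻¹ := by
        rw [hyw, map_inv, inv_pow, mul_inv_cancel_right, mul_inv_cancel_right]
      rw [h1, Units.val_mul, Units.val_mul, Units.val_pow_eq_pow_val]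
      exact mul_mem (mul_mem hyK (pow_mem (inv_mem_of_isGradedSubfield hK' t htK' ht) i))
        (K'.algebraMap_mem _)
    -- The remaining factor w lies in the larger subfield, so it commutes with t and is fixed by σ;
    -- it belongs to M, which F[t] already contains.
    have hwfix : σ (w : DegreeZero 𝒟) = w := by
      apply DegreeZero.incl_injective 𝒟
      change DegreeZero.incl 𝒟 (σk w) = _
      rw [← hconj, incl_conjZero, hK'.comm _ htK' (DegreeZero.incl 𝒟 w) hwK, mul_assoc, Units.mul_inv, mul_one]
    obtain ⟨l, hl⟩ := exists_algebraMap_eq_of_apply_eq hσ hwfix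
    have hwM : (w : DegreeZero 𝒟) ∈ M := hl ▸ l.2
    rw [hyw, Units.val_mul, Units.val_mul, Units.val_pow_eq_pow_val]
    exact mul_mem (mul_mem (hMK hwM) (Subalgebra.algebraMap_mem _ _)) (pow_mem htK i)
  · have := IsGradedDivisionRing.nontrivial (𝒜 := 𝒟)
    exact t.ne_zero

end IsSemiramified

theorem theorem2p14 {Γ F D : Type*} [AddCommGroup Γ] [IsAddTorsionFree Γ] [DecidableEq Γ]
    [CommRing F] [Ring D] [Algebra F D]
    (ℱ : Γ → AddSubgroup F) (𝒟 : Γ → AddSubgroup D) [GradedRing ℱ] [GradedRing 𝒟]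
    [IsGradedDivisionRing ℱ] [IsGradedDivisionRing 𝒟] [IsGradedAlgebraOver ℱ 𝒟]
    [Algebra.IsCentral F D] [Module.Finite F D] [IsCommDegreeZero 𝒟]
    (hD : IsSemiramified ℱ 𝒟) (S : HomogeneousFrame ℱ 𝒟)
    (hζ : ∃ ζ : DegreeZero ℱ, IsPrimitiveRoot ζ (gradedDegree F D)) :
    IsCyclicGradedAlgebra ℱ 𝒟 ↔
      ∃ M : IntermediateField (DegreeZero ℱ) (DegreeZero 𝒟),
        (IsCyclicGalois (DegreeZero ℱ) M ∧ IsCyclicGalois M (DegreeZero 𝒟)) ∧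
        ∃ (σ : DegreeZero 𝒟 ≃ₐ[M] DegreeZero 𝒟) (u : KUM (DegreeZero ℱ) M),
          Subgroup.zpowers σ = ⊤ ∧
          Subgroup.zpowers (u : kum (DegreeZero ℱ) M) = ⊤ ∧
          BrauerSimilar M (M ⊗[DegreeZero ℱ] CrossedProduct (hD.factorSet S))
            (CyclicAlgebra σ (hD.orderOf_pos M σ) u) := by
  obtain ⟨ζ, hζ⟩ := hζ
  refine ⟨hD.exists_of_isCyclicGradedAlgebra S hζ, ?_⟩
  rintro ⟨M, ⟨hM, -⟩, σ, u, hσ, hu, hB⟩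
  exact hD.isCyclicGradedAlgebra_of_exists S hζ M hM σ u hσ hu hB
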